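/- Let $\Phi(t)=\frac{1}{\sqrt{2\pi}}\int_{-\infty}^t e^{-x^2/2}\,dx$, and let $G_{n,p}$ denote the random graph on a vertex set $V$ of size $n$ in which each potential edge is included independently with probability $p\in[0,1]$. For each $\varepsilon>0$ there are constants $C>0$ and $q\in(0,1)$, depending only on $\varepsilon$, such that whenever $np(1-p)>C$ and $G\sim G_{n,p}$, with probability at least $1-q^n$ the following holds simultaneously for every $\delta\in(\varepsilon,1-\varepsilon)$, every real $\alpha$ and every $R\subseteq V$: if $$|R|\ \ge\ \frac n2+\alpha\sqrt{\frac{n(1-p)}{p}}\qquad\text{and}\qquad \sup_{0\le\gamma\le 2} e^{-\gamma^2/2}\left[\Phi\!\left(\frac{\gamma-2\alpha}{\sqrt{1-\delta}}\right)\right]^{\delta}\ \le\ \frac14-\varepsilon,$$ then at most $\delta n$ vertices of $G$ have at least as many neighbours in $V\setminus R$ as in $R$. In particular, the supremum condition is satisfied for $\varepsilon=10^{-10}$, $\delta=0.499$ and $\alpha=0.85$. Hence there are absolute constants $C>0$ and $q\in(0,1)$ such that whenever $np(1-p)>C$, with probability at least $1-q^n$ every $R\subseteq V$ with $|R|\ge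 \frac n2+0.85\sqrt{n(1-p)/p}$ has the property that at most $0.499\,n$ vertices of $G$ have at least as many neighbours in $V\setminus R$ as in $R$. -/

import Mathlib

/-- The standard normal distribution function `Φ`. -/
noncomputable def stdNormalCDF (t : ℝ) : ℝ :=
  ProbabilityTheory.cdf (ProbabilityTheory.gaussianReal 0 1) t

/-- `sup_{0 ≤ γ ≤ 2} e^{-γ²/2} Φ((γ - 2α)/√(1-δ))^δ`. The supremum is over a nonempty family which,
for `0 ≤ δ`, takes values in `[0, 1]`. -/
noncomputable def leadSup (α δ : ℝ) : ℝ :=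
  ⨆ γ : Set.Icc (0 : ℝ) 2,
    Real.exp (-(γ : ℝ) ^ 2 / 2) * stdNormalCDF (((γ : ℝ) - 2 * α) / √(1 - δ)) ^ δ

/-- The vertices of `G` that have at least as many neighbours outside `R` as inside `R`. -/
def unconvinced {V : Type*} (G : SimpleGraph V) (R : Set V) : Set V :=
  {v | (G.neighborSet v ∩ R).ncard ≤ (G.neighborSet v ∩ Rᶜ).ncard}

/-!
Give each vertex `u` the spin `s u = 1` if `u ∈ R` and `s u = -1` otherwise. In units of the
standard deviation of a degree, a vertex `v` is unconvinced by `R` when, up to a small error,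
`β + X v ≤ 0`, where `X v = n ^ (-1 / 2) * ∑ u, s u * x s(u, v)` is a sum of standardized edge
indicators and the mean field `β` is at least `2 α`. It has to be shown that for a fixed `R` the
event that a fraction `δ` of the vertices is unconvinced has probability at most `(1 / 2 - c) ^ n`;
this beats the number `2 ^ n` of choices of `R`.

*The condition on the supremum.* It is used only through its consequence `Φ(-2α) ^ δ ≤ 1 / 4 - ε`
(`stdNormalCDF_rpow_le_of_leadSup`). Indeed `Φ(-2α)` is the average of `Φ((√δ Z - 2α) / √(1 - δ))`
over a standard normal `Z`, and averaging the tangent of the concave function `log Φ` at a critical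
point `c` of the exponent reproduces the value of the exponent at `c`.

*Gaussian edges.* The probability that exactly the vertices of `S` are unconvinced is at most the
mean of a product over the vertices of smoothed indicators. Each edge enters only two of the
factors, so Lindeberg's exchange argument (`lintegral_fieldWeight_le`) replaces the at most `n ^ 2`
edge indicators by Gaussian variables at the cost of a factor `exp (K n / √(n p (1 - p)))`, which is
absorbed by taking `n p (1 - p)` large. For Gaussian edges `X` has the law of
`√(1 - 2 / n) ξ v + s v Z / √n` with `Z` and all `ξ v` independent and standard normal
(`map_localField_gaussian`): conditionally on `γ = Z / √n` the vertices are independent, and `v` is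
unconvinced with probability close to `Φ(-β - s v γ)`.

*Summation over `S`.* A Chernoff bound with a tilt `t ≥ 1` per unconvinced vertex, over the almost
equally many vertices of either spin, bounds the sum over the sets `S` of size `δ n` by
`t ^ (-δ n) ((1 + t Φ(γ - β)) (1 + t Φ(-γ - β))) ^ (n / 2)`. The analytic core, `exists_tilt`, is
that for `|γ| ≤ 1.18` some `t` makes this at most `(√ρ / 2) ^ n exp (n γ ^ 2 / 2)` with a `ρ < 1`
depending only on `ε`; the last exponential cancels the density of `Z`. Larger values of `γ` have
probability at most `0.499 ^ n`, since `1.18 ^ 2 / 2 > log 2` (`lintegral_configSum_le`). At `γ = 0`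
and `t = 1 / Φ(-β)` the inequality says precisely that `Φ(-β) ^ δ < 1 / 4`; for other `γ` it rests
on bounds for the second derivative of `log Φ`, that is on Mills ratio inequalities.

*Uniformity.* Removing vertices from `R` only enlarges the set of unconvinced vertices, so it
suffices to treat sets with bounded mean field, with the actual fraction of unconvinced vertices in
the role of `δ` (`exists_bounded_of_bad`). A union bound over these sets and fractions gives
`exists_const_binomialRandom_unconvinced`, which is uniform in `δ`, `α` and `R`.

For `δ = 0.499` and `α = 0.85` the supremum is bounded by replacing `log Φ` by its tangent at
`-0.9`, after which the exponent is a quadratic polynomial in `γ` (`leadSup_numeric`).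
-/

open MeasureTheory ProbabilityTheory Filter Topology Set

/-! ### The standard normal distribution function -/

/-- The standard normal density `x ↦ exp (-x ^ 2 / 2) / √(2π)`. -/
noncomputable def stdNormalPDF (x : ℝ) : ℝ :=
  (√(2 * Real.pi))⁻¹ * Real.exp (-x ^ 2 / 2)

lemma gaussianPDFReal_zero_one (x : ℝ) : gaussianPDFReal 0 1 x = stdNormalPDF x := by
  simp [gaussianPDFReal, stdNormalPDF]

lemma stdNormalPDF_pos (x : ℝ) : 0 < stdNormalPDF x := by
  unfold stdNormalPDF; positivity

lemma stdNormalPDF_neg (x : ℝ) : stdNormalPDF (-x) = stdNormalPDF x := by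
  simp [stdNormalPDF]

lemma hasDerivAt_stdNormalPDF (x : ℝ) :
    HasDerivAt stdNormalPDF (-x * stdNormalPDF x) x := by
  have h1 : HasDerivAt (fun x : ℝ ↦ -x ^ 2 / 2) (-x) x := by
    have := ((hasDerivAt_pow 2 x).neg).div_const 2
    refine HasDerivAt.congr_deriv this ?_
    push_cast
    ring
  have h2 := (h1.exp).const_mul (√(2 * Real.pi))⁻¹
  refine HasDerivAt.congr_deriv h2 ?_
  simp only [stdNormalPDF]; ring

lemma continuous_stdNormalPDF : Continuous stdNormalPDF :=
  continuous_iff_continuousAt.2 fun x ↦ (hasDerivAt_stdNormalPDF x).continuousAt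

lemma inv_sqrt_two_pi_le : (√(2 * Real.pi))⁻¹ ≤ 1 / 2 := by
  rw [inv_le_comm₀ (by positivity) (by norm_num)]
  apply Real.le_sqrt_of_sq_le
  nlinarith [Real.pi_gt_three]

lemma stdNormalPDF_le_half (x : ℝ) : stdNormalPDF x ≤ 1 / 2 := by
  unfold stdNormalPDF
  have h1 : Real.exp (-x ^ 2 / 2) ≤ 1 := Real.exp_le_one_iff.2 (by nlinarith [sq_nonneg x])
  calc _ ≤ (1 / 2 : ℝ) * 1 := mul_le_mul inv_sqrt_two_pi_le h1 (by positivity) (by norm_num)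
    _ = 1 / 2 := by norm_num

lemma integrable_stdNormalPDF : Integrable stdNormalPDF := by
  have := integrable_gaussianPDFReal 0 1
  exact this.congr (.of_forall gaussianPDFReal_zero_one)

lemma stdNormalCDF_eq_integral (x : ℝ) : stdNormalCDF x = ∫ y in Iic x, stdNormalPDF y := by
  unfold stdNormalCDF
  rw [cdf_eq_real, measureReal_def, gaussianReal_apply_eq_integral 0 one_ne_zero,
    ENNReal.toReal_ofReal]
  · simp only [gaussianPDFReal_zero_one]
  · exact integral_nonneg fun y ↦ gaussianPDFReal_nonneg _ _ _

lemma hasDerivAt_stdNormalCDF (x : ℝ) : HasDerivAt stdNormalCDF (stdNormalPDF x) x := by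
  have h : ∀ y, stdNormalCDF y = stdNormalCDF 0 + ∫ t in (0 : ℝ)..y, stdNormalPDF t := fun y ↦ by
    rw [← intervalIntegral.integral_Iic_sub_Iic integrable_stdNormalPDF.integrableOn
      integrable_stdNormalPDF.integrableOn, ← stdNormalCDF_eq_integral, ← stdNormalCDF_eq_integral]
    ring
  rw [funext h]
  exact (intervalIntegral.integral_hasDerivAt_right
    (continuous_stdNormalPDF.intervalIntegrable _ _)
    (continuous_stdNormalPDF.stronglyMeasurableAtFilter _ _)
    continuous_stdNormalPDF.continuousAt).const_add _

lemma continuous_stdNormalCDF : Continuous stdNormalCDF :=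
  continuous_iff_continuousAt.2 fun x ↦ (hasDerivAt_stdNormalCDF x).continuousAt

lemma strictMono_stdNormalCDF : StrictMono stdNormalCDF :=
  strictMono_of_deriv_pos fun x ↦ by
    rw [(hasDerivAt_stdNormalCDF x).deriv]; exact stdNormalPDF_pos x

lemma tendsto_stdNormalCDF_atBot : Tendsto stdNormalCDF atBot (𝓝 0) := tendsto_cdf_atBot _

lemma tendsto_stdNormalCDF_atTop : Tendsto stdNormalCDF atTop (𝓝 1) := tendsto_cdf_atTop _

lemma stdNormalCDF_le_one (x : ℝ) : stdNormalCDF x ≤ 1 := cdf_le_one _ _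

lemma stdNormalCDF_pos (x : ℝ) : 0 < stdNormalCDF x :=
  (cdf_nonneg _ (x - 1)).trans_lt (strictMono_stdNormalCDF (by linarith))

lemma stdNormalCDF_neg (x : ℝ) : stdNormalCDF (-x) = 1 - stdNormalCDF x := by
  have hd : ∀ y, HasDerivAt (fun y ↦ stdNormalCDF y + stdNormalCDF (-y)) 0 y := fun y ↦ by
    have h1 := (hasDerivAt_stdNormalCDF (-y)).comp y (hasDerivAt_neg y)
    have h2 := (hasDerivAt_stdNormalCDF y).add h1
    refine HasDerivAt.congr_deriv h2 ?_
    rw [stdNormalPDF_neg]; ring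
  have hc : ∀ y, stdNormalCDF y + stdNormalCDF (-y) = stdNormalCDF x + stdNormalCDF (-x) := fun y ↦
    is_const_of_deriv_eq_zero (fun z ↦ (hd z).differentiableAt) (fun z ↦ (hd z).deriv) y x
  have hl : Tendsto (fun y ↦ stdNormalCDF y + stdNormalCDF (-y)) atTop (𝓝 (1 + 0)) :=
    tendsto_stdNormalCDF_atTop.add (tendsto_stdNormalCDF_atBot.comp tendsto_neg_atTop_atBot)
  rw [funext hc] at hl
  have := tendsto_nhds_unique hl tendsto_const_nhds
  linarith

lemma stdNormalCDF_zero : stdNormalCDF 0 = 1 / 2 := by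
  have := stdNormalCDF_neg 0
  rw [neg_zero] at this
  linarith

lemma abs_stdNormalCDF_sub_le (x y : ℝ) : |stdNormalCDF x - stdNormalCDF y| ≤ |x - y| := by
  have := Convex.norm_image_sub_le_of_norm_hasDerivWithin_le (f := stdNormalCDF)
    (f' := stdNormalPDF) (s := univ) (x := y) (y := x) (C := 1)
    (fun z _ ↦ (hasDerivAt_stdNormalCDF z).hasDerivWithinAt)
    (fun z _ ↦ by
      rw [Real.norm_of_nonneg (stdNormalPDF_pos z).le]
      linarith [stdNormalPDF_le_half z]) convex_univ (mem_univ _) (mem_univ _)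
  simpa using this

/-! ### Mills ratio inequalities -/

lemma tendsto_pow_mul_stdNormalPDF (k : ℕ) :
    Tendsto (fun x : ℝ ↦ x ^ k * stdNormalPDF x) atTop (𝓝 0) := by
  have h1 : Tendsto (fun x : ℝ ↦ x ^ k * Real.exp (-x)) atTop (𝓝 0) :=
    Real.tendsto_pow_mul_exp_neg_atTop_nhds_zero k
  refine tendsto_of_tendsto_of_tendsto_of_le_of_le' tendsto_const_nhds h1 ?_ ?_
  · filter_upwards [eventually_ge_atTop 0] with x hx
    have := stdNormalPDF_pos x
    positivity
  · filter_upwards [eventually_ge_atTop 2] with x hx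
    gcongr
    have h2 : Real.exp (-x ^ 2 / 2) ≤ Real.exp (-x) := Real.exp_le_exp.2 (by nlinarith)
    unfold stdNormalPDF
    have h3 := inv_sqrt_two_pi_le
    have h4 := Real.exp_pos (-x ^ 2 / 2)
    nlinarith

/-- The upper tail `1 - Φ` of the standard normal law, as a function of a positive argument. -/
noncomputable def stdNormalTail (x : ℝ) : ℝ := stdNormalCDF (-x)

lemma stdNormalTail_pos (x : ℝ) : 0 < stdNormalTail x := stdNormalCDF_pos _

lemma hasDerivAt_stdNormalTail (x : ℝ) : HasDerivAt stdNormalTail (-stdNormalPDF x) x := by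
  have h1 := (hasDerivAt_stdNormalCDF (-x)).comp x (hasDerivAt_neg x)
  refine HasDerivAt.congr_deriv h1 ?_
  rw [stdNormalPDF_neg]; ring

lemma tendsto_stdNormalTail : Tendsto stdNormalTail atTop (𝓝 0) :=
  tendsto_stdNormalCDF_atBot.comp tendsto_neg_atTop_atBot

/-- A function that decreases on `[0, ∞)` to the limit `0` is nonnegative there. -/
lemma nonneg_of_deriv_nonpos_of_tendsto {k k' : ℝ → ℝ} (hk : ∀ x, HasDerivAt k (k' x) x)
    (hk' : ∀ x, 0 ≤ x → k' x ≤ 0) (hlim : Tendsto k atTop (𝓝 0)) {x : ℝ} (hx : 0 ≤ x) :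
    0 ≤ k x := by
  have hanti : AntitoneOn k (Ici 0) := by
    refine antitoneOn_of_deriv_nonpos (convex_Ici 0)
      (fun y _ ↦ (hk y).continuousAt.continuousWithinAt)
      (fun y _ ↦ (hk y).differentiableAt.differentiableWithinAt) fun y hy ↦ ?_
    rw [(hk y).deriv]
    rw [interior_Ici] at hy
    exact hk' y (le_of_lt hy)
  refine le_of_tendsto hlim ?_
  filter_upwards [eventually_ge_atTop x] with y hy
  exact hanti hx (hx.trans hy) hy

/-- The bound `1 - Φ(x) ≤ φ(x) / x`. It is the start of a chain: each of the inequalities below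
follows from an earlier one, which gives the sign of the derivative of the difference of the two
sides, and from the vanishing of this difference at infinity. -/
lemma mul_stdNormalTail_le {x : ℝ} (hx : 0 ≤ x) : x * stdNormalTail x ≤ stdNormalPDF x := by
  -- That `x (1 - Φ(x))` vanishes at infinity is itself a consequence of this bound, so the
  -- inequality is first divided by `x`.
  rcases hx.eq_or_lt with rfl | hx
  · simpa using (stdNormalPDF_pos 0).le
  have hd : ∀ y, 0 < y →
      HasDerivAt (fun y ↦ stdNormalPDF y / y - stdNormalTail y) (-stdNormalPDF y / y ^ 2) y := by
    intro y hy
    have := ((hasDerivAt_stdNormalPDF y).div (hasDerivAt_id y) hy.ne').sub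
      (hasDerivAt_stdNormalTail y)
    refine HasDerivAt.congr_deriv this ?_
    simp only [id]
    field_simp
    ring
  have hanti : AntitoneOn (fun y ↦ stdNormalPDF y / y - stdNormalTail y) (Ioi 0) := by
    refine antitoneOn_of_deriv_nonpos (convex_Ioi 0)
      (fun y hy ↦ (hd y hy).continuousAt.continuousWithinAt) (fun y hy ↦ ?_) fun y hy ↦ ?_
    · rw [interior_Ioi] at hy
      exact (hd y hy).differentiableAt.differentiableWithinAt
    · rw [interior_Ioi] at hy
      rw [(hd y hy).deriv, neg_div]
      have := stdNormalPDF_pos y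
      have : 0 ≤ stdNormalPDF y / y ^ 2 := by positivity
      linarith
  have hlim : Tendsto (fun y ↦ stdNormalPDF y / y - stdNormalTail y) atTop (𝓝 (0 - 0)) := by
    refine Tendsto.sub ?_ tendsto_stdNormalTail
    have h0 := tendsto_pow_mul_stdNormalPDF 0
    simp only [pow_zero, one_mul] at h0
    exact h0.div_atTop tendsto_id
  rw [sub_zero] at hlim
  have : 0 ≤ stdNormalPDF x / x - stdNormalTail x := by
    refine le_of_tendsto hlim ?_
    filter_upwards [eventually_ge_atTop x] with y hy
    exact hanti hx (hx.trans_le hy) hy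
  rw [sub_nonneg, le_div_iff₀ hx] at this
  linarith

lemma tendsto_pow_mul_stdNormalTail (k : ℕ) :
    Tendsto (fun x : ℝ ↦ x ^ k * stdNormalTail x) atTop (𝓝 0) := by
  refine tendsto_of_tendsto_of_tendsto_of_le_of_le' tendsto_const_nhds
    (tendsto_pow_mul_stdNormalPDF k) ?_ ?_
  · filter_upwards [eventually_ge_atTop 0] with x hx
    have := stdNormalTail_pos x
    positivity
  · filter_upwards [eventually_ge_atTop 1] with x hx
    gcongr
    have := mul_stdNormalTail_le (x := x) (by linarith)
    have h2 := stdNormalTail_pos x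
    nlinarith

lemma mul_stdNormalPDF_le {x : ℝ} (hx : 0 ≤ x) :
    x * stdNormalPDF x ≤ (1 + x ^ 2) * stdNormalTail x := by
  have h := nonneg_of_deriv_nonpos_of_tendsto
    (k := fun y ↦ (1 + y ^ 2) * stdNormalTail y - y * stdNormalPDF y)
    (k' := fun y ↦ 2 * (y * stdNormalTail y - stdNormalPDF y))
    (fun y ↦ by
      have h1 := (((hasDerivAt_pow 2 y).const_add 1).mul (hasDerivAt_stdNormalTail y)).sub
        ((hasDerivAt_id y).mul (hasDerivAt_stdNormalPDF y))
      refine HasDerivAt.congr_deriv h1 ?_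
      simp only [id]; push_cast; ring)
    (fun y hy ↦ by linarith [mul_stdNormalTail_le hy])
    (by
      have h0 := (((tendsto_pow_mul_stdNormalTail 0).add (tendsto_pow_mul_stdNormalTail 2)).sub
        (tendsto_pow_mul_stdNormalPDF 1))
      convert h0 using 2
      · ring
      · simp) hx
  linarith

/-- An upper bound for the tail by a convergent of its continued fraction. -/
lemma mul_stdNormalTail_le' {x : ℝ} (hx : 0 ≤ x) :
    (x ^ 3 + 3 * x) * stdNormalTail x ≤ (x ^ 2 + 2) * stdNormalPDF x := by
  have h := nonneg_of_deriv_nonpos_of_tendsto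
    (k := fun y ↦ (y ^ 2 + 2) * stdNormalPDF y - (y ^ 3 + 3 * y) * stdNormalTail y)
    (k' := fun y ↦ 3 * (y * stdNormalPDF y - (1 + y ^ 2) * stdNormalTail y))
    (fun y ↦ by
      have h1 := (((hasDerivAt_pow 2 y).add_const 2).mul (hasDerivAt_stdNormalPDF y)).sub
        (((hasDerivAt_pow 3 y).add ((hasDerivAt_id y).const_mul 3)).mul
          (hasDerivAt_stdNormalTail y))
      refine HasDerivAt.congr_deriv h1 ?_
      simp only [id, Pi.add_apply]; push_cast; ring)
    (fun y hy ↦ by linarith [mul_stdNormalPDF_le hy])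
    (by
      have h0 := (((tendsto_pow_mul_stdNormalPDF 2).add
        ((tendsto_pow_mul_stdNormalPDF 0).const_mul 2)).sub
        ((tendsto_pow_mul_stdNormalTail 3).add ((tendsto_pow_mul_stdNormalTail 1).const_mul 3)))
      convert h0 using 2
      · ring
      · simp) hx
  linarith

/-- The quadratic forms in `φ` and `1 - Φ` whose signs are determined below vanish at infinity. -/
lemma tendsto_quadratic_form_tail (a b c : ℝ) (k : ℕ) :
    Tendsto (fun x : ℝ ↦ a * stdNormalPDF x ^ 2 + b * (x ^ k * stdNormalPDF x * stdNormalTail x)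
      + c * stdNormalTail x ^ 2) atTop (𝓝 0) := by
  have h1 := tendsto_pow_mul_stdNormalPDF 0
  have h2 := tendsto_pow_mul_stdNormalPDF k
  have h3 := tendsto_stdNormalTail
  simp only [pow_zero, one_mul] at h1
  have := (((h1.pow 2).const_mul a).add ((h2.mul h3).const_mul b)).add ((h3.pow 2).const_mul c)
  convert this using 2
  simp

/-- With `m = φ(x) / Φ(-x)`, this is `m (m - x) ≥ 1 / 2`: it says that `log Φ` has second derivative
at most `-1 / 2` on the negative half line. -/
lemma half_sq_stdNormalTail_le {x : ℝ} (hx : 0 ≤ x) :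
    1 / 2 * stdNormalTail x ^ 2 ≤
      stdNormalPDF x * (stdNormalPDF x - x * stdNormalTail x) := by
  have h := nonneg_of_deriv_nonpos_of_tendsto
    (k := fun y ↦ 1 * stdNormalPDF y ^ 2 + (-1) * (y ^ 1 * stdNormalPDF y * stdNormalTail y)
      + (-1 / 2) * stdNormalTail y ^ 2)
    (k' := fun y ↦ -(y * stdNormalPDF y * (stdNormalPDF y - y * stdNormalTail y)))
    (fun y ↦ by
      have hf := hasDerivAt_stdNormalPDF y
      have hq := hasDerivAt_stdNormalTail y
      have h1 := (((hf.pow 2).const_mul 1).add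
        ((((hasDerivAt_pow 1 y).mul hf).mul hq).const_mul (-1))).add ((hq.pow 2).const_mul (-1 / 2))
      refine HasDerivAt.congr_deriv h1 ?_
      simp only [Pi.mul_apply]; push_cast; ring)
    (fun y hy ↦ by
      have h1 := mul_stdNormalTail_le hy
      have h2 := stdNormalPDF_pos y
      have : 0 ≤ y * stdNormalPDF y * (stdNormalPDF y - y * stdNormalTail y) :=
        mul_nonneg (by positivity) (by linarith)
      linarith)
    (tendsto_quadratic_form_tail _ _ _ _) hx
  simp only [pow_one] at h
  nlinarith

/-- With `m = φ(x) / Φ(-x)`, this is `m (m - x) ≤ 1`. -/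
lemma le_sq_stdNormalTail {x : ℝ} (hx : 0 ≤ x) :
    stdNormalPDF x * (stdNormalPDF x - x * stdNormalTail x) ≤ stdNormalTail x ^ 2 := by
  have h := nonneg_of_deriv_nonpos_of_tendsto
    (k := fun y ↦ (-1) * stdNormalPDF y ^ 2 + 1 * (y ^ 1 * stdNormalPDF y * stdNormalTail y)
      + 1 * stdNormalTail y ^ 2)
    (k' := fun y ↦ -(stdNormalPDF y * ((1 + y ^ 2) * stdNormalTail y - y * stdNormalPDF y)))
    (fun y ↦ by
      have hf := hasDerivAt_stdNormalPDF y
      have hq := hasDerivAt_stdNormalTail y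
      have h1 := (((hf.pow 2).const_mul (-1)).add
        ((((hasDerivAt_pow 1 y).mul hf).mul hq).const_mul 1)).add ((hq.pow 2).const_mul 1)
      refine HasDerivAt.congr_deriv h1 ?_
      simp only [Pi.mul_apply]; push_cast; ring)
    (fun y hy ↦ by
      have h1 := mul_stdNormalPDF_le hy
      have h2 := stdNormalPDF_pos y
      have : 0 ≤ stdNormalPDF y * ((1 + y ^ 2) * stdNormalTail y - y * stdNormalPDF y) :=
        mul_nonneg h2.le (by linarith)
      linarith)
    (tendsto_quadratic_form_tail _ _ _ _) hx
  simp only [pow_one] at h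
  nlinarith

/-! ### Log-concavity of the normal distribution function -/

/-- The logarithmic derivative `Φ' / Φ` of the standard normal distribution function. -/
noncomputable def stdNormalHazard (u : ℝ) : ℝ := stdNormalPDF u / stdNormalCDF u

lemma stdNormalHazard_pos (u : ℝ) : 0 < stdNormalHazard u :=
  div_pos (stdNormalPDF_pos u) (stdNormalCDF_pos u)

lemma hasDerivAt_log_stdNormalCDF (u : ℝ) :
    HasDerivAt (fun u ↦ Real.log (stdNormalCDF u)) (stdNormalHazard u) u :=
  (hasDerivAt_stdNormalCDF u).log (stdNormalCDF_pos u).ne'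

lemma hasDerivAt_stdNormalHazard (u : ℝ) :
    HasDerivAt stdNormalHazard (-(stdNormalHazard u * (stdNormalHazard u + u))) u := by
  have h := (hasDerivAt_stdNormalPDF u).div (hasDerivAt_stdNormalCDF u) (stdNormalCDF_pos u).ne'
  refine HasDerivAt.congr_deriv h ?_
  have := (stdNormalCDF_pos u).ne'
  unfold stdNormalHazard
  field_simp
  ring

lemma stdNormalHazard_add_nonneg (u : ℝ) : 0 ≤ stdNormalHazard u + u := by
  rcases le_total 0 u with hu | hu
  · linarith [stdNormalHazard_pos u]
  · have h := mul_stdNormalTail_le (x := -u) (by linarith)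
    simp only [stdNormalTail, neg_neg, stdNormalPDF_neg] at h
    unfold stdNormalHazard
    rw [← neg_le_iff_add_nonneg, le_div_iff₀ (stdNormalCDF_pos u)]
    exact h

/-- The right side is minus the second derivative of `log Φ`, which is thus uniformly concave on the
negative half line. -/
lemma half_le_stdNormalHazard {u : ℝ} (hu : u ≤ 0) :
    1 / 2 ≤ stdNormalHazard u * (stdNormalHazard u + u) := by
  have h := half_sq_stdNormalTail_le (x := -u) (by linarith)
  simp only [stdNormalTail, neg_neg, stdNormalPDF_neg] at h
  have hp := stdNormalCDF_pos u
  have : stdNormalHazard u * (stdNormalHazard u + u) =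
      stdNormalPDF u * (stdNormalPDF u - -u * stdNormalCDF u) / stdNormalCDF u ^ 2 := by
    unfold stdNormalHazard; field_simp; ring
  rw [this, le_div_iff₀ (by positivity)]
  exact h

/-- The left side is minus the second derivative of `log Φ`. -/
lemma stdNormalHazard_le_one {u : ℝ} (hu : u ≤ 0) :
    stdNormalHazard u * (stdNormalHazard u + u) ≤ 1 := by
  have h := le_sq_stdNormalTail (x := -u) (by linarith)
  simp only [stdNormalTail, neg_neg, stdNormalPDF_neg] at h
  have hp := stdNormalCDF_pos u
  have : stdNormalHazard u * (stdNormalHazard u + u) =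
      stdNormalPDF u * (stdNormalPDF u - -u * stdNormalCDF u) / stdNormalCDF u ^ 2 := by
    unfold stdNormalHazard; field_simp; ring
  rw [this, div_le_one (by positivity)]
  exact h

/-- A function with antitone derivative lies below its tangents. -/
lemma le_tangent_of_antitoneOn {g g' : ℝ → ℝ} {s : Set ℝ} (hs : s.OrdConnected)
    (hg : ∀ x, HasDerivAt g (g' x) x) (hg' : AntitoneOn g' s) {a x : ℝ} (ha : a ∈ s)
    (hx : x ∈ s) : g x ≤ g a + g' a * (x - a) := by
  have hc : Continuous g := continuous_iff_continuousAt.2 fun y ↦ (hg y).continuousAt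
  rcases lt_trichotomy x a with h | rfl | h
  · obtain ⟨c, hc, hc'⟩ := exists_hasDerivAt_eq_slope g g' h hc.continuousOn fun y _ ↦ hg y
    have h1 : g' a ≤ g' c := hg' (hs.out hx ha ⟨hc.1.le, hc.2.le⟩) ha hc.2.le
    rw [hc', le_div_iff₀ (by linarith)] at h1
    linarith
  · simp
  · obtain ⟨c, hc, hc'⟩ := exists_hasDerivAt_eq_slope g g' h hc.continuousOn fun y _ ↦ hg y
    have h1 : g' c ≤ g' a := hg' ha (hs.out ha hx ⟨hc.1.le, hc.2.le⟩) hc.1.le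
    rw [hc', div_le_iff₀ (by linarith)] at h1
    linarith

lemma antitone_stdNormalHazard : Antitone stdNormalHazard :=
  antitone_of_deriv_nonpos (fun u ↦ (hasDerivAt_stdNormalHazard u).differentiableAt) fun u ↦ by
    rw [(hasDerivAt_stdNormalHazard u).deriv, neg_nonpos]
    exact mul_nonneg (stdNormalHazard_pos u).le (stdNormalHazard_add_nonneg u)

/-- Log-concavity of `Φ`, in tangent form. -/
lemma stdNormalCDF_le_mul_exp (u v : ℝ) :
    stdNormalCDF v ≤ stdNormalCDF u * Real.exp (stdNormalHazard u * (v - u)) := by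
  have h := le_tangent_of_antitoneOn ordConnected_univ hasDerivAt_log_stdNormalCDF
    (antitone_stdNormalHazard.antitoneOn _) (mem_univ u) (mem_univ v)
  rw [← Real.log_le_log_iff (stdNormalCDF_pos v)
    (mul_pos (stdNormalCDF_pos u) (Real.exp_pos _)), Real.log_mul (stdNormalCDF_pos u).ne'
    (Real.exp_pos _).ne', Real.log_exp]
  exact h

/-- Quantitative log-concavity of `Φ` on the negative half line, in tangent form. -/
lemma stdNormalCDF_le_mul_exp_sub {u v : ℝ} (hu : u ≤ 0) (hv : v ≤ 0) :
    stdNormalCDF v ≤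
      stdNormalCDF u * Real.exp (stdNormalHazard u * (v - u) - (v - u) ^ 2 / 4) := by
  have hg : ∀ y, HasDerivAt (fun y ↦ Real.log (stdNormalCDF y) + y ^ 2 / 4)
      (stdNormalHazard y + y / 2) y := fun y ↦ by
    refine HasDerivAt.congr_deriv
      ((hasDerivAt_log_stdNormalCDF y).add ((hasDerivAt_pow 2 y).div_const 4)) ?_
    push_cast; ring
  have hg2 : ∀ y, HasDerivAt (fun y ↦ stdNormalHazard y + y / 2)
      (-(stdNormalHazard y * (stdNormalHazard y + y)) + 1 / 2) y := fun y ↦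
    (hasDerivAt_stdNormalHazard y).add ((hasDerivAt_id y).div_const 2)
  have hanti : AntitoneOn (fun y ↦ stdNormalHazard y + y / 2) (Iic 0) := by
    refine antitoneOn_of_deriv_nonpos (convex_Iic 0)
      (fun y _ ↦ (hg2 y).continuousAt.continuousWithinAt)
      (fun y _ ↦ (hg2 y).differentiableAt.differentiableWithinAt) fun y hy ↦ ?_
    rw [(hg2 y).deriv]
    rw [interior_Iic] at hy
    linarith [half_le_stdNormalHazard (le_of_lt hy)]
  have h := le_tangent_of_antitoneOn ordConnected_Iic hg hanti hu hv
  rw [← Real.log_le_log_iff (stdNormalCDF_pos v)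
    (mul_pos (stdNormalCDF_pos u) (Real.exp_pos _)), Real.log_mul (stdNormalCDF_pos u).ne'
    (Real.exp_pos _).ne', Real.log_exp]
  nlinarith

/-! ### Gaussian averages of the normal distribution function -/

lemma gaussianReal_const_mul_Iic {τ : ℝ} (hτ : 0 < τ) (c : ℝ) :
    ((gaussianReal 0 1).map (τ * ·)) (Iic c) = ENNReal.ofReal (stdNormalCDF (c / τ)) := by
  rw [Measure.map_apply (by fun_prop) measurableSet_Iic, stdNormalCDF, ofReal_cdf]
  congr 1
  ext x
  simp [le_div_iff₀ hτ, mul_comm]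

/-- Averaging a normal distribution function over an independent normal shift. -/
lemma lintegral_stdNormalCDF {s τ : ℝ} (hτ : 0 < τ) (c : ℝ) :
    ∫⁻ x, ENNReal.ofReal (stdNormalCDF ((c - s * x) / τ)) ∂(gaussianReal 0 1) =
      ENNReal.ofReal (stdNormalCDF (c / √(τ ^ 2 + s ^ 2))) := by
  have hρ : 0 < √(τ ^ 2 + s ^ 2) := Real.sqrt_pos.2 (by positivity)
  have h1 : ((gaussianReal 0 1).map (s * ·)).conv ((gaussianReal 0 1).map (τ * ·)) =
      (gaussianReal 0 1).map (√(τ ^ 2 + s ^ 2) * ·) := by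
    rw [gaussianReal_map_const_mul, gaussianReal_map_const_mul, gaussianReal_map_const_mul,
      gaussianReal_conv_gaussianReal]
    congr 1
    · simp
    · ext
      simp only [NNReal.coe_add, NNReal.coe_mk, mul_one]
      rw [Real.sq_sqrt (by positivity)]; ring
  rw [← gaussianReal_const_mul_Iic hρ, ← h1, Measure.conv,
    Measure.map_apply (by fun_prop) measurableSet_Iic,
    Measure.prod_apply (measurableSet_Iic.preimage (by fun_prop)), lintegral_map]
  · refine lintegral_congr fun x ↦ ?_
    rw [← gaussianReal_const_mul_Iic hτ]
    congr 1
    ext y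
    simp only [mem_Iic, mem_preimage]
    constructor <;> intro h <;> linarith
  · exact measurable_measure_prodMk_left (measurableSet_Iic.preimage (by fun_prop))
  · fun_prop

lemma integral_stdNormalCDF {s τ : ℝ} (hτ : 0 < τ) (c : ℝ) :
    ∫ x, stdNormalCDF ((c - s * x) / τ) ∂(gaussianReal 0 1) =
      stdNormalCDF (c / √(τ ^ 2 + s ^ 2)) := by
  rw [integral_eq_lintegral_of_nonneg_ae (.of_forall fun x ↦ (stdNormalCDF_pos _).le),
    lintegral_stdNormalCDF hτ, ENNReal.toReal_ofReal (stdNormalCDF_pos _).le]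
  exact (continuous_stdNormalCDF.comp (by fun_prop)).aestronglyMeasurable

/-! ### The supremum condition bounds a single value of the distribution function -/

lemma leadSup_term_le {α δ γ : ℝ} (hδ : 0 ≤ δ) (hγ : γ ∈ Icc (0 : ℝ) 2) :
    Real.exp (-γ ^ 2 / 2) * stdNormalCDF ((γ - 2 * α) / √(1 - δ)) ^ δ ≤ leadSup α δ := by
  unfold leadSup
  refine le_ciSup (f := fun γ : Icc (0 : ℝ) 2 ↦ Real.exp (-(γ : ℝ) ^ 2 / 2) *
    stdNormalCDF (((γ : ℝ) - 2 * α) / √(1 - δ)) ^ δ) ⟨1, ?_⟩ ⟨γ, hγ⟩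
  rintro _ ⟨x, rfl⟩
  have h1 : Real.exp (-(x : ℝ) ^ 2 / 2) ≤ 1 :=
    Real.exp_le_one_iff.2 (by nlinarith [sq_nonneg (x : ℝ)])
  have h2 := Real.rpow_le_one (stdNormalCDF_pos (((x : ℝ) - 2 * α) / √(1 - δ))).le
    (stdNormalCDF_le_one _) hδ
  exact mul_le_one₀ h1 (Real.rpow_nonneg (stdNormalCDF_pos _).le _) h2

/-- If `c` is a critical point of `y ↦ -y ^ 2 / 2 + δ log Φ((y - b) / √(1 - δ))`, then its value
there bounds `δ log Φ(-b)`: average the tangent of `log Φ` at `c` against `N(0, δ)`. -/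
lemma stdNormalCDF_rpow_le_of_critical {b c δ : ℝ} (hδ : 0 < δ) (hδ1 : δ < 1)
    (hc : c = δ * (stdNormalHazard ((c - b) / √(1 - δ)) / √(1 - δ))) :
    stdNormalCDF (-b) ^ δ ≤
      Real.exp (-c ^ 2 / 2) * stdNormalCDF ((c - b) / √(1 - δ)) ^ δ := by
  set q := √(1 - δ) with hq
  have hq0 : 0 < q := Real.sqrt_pos.2 (by linarith)
  have hq2 : q ^ 2 = 1 - δ := Real.sq_sqrt (by linarith)
  set s := √δ with hs
  have hs2 : s ^ 2 = δ := Real.sq_sqrt hδ.le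
  set u := (c - b) / q with hu
  set l := stdNormalHazard u / q with hl
  have hcl : c = δ * l := hc
  have hpt : ∀ x, stdNormalCDF ((-b - s * x) / q) ≤
      stdNormalCDF u * Real.exp (-(l * c)) * Real.exp (-(l * s) * x) := fun x ↦ by
    refine (stdNormalCDF_le_mul_exp u _).trans_eq ?_
    rw [mul_assoc, ← Real.exp_add]
    congr 2
    rw [hu, hl, hu]
    field_simp
    ring
  have hint : stdNormalCDF (-b) ≤
      ∫ x, stdNormalCDF u * Real.exp (-(l * c)) * Real.exp (-(l * s) * x) ∂(gaussianReal 0 1) := by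
    have h1 := integral_stdNormalCDF (s := s) hq0 (-b)
    rw [show q ^ 2 + s ^ 2 = 1 by rw [hq2, hs2]; ring, Real.sqrt_one, div_one] at h1
    rw [← h1]
    refine integral_mono_of_nonneg (.of_forall fun x ↦ (stdNormalCDF_pos _).le) ?_
      (.of_forall hpt)
    exact (integrable_exp_mul_gaussianReal _).const_mul _
  have hmgf : ∫ x, Real.exp (-(l * s) * x) ∂(gaussianReal 0 1) = Real.exp ((l * s) ^ 2 / 2) := by
    have := congrFun (mgf_fun_id_gaussianReal (μ := 0) (v := 1)) (-(l * s))
    simpa [mgf] using this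
  rw [integral_const_mul, hmgf, mul_assoc, ← Real.exp_add] at hint
  have hexp : -(l * c) + (l * s) ^ 2 / 2 = -c ^ 2 / 2 / δ := by
    rw [mul_pow, hs2, hcl]; field_simp; ring
  rw [hexp] at hint
  calc stdNormalCDF (-b) ^ δ ≤ (stdNormalCDF u * Real.exp (-c ^ 2 / 2 / δ)) ^ δ :=
        Real.rpow_le_rpow (stdNormalCDF_pos _).le hint hδ.le
    _ = _ := by
        rw [Real.mul_rpow (stdNormalCDF_pos _).le (Real.exp_pos _).le, ← Real.exp_mul,
          div_mul_cancel₀ _ hδ.ne', mul_comm]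

/-- The equation is a fixed point equation for a positive decreasing function, so the intermediate
value theorem gives a solution. -/
lemma exists_critical {b δ : ℝ} (hδ : 0 < δ) (hδ1 : δ < 1) :
    ∃ c, 0 ≤ c ∧ c = δ * (stdNormalHazard ((c - b) / √(1 - δ)) / √(1 - δ)) := by
  have hq0 : 0 < √(1 - δ) := Real.sqrt_pos.2 (by linarith)
  set r : ℝ → ℝ := fun c ↦ δ * (stdNormalHazard ((c - b) / √(1 - δ)) / √(1 - δ)) with hr
  have hrpos : ∀ c, 0 < r c := fun c ↦ by
    have := stdNormalHazard_pos ((c - b) / √(1 - δ))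
    positivity
  have hcont : Continuous fun c ↦ c - r c := by
    have : Continuous stdNormalHazard :=
      continuous_iff_continuousAt.2 fun x ↦ (hasDerivAt_stdNormalHazard x).continuousAt
    fun_prop
  have hle : r (r 0) ≤ r 0 := by
    simp only [hr]
    gcongr
    refine antitone_stdNormalHazard ?_
    gcongr
    exact (hrpos 0).le
  obtain ⟨c, hc, hc'⟩ := intermediate_value_Icc (hrpos 0).le hcont.continuousOn
    (show (0 : ℝ) ∈ Icc (0 - r 0) (r 0 - r (r 0)) from
      ⟨by linarith [hrpos 0], by linarith⟩)
  exact ⟨c, hc.1, by linarith⟩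

lemma exp_neg_two_le : Real.exp (-2) ≤ 0.15 := by
  have h := Real.exp_one_gt_d9
  rw [show (-2 : ℝ) = -(1 + 1) by norm_num, Real.exp_neg, Real.exp_add]
  rw [inv_le_comm₀ (by positivity) (by norm_num)]
  nlinarith

/-- The supremum condition enters the argument only through this consequence. A critical point
`c ≤ 2` is in the range of the supremum, and for `c ≥ 2` the factor `exp (-c ^ 2 / 2) ≤ exp (-2)` is
already small enough. -/
lemma stdNormalCDF_rpow_le_of_leadSup {α δ ε : ℝ} (hδ : 0 < δ) (hδ1 : δ < 1) (hε : ε ≤ 1 / 10)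
    (h : leadSup α δ ≤ 1 / 4 - ε) : stdNormalCDF (-(2 * α)) ^ δ ≤ 1 / 4 - ε := by
  obtain ⟨c, hc0, hc⟩ := exists_critical (b := 2 * α) hδ hδ1
  have h1 := stdNormalCDF_rpow_le_of_critical hδ hδ1 hc
  rcases le_total c 2 with h2 | h2
  · exact h1.trans ((leadSup_term_le hδ.le ⟨hc0, h2⟩).trans h)
  · have h3 : Real.exp (-c ^ 2 / 2) ≤ Real.exp (-2) := Real.exp_le_exp.2 (by nlinarith)
    have h4 := Real.rpow_le_one (stdNormalCDF_pos ((c - 2 * α) / √(1 - δ))).le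
      (stdNormalCDF_le_one _) hδ.le
    have h5 : Real.exp (-c ^ 2 / 2) * stdNormalCDF ((c - 2 * α) / √(1 - δ)) ^ δ ≤ 0.15 * 1 :=
      mul_le_mul (h3.trans exp_neg_two_le) h4 (Real.rpow_nonneg (stdNormalCDF_pos _).le _)
        (by norm_num)
    linarith

/-! ### Numerical bounds -/

lemma log_two_pi_ge : 1.8324 ≤ Real.log (2 * Real.pi) := by
  have h1 : Real.log (2 * 2 * ((1 + 0.2532) * (1 + 0.2532))) ≤ Real.log (2 * Real.pi) :=
    Real.log_le_log (by norm_num) (by linarith [Real.pi_gt_d4])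
  rw [Real.log_mul (by norm_num) (by norm_num), Real.log_mul (by norm_num) (by norm_num),
    Real.log_mul (by norm_num) (by norm_num)] at h1
  have h2 := Real.le_log_one_add_of_nonneg (x := 0.2532) (by norm_num)
  have h3 := Real.log_two_gt_d9
  norm_num at h1 h2 h3 ⊢
  linarith

lemma log_two_pi_le : Real.log (2 * Real.pi) ≤ 1.88 := by
  have h1 : Real.log (2 * Real.pi) = Real.log (8 * (Real.pi / 4)) := by congr 1; ring
  rw [h1, Real.log_mul (by norm_num) (by positivity), show (8 : ℝ) = 2 ^ 3 by norm_num,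
    Real.log_pow]
  have h2 := Real.log_le_sub_one_of_pos (show 0 < Real.pi / 4 by positivity)
  have h3 := Real.log_two_lt_d9
  have h4 := Real.pi_lt_d4
  norm_num at h2 h3 h4 ⊢
  linarith

lemma log_four_eq : Real.log 4 = 2 * Real.log 2 := by
  rw [show (4 : ℝ) = 2 ^ 2 by norm_num, Real.log_pow]; norm_num

/-- A lower bound for the logarithm by its Padé approximant at `2`. -/
lemma log_two_add_le_log {x : ℝ} (hx : 2 ≤ x) :
    0.6931 + 2 * (x - 2) / (x + 2) ≤ Real.log x := by
  have h1 := Real.le_log_one_add_of_nonneg (x := x / 2 - 1) (by linarith)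
  have h2 : Real.log x = Real.log 2 + Real.log (1 + (x / 2 - 1)) := by
    rw [← Real.log_mul (by norm_num) (by linarith)]; congr 1; ring
  have h3 : 2 * (x / 2 - 1) / (x / 2 - 1 + 2) = 2 * (x - 2) / (x + 2) := by
    rw [div_eq_div_iff (by linarith) (by linarith)]
    ring
  have h4 := Real.log_two_gt_d9
  rw [h3] at h1
  norm_num at h4 ⊢
  linarith

/-- The degree five Taylor polynomial of the exponential. -/
lemma taylor_le_exp {y : ℝ} (hy : 0 ≤ y) :
    1 + y + y ^ 2 / 2 + y ^ 3 / 6 + y ^ 4 / 24 + y ^ 5 / 120 ≤ Real.exp y := by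
  have h := Real.sum_le_exp_of_nonneg hy 6
  simp only [Finset.sum_range_succ, Finset.sum_range_zero, Nat.factorial] at h
  norm_num at h ⊢
  linarith

/-- An upper Taylor bound for the hyperbolic cosine on the range `z ^ 2 ≤ 12.55`. -/
lemma cosh_le_taylor {z : ℝ} (hz : z ^ 2 ≤ 12.55) :
    Real.cosh z ≤
      1 + z ^ 2 / 2 + z ^ 4 / 24 + z ^ 6 / 720 + 1.19 * z ^ 8 / 40320 := by
  have h1 := Real.hasSum_cosh z
  have h2 := (hasSum_nat_add_iff' 4).2 h1
  set w := z ^ 2 / 81 with hw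
  have hw0 : 0 ≤ w := by positivity
  have hw1 : w ≤ 0.155 := by rw [hw]; norm_num at hz ⊢; linarith
  have h3 : HasSum (fun n : ℕ ↦ z ^ 8 / 40320 * w ^ n) (z ^ 8 / 40320 * (1 - w)⁻¹) :=
    (hasSum_geometric_of_lt_one hw0 (by linarith)).mul_left _
  have h4 := hasSum_le (fun n ↦ by
    have hf : (40320 : ℝ) * 81 ^ n ≤ ((2 * (n + 4)).factorial : ℝ) := by
      have := Nat.factorial_mul_pow_le_factorial (m := 8) (n := 2 * n)
      rw [show 8 + 2 * n = 2 * (n + 4) by ring, pow_mul] at this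
      have h8 : Nat.factorial 8 = 40320 := by decide
      rw [h8] at this
      exact_mod_cast this
    show z ^ (2 * (n + 4)) / ((2 * (n + 4)).factorial : ℝ) ≤ z ^ 8 / 40320 * w ^ n
    have he : z ^ 8 / 40320 * w ^ n = z ^ (2 * (n + 4)) / (40320 * 81 ^ n) := by
      rw [hw, div_pow, ← pow_mul, show 2 * (n + 4) = 8 + 2 * n by ring, pow_add]
      field_simp
    rw [he]
    have : 0 ≤ z ^ (2 * (n + 4)) := by rw [pow_mul]; positivity
    gcongr) h2 h3
  have h5 : (1 - w)⁻¹ ≤ 1.19 := by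
    rw [inv_le_comm₀ (by linarith) (by norm_num)]
    norm_num at hw1 ⊢
    linarith
  have h6 : z ^ 8 / 40320 * (1 - w)⁻¹ ≤ z ^ 8 / 40320 * 1.19 := by
    have : 0 ≤ z ^ 8 / 40320 := by positivity
    gcongr
  simp only [Finset.sum_range_succ, Finset.sum_range_zero] at h4
  norm_num [Nat.factorial] at h4 h6 ⊢
  linarith

/-! ### The tilting inequality: moderate `α` -/

/-- The function `u ↦ log (1 + t Φ(u)) - u ^ 4 / 48` is concave, because with `z = t φ / (1 + t Φ)`
its second derivative is `-(z + u / 2) ^ 2`. Its tangent at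
`-b` therefore bounds its values at `-b ± γ`. -/
lemma one_add_mul_stdNormalCDF_le {t : ℝ} (ht : 0 ≤ t) (b γ : ℝ) :
    (1 + t * stdNormalCDF (γ - b)) * (1 + t * stdNormalCDF (-γ - b)) ≤
      (1 + t * stdNormalCDF (-b)) ^ 2 * Real.exp (γ ^ 2 * b ^ 2 / 4 + γ ^ 4 / 24) := by
  have hpos : ∀ u, 0 < 1 + t * stdNormalCDF u := fun u ↦ by
    have := stdNormalCDF_pos u; positivity
  set z : ℝ → ℝ := fun u ↦ t * stdNormalPDF u / (1 + t * stdNormalCDF u) with hz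
  have hg : ∀ u, HasDerivAt (fun u ↦ Real.log (1 + t * stdNormalCDF u) - u ^ 4 / 48)
      (z u - u ^ 3 / 12) u := fun u ↦ by
    refine HasDerivAt.congr_deriv (((((hasDerivAt_stdNormalCDF u).const_mul t).const_add 1).log
      (hpos u).ne').sub ((hasDerivAt_pow 4 u).div_const 48)) ?_
    push_cast; ring
  have hg2 : ∀ u, HasDerivAt (fun u ↦ z u - u ^ 3 / 12) (-(z u + u / 2) ^ 2) u := fun u ↦ by
    refine HasDerivAt.congr_deriv ((((hasDerivAt_stdNormalPDF u).const_mul t).div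
      (((hasDerivAt_stdNormalCDF u).const_mul t).const_add 1) (hpos u).ne').sub
      ((hasDerivAt_pow 3 u).div_const 12)) ?_
    have := (hpos u).ne'
    simp only [hz]
    field_simp
    push_cast
    ring
  have hanti : Antitone fun u ↦ z u - u ^ 3 / 12 :=
    antitone_of_deriv_nonpos (fun u ↦ (hg2 u).differentiableAt) fun u ↦ by
      rw [(hg2 u).deriv]; nlinarith [sq_nonneg (z u + u / 2)]
  have h1 := le_tangent_of_antitoneOn ordConnected_univ hg (hanti.antitoneOn _)
    (mem_univ (-b)) (mem_univ (γ - b))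
  have h2 := le_tangent_of_antitoneOn ordConnected_univ hg (hanti.antitoneOn _)
    (mem_univ (-b)) (mem_univ (-γ - b))
  rw [← Real.log_le_log_iff (mul_pos (hpos _) (hpos _))
    (mul_pos (pow_pos (hpos _) 2) (Real.exp_pos _)), Real.log_mul (hpos _).ne' (hpos _).ne',
    Real.log_mul (pow_pos (hpos _) 2).ne' (Real.exp_pos _).ne', Real.log_exp, Real.log_pow]
  push_cast
  nlinarith

/-- The tilt `t = 1 / Φ(-b)`, for which the claim at `γ = 0` is the hypothesis `hρ`. The restriction
on `b` makes the error `γ ^ 2 * b ^ 2 / 4 + γ ^ 4 / 24` at most `γ ^ 2`. -/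
lemma exists_tilt_of_le {b δ ρ γ : ℝ} (hb : |b| ≤ 1.94)
    (hρ : 4 * stdNormalCDF (-b) ^ δ ≤ ρ) (hγ : |γ| ≤ 1.18) :
    ∃ t, 1 ≤ t ∧ 4 * ((1 + t * stdNormalCDF (γ - b)) * (1 + t * stdNormalCDF (-γ - b))) ≤
      ρ ^ 2 * (t ^ (2 * δ) * Real.exp (γ ^ 2)) := by
  have hp := stdNormalCDF_pos (-b)
  set φ := stdNormalCDF (-b) with hφ
  refine ⟨φ⁻¹, (one_le_inv₀ hp).2 (stdNormalCDF_le_one _), ?_⟩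
  have h1 := one_add_mul_stdNormalCDF_le (inv_pos.2 hp).le b γ
  rw [← hφ, inv_mul_cancel₀ hp.ne'] at h1
  have hb2 : b ^ 2 ≤ 1.94 ^ 2 := sq_le_sq' (by linarith [(abs_le.1 hb).1]) (abs_le.1 hb).2
  have hγ2 : γ ^ 2 ≤ 1.18 ^ 2 := sq_le_sq' (by linarith [(abs_le.1 hγ).1]) (abs_le.1 hγ).2
  have h2 : Real.exp (γ ^ 2 * b ^ 2 / 4 + γ ^ 4 / 24) ≤ Real.exp (γ ^ 2) := by
    refine Real.exp_le_exp.2 ?_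
    have : γ ^ 2 * (b ^ 2 / 4 + γ ^ 2 / 24) ≤ γ ^ 2 * 1 := by
      refine mul_le_mul_of_nonneg_left ?_ (sq_nonneg γ)
      norm_num at hb2 hγ2 ⊢
      linarith
    nlinarith
  have h3 : φ⁻¹ ^ (2 * δ) = ((φ ^ δ) ^ 2)⁻¹ := by
    rw [Real.inv_rpow hp.le, mul_comm, Real.rpow_mul hp.le, Real.rpow_two]
  have h4 : 0 < φ ^ δ := Real.rpow_pos_of_pos hp _
  have h5 : 16 ≤ ρ ^ 2 * ((φ ^ δ) ^ 2)⁻¹ := by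
    rw [← div_eq_mul_inv, le_div_iff₀ (by positivity)]
    nlinarith
  rw [h3]
  calc 4 * ((1 + φ⁻¹ * stdNormalCDF (γ - b)) * (1 + φ⁻¹ * stdNormalCDF (-γ - b)))
      ≤ 4 * ((1 + 1) ^ 2 * Real.exp (γ ^ 2)) := by
        refine mul_le_mul_of_nonneg_left (h1.trans ?_) (by norm_num)
        exact mul_le_mul_of_nonneg_left h2 (by norm_num)
    _ = 16 * Real.exp (γ ^ 2) := by ring
    _ ≤ ρ ^ 2 * ((φ ^ δ) ^ 2)⁻¹ * Real.exp (γ ^ 2) :=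
        mul_le_mul_of_nonneg_right h5 (Real.exp_pos _).le
    _ = _ := by ring

/-! ### The point where `Φ(-b) ^ δ` equals `1 / 4` -/

lemma log_stdNormalCDF_neg_eq (b : ℝ) : Real.log (stdNormalCDF (-b)) =
    -(b ^ 2 / 2 + Real.log (2 * Real.pi) / 2 + Real.log (stdNormalHazard (-b))) := by
  have h1 : Real.log (stdNormalHazard (-b)) =
      Real.log (stdNormalPDF (-b)) - Real.log (stdNormalCDF (-b)) :=
    Real.log_div (stdNormalPDF_pos _).ne' (stdNormalCDF_pos _).ne'
  have h2 : Real.log (stdNormalPDF (-b)) = -(Real.log (2 * Real.pi) / 2) - b ^ 2 / 2 := by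
    rw [stdNormalPDF_neg, stdNormalPDF, Real.log_mul (by positivity) (Real.exp_pos _).ne',
      Real.log_exp, Real.log_inv, Real.log_sqrt (by positivity)]
    ring
  linarith

/-- The point at which `Φ(-b) ^ δ` equals `1 / 4`, together with the relation between `b`, `δ` and
the hazard rate `m` there. -/
lemma exists_quarter_point {α δ : ℝ} (hδ : 0 < δ) (hδ1 : δ ≤ 0.385)
    (h : stdNormalCDF (-(2 * α)) ^ δ ≤ 1 / 4) :
    ∃ b m, b ≤ 2 * α ∧ 1.2 ≤ b ∧ m = stdNormalHazard (-b) ∧ 0 < m ∧ b < m ∧ m - 1 / m ≤ b ∧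
      Real.log (stdNormalCDF (-b)) = -(Real.log 4 / δ) ∧
      Real.log 4 / δ = b ^ 2 / 2 + Real.log (2 * Real.pi) / 2 + Real.log m := by
  have hlog4 : 1.386 ≤ Real.log 4 := by
    rw [log_four_eq]; have := Real.log_two_gt_d9; norm_num at this ⊢; linarith
  have hN : 3.6 ≤ Real.log 4 / δ := by
    rw [le_div_iff₀ hδ]; norm_num at hδ1 hlog4 ⊢; nlinarith
  have hα : Real.log (stdNormalCDF (-(2 * α))) ≤ -(Real.log 4 / δ) := by
    have h1 := Real.log_le_log (Real.rpow_pos_of_pos (stdNormalCDF_pos _) _) h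
    rw [Real.log_rpow (stdNormalCDF_pos _), one_div, Real.log_inv] at h1
    rw [← neg_div, le_div_iff₀ hδ]
    linarith
  -- At `b = 1.2` the hazard rate is below `1.8`, so the tail there is still too large.
  have h12 : ∀ b, 0 ≤ b → b ≤ 1.2 → -(Real.log 4 / δ) < Real.log (stdNormalCDF (-b)) := by
    intro b hb0 hb
    have hm := stdNormalHazard_pos (-b)
    have h1 := stdNormalHazard_le_one (u := -b) (by linarith)
    have h2 : stdNormalHazard (-b) ≤ 1.8 := by
      norm_num at hb ⊢
      nlinarith
    have h3 := Real.log_le_sub_one_of_pos hm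
    have h4 := log_two_pi_le
    rw [log_stdNormalCDF_neg_eq]
    norm_num at hN h2 h4 hb
    nlinarith
  have hα12 : 1.2 < 2 * α := by
    by_contra! hcon
    rcases le_total 0 (2 * α) with h0 | h0
    · linarith [h12 _ h0 hcon]
    · have h1 := h12 0 le_rfl (by norm_num)
      have h2 : Real.log (stdNormalCDF (-0)) ≤ Real.log (stdNormalCDF (-(2 * α))) :=
        Real.log_le_log (stdNormalCDF_pos _) (strictMono_stdNormalCDF.monotone (by linarith))
      exact (hα.trans_lt h1).not_ge h2
  have hcont : Continuous fun b ↦ Real.log (stdNormalCDF (-b)) :=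
    (continuous_stdNormalCDF.comp continuous_neg).log fun b ↦ (stdNormalCDF_pos _).ne'
  obtain ⟨b, hb, hb'⟩ := intermediate_value_Icc' hα12.le hcont.continuousOn
    (show -(Real.log 4 / δ) ∈ _ from ⟨hα, (h12 1.2 (by norm_num) le_rfl).le⟩)
  have hb0 : 0 ≤ b := le_trans (by norm_num) hb.1
  have hm := stdNormalHazard_pos (-b)
  have hb' : Real.log (stdNormalCDF (-b)) = -(Real.log 4 / δ) := hb'
  refine ⟨b, stdNormalHazard (-b), hb.2, hb.1, rfl, hm, ?_, ?_, hb', ?_⟩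
  · have h1 := half_le_stdNormalHazard (u := -b) (by linarith)
    nlinarith
  · have h1 := stdNormalHazard_le_one (u := -b) (by linarith)
    have h2 : stdNormalHazard (-b) + -b ≤ 1 / stdNormalHazard (-b) := by
      rw [le_div_iff₀ hm]; linarith
    linarith
  · rw [log_stdNormalCDF_neg_eq] at hb'
    linarith

/-- At the quarter point, `t = 1 / Φ(-b)` has `t ^ (2 δ) = 16`. -/
lemma stdNormalCDF_rpow_neg_of_log {φ δ : ℝ} (hφ : 0 < φ) (hδ : 0 < δ)
    (h : Real.log φ = -(Real.log 4 / δ)) : φ⁻¹ ^ (2 * δ) = 16 := by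
  have h1 : φ⁻¹ = Real.exp (Real.log 4 / δ) := by
    rw [← neg_eq_iff_eq_neg, ← Real.log_inv] at h
    rw [← h, Real.exp_log (inv_pos.2 hφ)]
  rw [h1, ← Real.exp_mul, show Real.log 4 / δ * (2 * δ) = Real.log 4 + Real.log 4 by
    field_simp; ring, Real.exp_add, Real.exp_log (by norm_num)]
  norm_num

/-- A bound on the hazard rate at the quarter point: the relation between `δ` and `m` is
monotone. -/
lemma hazard_le_of_quarter {b m M δ δ₁ : ℝ} (hδ₁ : 0 < δ₁) (hδ : δ₁ ≤ δ) (hM : 2 ≤ M)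
    (hmb : m - 1 / m ≤ b)
    (heq : Real.log 4 / δ = b ^ 2 / 2 + Real.log (2 * Real.pi) / 2 + Real.log m)
    (hnum : 1.3863 / δ₁ ≤ (M - 1 / M) ^ 2 / 2 + 0.9162 + (0.6931 + 2 * (M - 2) / (M + 2))) :
    m ≤ M := by
  by_contra! hcon
  have h1 : 1 / m < 1 / M := one_div_lt_one_div_of_lt (by linarith) hcon
  have h2 : 1 / M ≤ 1 / 2 := one_div_le_one_div_of_le (by norm_num) hM
  have h3 : (M - 1 / M) ^ 2 < b ^ 2 := pow_lt_pow_left₀ (by linarith) (by linarith) (by norm_num)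
  have h4 : Real.log M < Real.log m := Real.log_lt_log (by linarith) hcon
  have h5 := log_two_add_le_log hM
  have h6 := log_two_pi_ge
  have h7 : Real.log 4 / δ ≤ 1.3863 / δ₁ := by
    have : Real.log 4 ≤ 1.3863 := by
      rw [log_four_eq]; have := Real.log_two_lt_d9; norm_num at this ⊢; linarith
    exact div_le_div₀ (by norm_num) this hδ₁ hδ
  linarith

/-! ### The tilting inequality: `δ` between `0.25` and `0.385` -/

/-- At the quarter point `b`, the tilt `t = c exp (γ ^ 2 / 4) / Φ(-b)`. By the quantitative
log-concavity of `Φ`, `t Φ(±γ - b) ≤ c exp (± m γ)`, which reduces the claim to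
`1 + c ^ 2 + 2 c cosh (m γ) ≤ 0.995 * 4 c ^ (2 δ) exp ((1 + δ / 2) γ ^ 2)`. The hypothesis `hpoly`
is this inequality in `x = γ ^ 2`, with both sides replaced by Taylor polynomials and the quantities
`m`, `δ` and `c ^ (2 δ)` by their bounds `M`, `δ₁` and `r`. -/
lemma tilt_of_moderate {b m M c r δ δ₁ δ₂ γ : ℝ} (hδ : 0 < δ₁) (h1 : δ₁ ≤ δ) (h2 : δ ≤ δ₂)
    (hδ₂ : δ₂ ≤ 0.385)
    (hb : 1.2 ≤ b) (hm : m = stdNormalHazard (-b)) (hmM : m ≤ M) (hM : M ≤ 3) (hc : 0.1 ≤ c)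
    (hc1 : c ≤ 1) (hγ0 : 0 ≤ γ) (hγ : γ ≤ 1.18)
    (hlog : Real.log (stdNormalCDF (-b)) = -(Real.log 4 / δ))
    (hr : r ≤ c ^ (2 * δ₂))
    (hpoly : ∀ x : ℝ, 0 ≤ x → x ≤ 1.3924 →
      1 + c ^ 2 + 2 * c * (1 + M ^ 2 / 2 * x + M ^ 4 / 24 * x ^ 2 + M ^ 6 / 720 * x ^ 3
        + 1.19 * M ^ 8 / 40320 * x ^ 4) ≤
      0.995 * (4 * r) * (1 + (1 + δ₁ / 2) * x + (1 + δ₁ / 2) ^ 2 / 2 * x ^ 2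
        + (1 + δ₁ / 2) ^ 3 / 6 * x ^ 3 + (1 + δ₁ / 2) ^ 4 / 24 * x ^ 4
        + (1 + δ₁ / 2) ^ 5 / 120 * x ^ 5)) :
    ∃ t, 1 ≤ t ∧ 4 * ((1 + t * stdNormalCDF (γ - b)) * (1 + t * stdNormalCDF (-γ - b))) ≤
      0.995 * (t ^ (2 * δ) * Real.exp (γ ^ 2)) := by
  have hp := stdNormalCDF_pos (-b)
  have hm0 : 0 < m := hm ▸ stdNormalHazard_pos _
  set φ := stdNormalCDF (-b) with hφ
  have hc0 : 0 < c := by linarith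
  refine ⟨c * Real.exp (γ ^ 2 / 4) * φ⁻¹, ?_, ?_⟩
  · -- `φ = 4 ^ (-1 / δ) ≤ 4 ^ (-2) < c`
    have h3 : Real.log φ ≤ Real.log (1 / 16) := by
      rw [hlog, one_div, Real.log_inv, neg_le_neg_iff, le_div_iff₀ (by linarith),
        show (16 : ℝ) = 4 ^ 2 by norm_num, Real.log_pow]
      have : 0 < Real.log 4 := Real.log_pos (by norm_num)
      push_cast
      norm_num at hδ₂
      nlinarith
    have h4 : φ ≤ 1 / 16 := (Real.log_le_log_iff hp (by norm_num)).1 h3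
    rw [← div_eq_mul_inv, le_div_iff₀ hp, one_mul]
    have h5 : 1 ≤ Real.exp (γ ^ 2 / 4) := Real.one_le_exp (by positivity)
    nlinarith
  · have hplus : φ⁻¹ * stdNormalCDF (γ - b) ≤ Real.exp (m * γ - γ ^ 2 / 4) := by
      rw [inv_mul_le_iff₀ hp]
      refine (stdNormalCDF_le_mul_exp_sub (u := -b) (v := γ - b) (by linarith)
        (by norm_num at hb hγ; linarith)).trans_eq ?_
      rw [← hφ, ← hm, show γ - b - -b = γ by ring]
    have hminus : φ⁻¹ * stdNormalCDF (-γ - b) ≤ Real.exp (-(m * γ) - γ ^ 2 / 4) := by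
      rw [inv_mul_le_iff₀ hp]
      refine (stdNormalCDF_le_mul_exp_sub (u := -b) (v := -γ - b) (by linarith)
        (by linarith)).trans_eq ?_
      rw [← hφ, ← hm, show -γ - b - -b = -γ by ring]
      ring_nf
    have hplus' : c * Real.exp (γ ^ 2 / 4) * φ⁻¹ * stdNormalCDF (γ - b) ≤
        c * Real.exp (m * γ) := by
      calc _ = c * Real.exp (γ ^ 2 / 4) * (φ⁻¹ * stdNormalCDF (γ - b)) := by ring
        _ ≤ c * Real.exp (γ ^ 2 / 4) * Real.exp (m * γ - γ ^ 2 / 4) := by gcongr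
        _ = c * Real.exp (m * γ) := by rw [mul_assoc, ← Real.exp_add]; ring_nf
    have hminus' : c * Real.exp (γ ^ 2 / 4) * φ⁻¹ * stdNormalCDF (-γ - b) ≤
        c * Real.exp (-(m * γ)) := by
      calc _ = c * Real.exp (γ ^ 2 / 4) * (φ⁻¹ * stdNormalCDF (-γ - b)) := by ring
        _ ≤ c * Real.exp (γ ^ 2 / 4) * Real.exp (-(m * γ) - γ ^ 2 / 4) := by gcongr
        _ = c * Real.exp (-(m * γ)) := by rw [mul_assoc, ← Real.exp_add]; ring_nf
    have hx : γ ^ 2 ≤ 1.3924 := by norm_num at hγ ⊢; nlinarith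
    have hM0 : 0 < M := by linarith
    have hcosh : Real.cosh (m * γ) ≤ 1 + M ^ 2 / 2 * γ ^ 2 + M ^ 4 / 24 * (γ ^ 2) ^ 2
        + M ^ 6 / 720 * (γ ^ 2) ^ 3 + 1.19 * M ^ 8 / 40320 * (γ ^ 2) ^ 4 := by
      have h5 : Real.cosh (m * γ) ≤ Real.cosh (M * γ) := by
        rw [Real.cosh_le_cosh, abs_of_nonneg (by positivity), abs_of_nonneg (by positivity)]
        gcongr
      refine h5.trans ((cosh_le_taylor ?_).trans_eq (by ring))
      rw [mul_pow]
      have : M ^ 2 ≤ 9 := by nlinarith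
      norm_num at hx ⊢
      nlinarith [sq_nonneg γ]
    have hexp := taylor_le_exp (y := (1 + δ₁ / 2) * γ ^ 2) (by positivity)
    have hr' : r ≤ c ^ (2 * δ) :=
      hr.trans (Real.rpow_le_rpow_of_exponent_ge hc0 hc1 (by linarith))
    have hmain : (1 + c * Real.exp (m * γ)) * (1 + c * Real.exp (-(m * γ))) ≤
        0.995 * (4 * c ^ (2 * δ)) * Real.exp ((1 + δ / 2) * γ ^ 2) := by
      have h6 : (1 + c * Real.exp (m * γ)) * (1 + c * Real.exp (-(m * γ))) =
          1 + c ^ 2 + 2 * c * Real.cosh (m * γ) := by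
        have : Real.exp (m * γ) * Real.exp (-(m * γ)) = 1 := by
          rw [← Real.exp_add]; simp
        rw [Real.cosh_eq]
        linear_combination c ^ 2 * this
      rw [h6]
      have h7 : 1 + c ^ 2 + 2 * c * Real.cosh (m * γ) ≤ _ :=
        (add_le_add_right (mul_le_mul_of_nonneg_left hcosh (by linarith)) _).trans
          (hpoly (γ ^ 2) (sq_nonneg _) hx)
      refine h7.trans (mul_le_mul ?_ ?_ (by positivity) (by positivity))
      · gcongr
      · refine le_trans (le_of_eq (by ring)) (hexp.trans (Real.exp_le_exp.2 ?_))
        gcongr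
    have ht : (c * Real.exp (γ ^ 2 / 4) * φ⁻¹) ^ (2 * δ) =
        c ^ (2 * δ) * Real.exp (δ * γ ^ 2 / 2) * 16 := by
      rw [Real.mul_rpow (by positivity) (by positivity), Real.mul_rpow hc0.le (by positivity),
        stdNormalCDF_rpow_neg_of_log hp (by linarith) hlog, ← Real.exp_mul]
      ring_nf
    rw [ht]
    calc _ ≤ 4 * ((1 + c * Real.exp (m * γ)) * (1 + c * Real.exp (-(m * γ)))) := by
          have h8 := stdNormalCDF_pos (γ - b)
          have h9 := stdNormalCDF_pos (-γ - b)
          gcongr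
      _ ≤ 4 * (0.995 * (4 * c ^ (2 * δ)) * Real.exp ((1 + δ / 2) * γ ^ 2)) := by gcongr
      _ = _ := by
          rw [show (1 + δ / 2) * γ ^ 2 = δ * γ ^ 2 / 2 + γ ^ 2 by ring, Real.exp_add]
          ring

/-- A rational lower bound for a rational power, checked on a natural power. -/
lemma le_rpow_of_pow_le {r c s : ℝ} {k l : ℕ} (hc : 0 ≤ c) (hk : k ≠ 0)
    (hs : (l : ℝ) = s * k) (h : r ^ k ≤ c ^ l) : r ≤ c ^ s := by
  refine le_of_pow_le_pow_left₀ hk (Real.rpow_nonneg hc _) (h.trans_eq ?_)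
  rw [← Real.rpow_natCast (c ^ s), ← Real.rpow_mul hc, ← hs, Real.rpow_natCast]

/-- Nonnegativity of the degree five Bernstein polynomials of `[0, 1.3924]`. -/
lemma bernstein_five_nonneg {x : ℝ} (h0 : 0 ≤ x) (h1 : x ≤ 1.3924) :
    0 ≤ (1.3924 - x) ^ 5 ∧ 0 ≤ x * (1.3924 - x) ^ 4 ∧ 0 ≤ x ^ 2 * (1.3924 - x) ^ 3 ∧
      0 ≤ x ^ 3 * (1.3924 - x) ^ 2 ∧ 0 ≤ x ^ 4 * (1.3924 - x) ∧ 0 ≤ x ^ 5 := by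
  have : 0 ≤ 1.3924 - x := by linarith
  refine ⟨?_, ?_, ?_, ?_, ?_, ?_⟩ <;> positivity

/-- On each of six intervals `[δ₁, δ₂]` the hazard rate at the quarter point is at most `M`, `c` is
a numerically good choice, and `r` is a rational lower bound for `c ^ (2 δ₂)`. -/
lemma exists_tilt_of_small {α δ γ : ℝ} (hδ0 : 0.25 ≤ δ) (hδ1 : δ ≤ 0.385)
    (h : stdNormalCDF (-(2 * α)) ^ δ ≤ 1 / 4) (hγ0 : 0 ≤ γ) (hγ : γ ≤ 1.18) :
    ∃ b t, b ≤ 2 * α ∧ 1 ≤ t ∧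
      4 * ((1 + t * stdNormalCDF (γ - b)) * (1 + t * stdNormalCDF (-γ - b))) ≤
      0.995 * (t ^ (2 * δ) * Real.exp (γ ^ 2)) := by
  obtain ⟨b, m, hb, hb1, hm, -, -, hmb, hlog, heq⟩ :=
    exists_quarter_point (lt_of_lt_of_le (by norm_num) hδ0) hδ1 h
  have key : ∀ δ₁ δ₂ M c r : ℝ, δ₁ ≤ δ → δ ≤ δ₂ → 0 < δ₁ → δ₂ ≤ 0.385 → 2 ≤ M → M ≤ 3 →
      0.1 ≤ c → c ≤ 1 → r ≤ c ^ (2 * δ₂) →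
      1.3863 / δ₁ ≤ (M - 1 / M) ^ 2 / 2 + 0.9162 + (0.6931 + 2 * (M - 2) / (M + 2)) →
      (∀ x : ℝ, 0 ≤ x → x ≤ 1.3924 →
      1 + c ^ 2 + 2 * c * (1 + M ^ 2 / 2 * x + M ^ 4 / 24 * x ^ 2 + M ^ 6 / 720 * x ^ 3
        + 1.19 * M ^ 8 / 40320 * x ^ 4) ≤
      0.995 * (4 * r) * (1 + (1 + δ₁ / 2) * x + (1 + δ₁ / 2) ^ 2 / 2 * x ^ 2
        + (1 + δ₁ / 2) ^ 3 / 6 * x ^ 3 + (1 + δ₁ / 2) ^ 4 / 24 * x ^ 4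
        + (1 + δ₁ / 2) ^ 5 / 120 * x ^ 5)) →
      ∃ b t, b ≤ 2 * α ∧ 1 ≤ t ∧
      4 * ((1 + t * stdNormalCDF (γ - b)) * (1 + t * stdNormalCDF (-γ - b))) ≤
      0.995 * (t ^ (2 * δ) * Real.exp (γ ^ 2)) := by
    intro δ₁ δ₂ M c r h1 h2 h3 h4 h5 h6 h7 h8 h9 h10 h11
    obtain ⟨t, ht, ht'⟩ := tilt_of_moderate h3 h1 h2 h4 hb1 hm
      (hazard_le_of_quarter h3 h1 h5 hmb heq h10) h6 h7 h8 hγ0 hγ hlog h9 h11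
    exact ⟨b, t, hb, ht, ht'⟩
  rcases le_total δ 0.275 with h1 | h1
  · refine key 0.25 0.275 2.997 0.17 0.3773 hδ0 h1 (by norm_num) (by norm_num) (by norm_num)
      (by norm_num) (by norm_num) (by norm_num)
      (le_rpow_of_pow_le (k := 20) (l := 11) (by norm_num) (by norm_num) (by norm_num)
        (by norm_num)) (by norm_num) fun x hx0 hx1 ↦ ?_
    -- The difference of the two sides has nonnegative coefficients in the Bernstein basis.
    obtain ⟨b0, b1, b2, b3, b4, b5⟩ := bernstein_five_nonneg hx0 hx1
    norm_num at b0 b1 b2 b3 b4 b5 ⊢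
    linarith
  rcases le_total δ 0.3 with h2 | h2
  · refine key 0.275 0.3 2.839 0.22 0.4031 h1 h2 (by norm_num) (by norm_num) (by norm_num)
      (by norm_num) (by norm_num) (by norm_num)
      (le_rpow_of_pow_le (k := 5) (l := 3) (by norm_num) (by norm_num) (by norm_num)
        (by norm_num)) (by norm_num) fun x hx0 hx1 ↦ ?_
    obtain ⟨b0, b1, b2, b3, b4, b5⟩ := bernstein_five_nonneg hx0 hx1
    norm_num at b0 b1 b2 b3 b4 b5 ⊢
    linarith
  rcases le_total δ 0.33 with h3 | h3
  · refine key 0.3 0.33 2.702 0.27 0.4214 h2 h3 (by norm_num) (by norm_num) (by norm_num)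
      (by norm_num) (by norm_num) (by norm_num)
      (le_rpow_of_pow_le (k := 50) (l := 33) (by norm_num) (by norm_num) (by norm_num)
        (by norm_num)) (by norm_num) fun x hx0 hx1 ↦ ?_
    obtain ⟨b0, b1, b2, b3, b4, b5⟩ := bernstein_five_nonneg hx0 hx1
    norm_num at b0 b1 b2 b3 b4 b5 ⊢
    linarith
  rcases le_total δ 0.35 with h4 | h4
  · refine key 0.33 0.35 2.56 0.38 0.5079 h3 h4 (by norm_num) (by norm_num) (by norm_num)
      (by norm_num) (by norm_num) (by norm_num)
      (le_rpow_of_pow_le (k := 10) (l := 7) (by norm_num) (by norm_num) (by norm_num)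
        (by norm_num)) (by norm_num) fun x hx0 hx1 ↦ ?_
    obtain ⟨b0, b1, b2, b3, b4, b5⟩ := bernstein_five_nonneg hx0 hx1
    norm_num at b0 b1 b2 b3 b4 b5 ⊢
    linarith
  rcases le_total δ 0.37 with h5 | h5
  · refine key 0.35 0.37 2.475 0.46 0.5628 h4 h5 (by norm_num) (by norm_num) (by norm_num)
      (by norm_num) (by norm_num) (by norm_num)
      (le_rpow_of_pow_le (k := 50) (l := 37) (by norm_num) (by norm_num) (by norm_num)
        (by norm_num)) (by norm_num) fun x hx0 hx1 ↦ ?_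
    obtain ⟨b0, b1, b2, b3, b4, b5⟩ := bernstein_five_nonneg hx0 hx1
    norm_num at b0 b1 b2 b3 b4 b5 ⊢
    linarith
  · refine key 0.37 0.385 2.398 0.56 0.6398 h5 hδ1 (by norm_num) (by norm_num) (by norm_num)
      (by norm_num) (by norm_num) (by norm_num)
      (le_rpow_of_pow_le (k := 100) (l := 77) (by norm_num) (by norm_num) (by norm_num)
        (by norm_num)) (by norm_num) fun x hx0 hx1 ↦ ?_
    obtain ⟨b0, b1, b2, b3, b4, b5⟩ := bernstein_five_nonneg hx0 hx1
    norm_num at b0 b1 b2 b3 b4 b5 ⊢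
    linarith

/-! ### The tilting inequality: `δ` at most `0.25` -/

/-- The exponent on the right is at least `-0.5776`, with equality at `γ = 0.76`, and there the
exponential on the left is small. On each piece of the range, bounded below by `a`, `A` is a
lower bound for `exp (5 γ)` and `B` an upper bound for `exp (1.52 γ - γ ^ 2)`. -/
lemma one_add_half_exp_le {γ : ℝ} (h0 : 0 ≤ γ) :
    1 + Real.exp (-(5 * γ)) / 2 ≤ 1.876 * Real.exp (γ ^ 2 - 1.52 * γ) := by
  have key : ∀ a y A B : ℝ, a ≤ γ → 0 ≤ a → 1.52 * γ - γ ^ 2 ≤ y → 0 ≤ y → y ≤ 1 →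
      A ≤ 1 + 5 * a + (5 * a) ^ 2 / 2 + (5 * a) ^ 3 / 6 + (5 * a) ^ 4 / 24 + (5 * a) ^ 5 / 120 →
      1 + y + y ^ 2 / 2 + y ^ 3 / 6 + y ^ 4 * 5 / 96 ≤ B → 0 < A →
      (1 + A⁻¹ / 2) * B ≤ 1.876 →
      1 + Real.exp (-(5 * γ)) / 2 ≤ 1.876 * Real.exp (γ ^ 2 - 1.52 * γ) := by
    intro a y A B ha ha0 hy hy0 hy1 hA hB hA0 hAB
    have h1 : Real.exp (-(5 * γ)) ≤ A⁻¹ := by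
      rw [Real.exp_neg]
      refine inv_anti₀ hA0 (hA.trans ((taylor_le_exp (by positivity)).trans ?_))
      exact Real.exp_le_exp.2 (by linarith)
    have h2 : Real.exp (1.52 * γ - γ ^ 2) ≤ B := by
      refine (Real.exp_le_exp.2 hy).trans (le_trans ?_ hB)
      refine (Real.exp_bound' hy0 hy1 (n := 4) (by norm_num)).trans_eq ?_
      simp only [Finset.sum_range_succ, Finset.sum_range_zero, Nat.factorial]
      norm_num
    have h3 : γ ^ 2 - 1.52 * γ = -(1.52 * γ - γ ^ 2) := by ring
    rw [h3, Real.exp_neg (1.52 * γ - γ ^ 2), ← div_eq_mul_inv, le_div_iff₀ (Real.exp_pos _)]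
    refine le_trans ?_ hAB
    have := Real.exp_pos (-(5 * γ))
    gcongr
  rcases le_total γ 0.15 with h1 | h1
  · refine key 0 0.2055 1 1.2283 h0 le_rfl ?_ (by norm_num) (by norm_num) (by norm_num)
      (by norm_num) (by norm_num) (by norm_num)
    norm_num at h1 ⊢
    nlinarith
  rcases le_total γ 0.35 with h2 | h2
  · refine key 0.15 0.4095 2.116 1.507 h1 (by norm_num) ?_ (by norm_num) (by norm_num)
      (by norm_num) (by norm_num) (by norm_num) (by norm_num)
    norm_num at h2 ⊢
    nlinarith
  rcases le_total γ 0.55 with h3 | h3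
  · refine key 0.35 0.5335 5.64 1.707 h2 (by norm_num) ?_ (by norm_num) (by norm_num)
      (by norm_num) (by norm_num) (by norm_num) (by norm_num)
    norm_num at h3 ⊢
    nlinarith
  · refine key 0.55 0.5776 14 1.786 h3 (by norm_num) ?_ (by norm_num) (by norm_num)
      (by norm_num) (by norm_num) (by norm_num) (by norm_num)
    norm_num
    nlinarith [sq_nonneg (γ - 0.76)]

/-- For small `δ` the hazard rate `m` at the quarter point `b` is large and `δ m ≤ 0.76`. The tilt
is `t = exp (-m γ) / (2 Φ(-b))`, for which `t Φ(γ - b) ≤ 1 / 2` by log-concavity, while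
`t Φ(-γ - b) ≤ exp (-2 m γ) / 2` is small. -/
lemma exists_tilt_of_tiny {α δ γ : ℝ} (hδ0 : 0 < δ) (hδ1 : δ ≤ 0.25)
    (h : stdNormalCDF (-(2 * α)) ^ δ ≤ 1 / 4) (hγ0 : 0 ≤ γ) (hγ : γ ≤ 1.18) :
    ∃ b t, b ≤ 2 * α ∧ 1 ≤ t ∧
      4 * ((1 + t * stdNormalCDF (γ - b)) * (1 + t * stdNormalCDF (-γ - b))) ≤
      0.995 * (t ^ (2 * δ) * Real.exp (γ ^ 2)) := by
  obtain ⟨b, m, hb, hb1, hm, hm0, hbm, hmb, hlog, heq⟩ :=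
    exists_quarter_point hδ0 (hδ1.trans (by norm_num)) h
  have hL := Real.log_two_gt_d9
  have hL' := Real.log_two_lt_d9
  have hL4 := log_four_eq
  have hpi := log_two_pi_ge
  have hpi' := log_two_pi_le
  have hφ := stdNormalCDF_pos (-b)
  set φ := stdNormalCDF (-b)
  set N := Real.log 4 / δ with hN
  have hδN : δ * N = Real.log 4 := by rw [hN]; field_simp
  have hN4 : 5.5448 ≤ N := by
    rw [hN, le_div_iff₀ hδ0]
    norm_num at hL hδ1 ⊢
    linarith
  have hm25 : 2.5 ≤ m := by
    by_contra! hcon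
    have h1 : Real.log m ≤ Real.log 2.5 := Real.log_le_log hm0 hcon.le
    have h2 : Real.log 2.5 ≤ 0.9432 := by
      rw [show (2.5 : ℝ) = 2 * 1.25 by norm_num, Real.log_mul (by norm_num) (by norm_num)]
      have := Real.log_le_sub_one_of_pos (x := 1.25) (by norm_num)
      norm_num at this hL' ⊢
      linarith
    have h3 : b ^ 2 ≤ 2.5 ^ 2 := pow_le_pow_left₀ (by linarith) (by linarith) 2
    norm_num at *
    linarith
  have hNm : m ^ 2 / 2 - 0.0838 + Real.log m ≤ N := by
    have h1 : (m - 1 / m) ^ 2 ≤ b ^ 2 := by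
      refine pow_le_pow_left₀ ?_ hmb 2
      have : 1 / m ≤ 1 := (div_le_one₀ hm0).2 (by linarith)
      linarith
    have h2 : m ^ 2 - 2 ≤ (m - 1 / m) ^ 2 := by
      have h3 : (m - 1 / m) ^ 2 = m ^ 2 - 2 + (1 / m) ^ 2 := by field_simp; ring
      rw [h3]
      linarith [sq_nonneg (1 / m)]
    norm_num at *
    linarith
  have hδm : δ * m ≤ 0.76 := by
    rcases le_total m 3 with h3 | h3
    · norm_num at hδ1 ⊢
      nlinarith
    · have h4 := log_two_add_le_log (x := m) (by linarith)
      have h5 : 0.4 ≤ 2 * (m - 2) / (m + 2) := by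
        rw [le_div_iff₀ (by linarith)]
        norm_num
        linarith
      have h6 : m ^ 2 / 2 + 1.009 ≤ N := by
        norm_num at *
        linarith
      have h7 : Real.log 4 * m ≤ 0.76 * N := by
        norm_num at *
        nlinarith
      rw [← mul_le_mul_iff_left₀ (show 0 < N by linarith)]
      calc δ * m * N = Real.log 4 * m := by rw [← hδN]; ring
        _ ≤ _ := h7
  have hmγ : 0 ≤ m * γ := by positivity
  have hφN : φ = Real.exp (-N) := by rw [← hlog, Real.exp_log hφ]
  refine ⟨b, Real.exp (-(m * γ)) / 2 * φ⁻¹, hb, ?_, ?_⟩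
  · have h1 : 0.8 ≤ Real.log m := by
      have h4 := log_two_add_le_log (x := m) (by linarith)
      have h5 : 0.2 ≤ 2 * (m - 2) / (m + 2) := by
        rw [le_div_iff₀ (by linarith)]
        norm_num at hm25 ⊢
        linarith
      norm_num at *
      linarith
    have h2 : m * γ ≤ m * 1.18 := by gcongr
    have h3 : Real.log 2 ≤ -(m * γ) + N := by
      norm_num at *
      nlinarith
    rw [hφN, ← Real.exp_neg, neg_neg, div_mul_eq_mul_div, ← Real.exp_add, le_div_iff₀ (by norm_num),
      one_mul]
    exact (Real.log_le_iff_le_exp (by norm_num)).1 h3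
  · have hplus : Real.exp (-(m * γ)) / 2 * φ⁻¹ * stdNormalCDF (γ - b) ≤ 1 / 2 := by
      have h1 := stdNormalCDF_le_mul_exp (-b) (γ - b)
      rw [← hm, show γ - b - -b = γ by ring] at h1
      calc _ ≤ Real.exp (-(m * γ)) / 2 * φ⁻¹ * (φ * Real.exp (m * γ)) := by gcongr
        _ = (φ⁻¹ * φ) * (Real.exp (-(m * γ)) * Real.exp (m * γ)) / 2 := by ring
        _ = 1 / 2 := by rw [← Real.exp_add, inv_mul_cancel₀ hφ.ne']; simp
    have hminus : Real.exp (-(m * γ)) / 2 * φ⁻¹ * stdNormalCDF (-γ - b) ≤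
        Real.exp (-(5 * γ)) / 2 := by
      have h1 := stdNormalCDF_le_mul_exp (-b) (-γ - b)
      rw [← hm, show -γ - b - -b = -γ by ring] at h1
      calc _ ≤ Real.exp (-(m * γ)) / 2 * φ⁻¹ * (φ * Real.exp (m * -γ)) := by gcongr
        _ = (φ⁻¹ * φ) * (Real.exp (-(m * γ)) * Real.exp (m * -γ)) / 2 := by ring
        _ = Real.exp (-(2 * m * γ)) / 2 := by
          rw [← Real.exp_add, inv_mul_cancel₀ hφ.ne', one_mul]
          ring_nf
        _ ≤ _ := by
          gcongr
          norm_num at hm25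
          linarith
    have ht : (Real.exp (-(m * γ)) / 2 * φ⁻¹) ^ (2 * δ) =
        16 * (1 / 4) ^ δ * Real.exp (-(2 * (δ * m) * γ)) := by
      rw [Real.mul_rpow (by positivity) (by positivity), stdNormalCDF_rpow_neg_of_log hφ hδ0 hlog,
        Real.div_rpow (by positivity) (by norm_num), ← Real.exp_mul,
        Real.rpow_mul (by norm_num) 2 δ, Real.rpow_two, Real.div_rpow (by norm_num) (by norm_num),
        Real.one_rpow]
      norm_num
      ring_nf
    have h4 : 0.7071 ≤ (1 / 4 : ℝ) ^ δ := by
      refine (le_rpow_of_pow_le (k := 4) (l := 1) (s := 0.25) (by norm_num) (by norm_num)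
        (by norm_num) (by norm_num)).trans
        (Real.rpow_le_rpow_of_exponent_ge (by norm_num) (by norm_num) hδ1)
    have h5 : Real.exp (-(1.52 * γ)) ≤ Real.exp (-(2 * (δ * m) * γ)) := by
      refine Real.exp_le_exp.2 (neg_le_neg ?_)
      refine mul_le_mul_of_nonneg_right ?_ hγ0
      norm_num at hδm ⊢
      linarith
    have h6 := one_add_half_exp_le hγ0
    have h7 : Real.exp (γ ^ 2 - 1.52 * γ) = Real.exp (-(1.52 * γ)) * Real.exp (γ ^ 2) := by
      rw [← Real.exp_add]; ring_nf
    rw [ht]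
    have h8 := stdNormalCDF_pos (γ - b)
    have h9 := stdNormalCDF_pos (-γ - b)
    calc _ ≤ 4 * ((1 + 1 / 2) * (1 + Real.exp (-(5 * γ)) / 2)) := by gcongr
      _ ≤ 4 * ((1 + 1 / 2) * (1.876 * Real.exp (γ ^ 2 - 1.52 * γ))) := by gcongr
      _ = 11.256 * (Real.exp (-(1.52 * γ)) * Real.exp (γ ^ 2)) := by rw [h7]; ring
      _ ≤ 0.995 * (16 * 0.7071) * (Real.exp (-(1.52 * γ)) * Real.exp (γ ^ 2)) := by
        gcongr
        norm_num
      _ ≤ 0.995 * (16 * (1 / 4) ^ δ) * (Real.exp (-(2 * (δ * m) * γ)) * Real.exp (γ ^ 2)) := by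
        gcongr
      _ = _ := by ring

/-! ### The tilting inequality in general -/

lemma pos_of_stdNormalCDF_rpow_le {x δ : ℝ} (hδ : 0 < δ) (hδ1 : δ ≤ 1)
    (h : stdNormalCDF (-x) ^ δ ≤ 1 / 4) : 0 < x := by
  by_contra! hcon
  have h5 : 1 / 2 ≤ stdNormalCDF (-x) := by
    rw [← stdNormalCDF_zero]
    exact strictMono_stdNormalCDF.monotone (by linarith)
  have h6 : (1 / 2 : ℝ) ≤ stdNormalCDF (-x) ^ δ :=
    le_trans ((Real.rpow_one _).symm.trans_le
      (Real.rpow_le_rpow_of_exponent_ge (by norm_num) (by norm_num) hδ1))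
      (Real.rpow_le_rpow (by norm_num) h5 hδ.le)
  linarith

/-- The analytic heart of the argument: if `Φ(-2α) ^ δ` stays below `1/4`, then for every moderate
`γ` the exponential tilt `t` can be chosen so that the tilted partition function of a vertex,
averaged geometrically over the two halves of the vertex set, beats the entropy factor. -/
lemma exists_tilt {ε : ℝ} (hε : 0 < ε) (hε1 : ε ≤ 1 / 10) :
    ∃ ρ : ℝ, 0 < ρ ∧ ρ < 1 ∧ ∀ δ α : ℝ, 0 < δ → stdNormalCDF (-(2 * α)) ^ δ ≤ 1 / 4 - ε →
      δ ≤ 1 → ∀ γ : ℝ, |γ| ≤ 1.18 → ∃ t, 1 ≤ t ∧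
        4 * ((1 + t * stdNormalCDF (γ - 2 * α)) * (1 + t * stdNormalCDF (-γ - 2 * α))) ≤
          ρ * (t ^ (2 * δ) * Real.exp (γ ^ 2)) := by
  refine ⟨max 0.995 ((1 - 4 * ε) ^ 2), lt_max_of_lt_left (by norm_num),
    max_lt (by norm_num) (by nlinarith), fun δ α hδ h hδ1 γ hγ ↦ ?_⟩
  have mono : ∀ b t : ℝ, b ≤ 2 * α → 1 ≤ t → ∀ γ : ℝ,
      4 * ((1 + t * stdNormalCDF (γ - b)) * (1 + t * stdNormalCDF (-γ - b))) ≤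
        0.995 * (t ^ (2 * δ) * Real.exp (γ ^ 2)) →
      4 * ((1 + t * stdNormalCDF (γ - 2 * α)) * (1 + t * stdNormalCDF (-γ - 2 * α))) ≤
        max 0.995 ((1 - 4 * ε) ^ 2) * (t ^ (2 * δ) * Real.exp (γ ^ 2)) := by
    intro b t hb ht γ h1
    have h2 := stdNormalCDF_pos (γ - 2 * α)
    have h3 := stdNormalCDF_pos (-γ - 2 * α)
    have h4 := strictMono_stdNormalCDF.monotone (show γ - 2 * α ≤ γ - b by linarith)
    have h5 := strictMono_stdNormalCDF.monotone (show -γ - 2 * α ≤ -γ - b by linarith)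
    have h6 := stdNormalCDF_pos (γ - b)
    refine le_trans ?_ (h1.trans ?_)
    · gcongr
    · gcongr
      exact le_max_left _ _
  -- The statement is symmetric under `γ ↦ -γ`.
  wlog hγ0 : 0 ≤ γ generalizing γ
  · obtain ⟨t, ht, h1⟩ := this (-γ) (by rwa [abs_neg]) (by linarith)
    refine ⟨t, ht, ?_⟩
    rw [neg_neg, neg_sq] at h1
    rwa [mul_comm (1 + t * stdNormalCDF (γ - 2 * α))]
  have hγ1 : γ ≤ 1.18 := (le_abs_self γ).trans hγ
  have h4 : stdNormalCDF (-(2 * α)) ^ δ ≤ 1 / 4 := by linarith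
  -- `Φ` is increasing, so a tilt that works for some `b ≤ 2 α` also works for `2 α`.
  rcases le_total δ 0.25 with h1 | h1
  · obtain ⟨b, t, hb, ht, h2⟩ := exists_tilt_of_tiny hδ h1 h4 hγ0 hγ1
    exact ⟨t, ht, mono b t hb ht γ h2⟩
  rcases le_total δ 0.385 with h2 | h2
  · obtain ⟨b, t, hb, ht, h2⟩ := exists_tilt_of_small h1 h2 h4 hγ0 hγ1
    exact ⟨t, ht, mono b t hb ht γ h2⟩
  rcases le_total (2 * α) 1.94 with h3 | h3
  · have hα := pos_of_stdNormalCDF_rpow_le hδ hδ1 h4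
    obtain ⟨t, ht, h5⟩ := exists_tilt_of_le (b := 2 * α) (δ := δ) (ρ := 1 - 4 * ε)
      (by rwa [abs_of_pos hα]) (by linarith) hγ
    refine ⟨t, ht, h5.trans ?_⟩
    gcongr
    exact le_max_right _ _
  · -- For `2 α ≥ 1.94` and `δ ≥ 0.385` the case `b = 1.94` applies, as there `4 Φ(-b) ^ δ ≤ 0.997`
    -- and `0.997 ^ 2 ≤ 0.995`.
    have h5 : stdNormalCDF (-1.94) ≤ 0.02704 := by
      have h6 := mul_stdNormalTail_le' (x := 1.94) (by norm_num)
      have h7 : (√(2 * Real.pi))⁻¹ ≤ 0.399 := by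
        rw [inv_le_comm₀ (by positivity) (by norm_num)]
        apply Real.le_sqrt_of_sq_le
        have := Real.pi_gt_d4
        norm_num at this ⊢
        linarith
      have h8 : Real.exp (-1.94 ^ 2 / 2) ≤ 6.482⁻¹ := by
        rw [neg_div, Real.exp_neg]
        refine inv_anti₀ (by norm_num) (le_trans (by norm_num) (taylor_le_exp (by norm_num)))
      have h9 : stdNormalPDF 1.94 ≤ 0.399 * 6.482⁻¹ := by
        unfold stdNormalPDF
        gcongr
      unfold stdNormalTail at h6
      norm_num at *
      linarith
    have h6 : stdNormalCDF (-1.94) ^ δ ≤ 0.24925 := by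
      calc _ ≤ stdNormalCDF (-1.94) ^ (0.385 : ℝ) :=
            Real.rpow_le_rpow_of_exponent_ge (stdNormalCDF_pos _) (stdNormalCDF_le_one _) h2
        _ ≤ 0.02704 ^ (0.385 : ℝ) :=
            Real.rpow_le_rpow (stdNormalCDF_pos _).le h5 (by norm_num)
        _ ≤ 0.24925 := by
            refine le_of_pow_le_pow_left₀ (n := 200) (by norm_num) (by norm_num) ?_
            rw [← Real.rpow_natCast (_ ^ (0.385 : ℝ)), ← Real.rpow_mul (by norm_num),
              show (0.385 : ℝ) * (200 : ℕ) = (77 : ℕ) by norm_num, Real.rpow_natCast]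
            norm_num
    replace h6 : 4 * stdNormalCDF (-1.94) ^ δ ≤ 0.997 := by
      norm_num at *
      linarith
    obtain ⟨t, ht, h7⟩ := exists_tilt_of_le (b := 1.94) (δ := δ) (ρ := 0.997)
      (by norm_num) h6 hγ
    refine ⟨t, ht, mono 1.94 t h3 ht γ (h7.trans ?_)⟩
    gcongr
    norm_num

/-! ### Exchanging the factors of a product measure -/

/-- Exchanging one factor of a product measure. -/
lemma lintegral_pi_le_of_eq_off {ι : Type*} [Fintype ι] [DecidableEq ι] {X : ι → Type*}
    [∀ i, MeasurableSpace (X i)] {μ ν : ∀ i, Measure (X i)} [∀ i, IsProbabilityMeasure (μ i)]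
    [∀ i, IsProbabilityMeasure (ν i)] {Ψ : (∀ i, X i) → ENNReal} (hΨ : Measurable Ψ) {c : ENNReal}
    (hc : c ≠ ⊤) (i : ι) (hi : ∀ j, j ≠ i → μ j = ν j)
    (h : ∀ x, ∫⁻ t, Ψ (Function.update x i t) ∂μ i ≤ c * ∫⁻ t, Ψ (Function.update x i t) ∂ν i) :
    ∫⁻ x, Ψ x ∂Measure.pi μ ≤ c * ∫⁻ x, Ψ x ∂Measure.pi ν := by
  have hne : ∀ i, Nonempty (X i) := fun i ↦ (μ i).nonempty_of_neZero
  have x : ∀ i, X i := fun i ↦ (hne i).some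
  rw [lintegral_eq_lmarginal_univ x, lintegral_eq_lmarginal_univ (μ := ν) x,
    ← Finset.insert_erase (Finset.mem_univ i),
    lmarginal_insert' _ hΨ (Finset.notMem_erase i _),
    lmarginal_insert' _ hΨ (Finset.notMem_erase i _)]
  have hμν : (fun j : (Finset.univ.erase i : Finset ι) ↦ μ j) =
      fun j : (Finset.univ.erase i : Finset ι) ↦ ν j :=
    funext fun j ↦ hi j (Finset.ne_of_mem_erase j.2)
  unfold lmarginal
  rw [hμν, ← lintegral_const_mul' _ _ hc]
  exact lintegral_mono fun y ↦ h _

/-- Exchanging the factors of a product measure one after the other. -/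
lemma lintegral_pi_le_pow_mul {ι : Type*} [Fintype ι] [DecidableEq ι] {X : ι → Type*}
    [∀ i, MeasurableSpace (X i)] {μ ν : ∀ i, Measure (X i)} [∀ i, IsProbabilityMeasure (μ i)]
    [∀ i, IsProbabilityMeasure (ν i)] {Ψ : (∀ i, X i) → ENNReal} (hΨ : Measurable Ψ) {c : ENNReal}
    (hc : c ≠ ⊤)
    (h : ∀ i x, ∫⁻ t, Ψ (Function.update x i t) ∂μ i ≤
      c * ∫⁻ t, Ψ (Function.update x i t) ∂ν i) :
    ∫⁻ x, Ψ x ∂Measure.pi μ ≤ c ^ Fintype.card ι * ∫⁻ x, Ψ x ∂Measure.pi ν := by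
  have key : ∀ s : Finset ι, ∫⁻ x, Ψ x ∂Measure.pi μ ≤
      c ^ s.card * ∫⁻ x, Ψ x ∂Measure.pi (fun i ↦ if i ∈ s then ν i else μ i) := by
    intro s
    induction s using Finset.induction_on with
    | empty => simp
    | insert i s hi ih =>
      have inst : ∀ s : Finset ι, ∀ j, IsProbabilityMeasure (if j ∈ s then ν j else μ j) := by
        intro s j
        split_ifs <;> infer_instance
      refine ih.trans ?_
      rw [Finset.card_insert_of_notMem hi, pow_succ, mul_assoc]
      gcongr
      refine lintegral_pi_le_of_eq_off hΨ hc i (fun j hj ↦ ?_) fun x ↦ ?_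
      · simp [hj]
      · simpa [hi] using h i x
  simpa using key Finset.univ

/-- Second order Taylor expansion at `0` with a cubic remainder. -/
lemma abs_taylor_two_le {g g₁ g₂ g₃ : ℝ → ℝ} {M : ℝ} (h1 : ∀ x, HasDerivAt g (g₁ x) x)
    (h2 : ∀ x, HasDerivAt g₁ (g₂ x) x) (h3 : ∀ x, HasDerivAt g₂ (g₃ x) x)
    (hM : ∀ x, |g₃ x| ≤ M) (x : ℝ) :
    |g x - g 0 - g₁ 0 * x - g₂ 0 / 2 * x ^ 2| ≤ M * |x| ^ 3 := by
  have mvt : ∀ (f f' : ℝ → ℝ) (x K : ℝ), (∀ y, HasDerivAt f (f' y) y) → f 0 = 0 →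
      (∀ y, |y| ≤ |x| → |f' y| ≤ K) → |f x| ≤ K * |x| := by
    intro f f' x K hf hf0 hK
    have := (convex_Icc (-|x|) |x|).norm_image_sub_le_of_norm_hasDerivWithin_le
      (f := f) (f' := f') (C := K) (x := 0) (y := x) (fun y _ ↦ (hf y).hasDerivWithinAt)
      (fun y hy ↦ hK y (abs_le.2 hy)) ⟨by linarith [abs_nonneg x], abs_nonneg x⟩
      ⟨neg_abs_le x, le_abs_self x⟩
    simpa [hf0] using this
  have hM0 : 0 ≤ M := (abs_nonneg _).trans (hM 0)
  have e2 : ∀ y, |g₂ y - g₂ 0| ≤ M * |y| := fun y ↦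
    mvt (fun y ↦ g₂ y - g₂ 0) g₃ y M (fun z ↦ (h3 z).sub_const _) (by simp) fun z _ ↦ hM z
  have e1 : ∀ y, |g₁ y - g₁ 0 - g₂ 0 * y| ≤ M * |y| * |y| := fun y ↦
    mvt (fun y ↦ g₁ y - g₁ 0 - g₂ 0 * y) (fun y ↦ g₂ y - g₂ 0) y (M * |y|)
      (fun z ↦ (((h2 z).sub_const _).sub ((hasDerivAt_id z).const_mul _)).congr_deriv (by simp))
      (by simp) fun z hz ↦ (e2 z).trans (by gcongr)
  refine (mvt (fun y ↦ g y - g 0 - g₁ 0 * y - g₂ 0 / 2 * y ^ 2)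
    (fun y ↦ g₁ y - g₁ 0 - g₂ 0 * y) x (M * |x| * |x|)
      (fun z ↦ ((((h1 z).sub_const _).sub ((hasDerivAt_id z).const_mul _)).sub
        ((hasDerivAt_pow 2 z).const_mul _)).congr_deriv ?_)
      (by simp) fun z hz ↦ (e1 z).trans (by gcongr)).trans_eq (by ring)
  simp
  ring

/-- A centred law on the line with unit variance and third absolute moment at most `T`. -/
structure IsStandardized (m : Measure ℝ) (T : ℝ) : Prop where
  integrable_cube : Integrable (fun x ↦ |x| ^ 3) m
  integrable_sq : Integrable (fun x ↦ x ^ 2) m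
  integrable_id : Integrable (fun x ↦ x) m
  mean : ∫ x, x ∂m = 0
  sq : ∫ x, x ^ 2 ∂m = 1
  cube : ∫ x, |x| ^ 3 ∂m ≤ T

/-- The mean of a smooth function under a standardized law is determined up to third order. -/
lemma IsStandardized.abs_integral_sub_le {m : Measure ℝ} [IsProbabilityMeasure m] {T : ℝ}
    (hm : IsStandardized m T) {g g₁ g₂ g₃ : ℝ → ℝ} {M B : ℝ} (h1 : ∀ x, HasDerivAt g (g₁ x) x)
    (h2 : ∀ x, HasDerivAt g₁ (g₂ x) x) (h3 : ∀ x, HasDerivAt g₂ (g₃ x) x)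
    (hM : ∀ x, |g₃ x| ≤ M) (hB : ∀ x, |g x| ≤ B) :
    |∫ x, g x ∂m - (g 0 + g₂ 0 / 2)| ≤ M * T := by
  have hM0 : 0 ≤ M := (abs_nonneg _).trans (hM 0)
  have hg : Integrable g m := Integrable.of_bound
    (continuous_iff_continuousAt.2 fun x ↦ (h1 x).continuousAt).aestronglyMeasurable B
    (ae_of_all _ hB)
  have e1 : ∫ x, (g x - g 0 - g₁ 0 * x - g₂ 0 / 2 * x ^ 2) ∂m =
      ∫ x, g x ∂m - (g 0 + g₂ 0 / 2) := by
    have i1 : Integrable (fun x ↦ g x - g 0) m := hg.sub (integrable_const _)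
    have i2 : Integrable (fun x ↦ g x - g 0 - g₁ 0 * x) m := i1.sub (hm.integrable_id.const_mul _)
    rw [integral_sub i2 (hm.integrable_sq.const_mul _),
      integral_sub i1 (hm.integrable_id.const_mul _), integral_sub hg (integrable_const _),
      integral_const_mul, integral_const_mul, hm.mean, hm.sq]
    simp
    ring
  rw [← e1]
  calc _ ≤ ∫ x, |g x - g 0 - g₁ 0 * x - g₂ 0 / 2 * x ^ 2| ∂m := abs_integral_le_integral_abs
    _ ≤ ∫ x, M * |x| ^ 3 ∂m := by
      refine integral_mono_of_nonneg (ae_of_all _ fun x ↦ abs_nonneg _)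
        (hm.integrable_cube.const_mul _) (ae_of_all _ fun x ↦ abs_taylor_two_le h1 h2 h3 hM x)
    _ ≤ M * T := by
      rw [integral_const_mul]
      exact mul_le_mul_of_nonneg_left hm.cube hM0

/-- One exchange step of Lindeberg's method, for a function bounded away from `0`. -/
lemma IsStandardized.integral_le {m m' : Measure ℝ} [IsProbabilityMeasure m]
    [IsProbabilityMeasure m'] {T T' : ℝ} (hm : IsStandardized m T) (hm' : IsStandardized m' T')
    {g g₁ g₂ g₃ : ℝ → ℝ} {M B b : ℝ} (h1 : ∀ x, HasDerivAt g (g₁ x) x)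
    (h2 : ∀ x, HasDerivAt g₁ (g₂ x) x) (h3 : ∀ x, HasDerivAt g₂ (g₃ x) x)
    (hM : ∀ x, |g₃ x| ≤ M) (hb : 0 < b) (hg : ∀ x, b ≤ g x) (hB : ∀ x, g x ≤ B) :
    ∫ x, g x ∂m ≤ (1 + M * (T + T') / b) * ∫ x, g x ∂m' := by
  have hB' : ∀ x, |g x| ≤ B := fun x ↦ (abs_of_nonneg (hb.le.trans (hg x))).trans_le (hB x)
  have e1 := abs_le.1 (hm.abs_integral_sub_le h1 h2 h3 hM hB')
  have e2 := abs_le.1 (hm'.abs_integral_sub_le h1 h2 h3 hM hB')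
  have hM0 : 0 ≤ M := (abs_nonneg _).trans (hM 0)
  have hT : 0 ≤ T := le_trans (integral_nonneg fun x ↦ by positivity) hm.cube
  have hT' : 0 ≤ T' := le_trans (integral_nonneg fun x ↦ by positivity) hm'.cube
  have e3 : b ≤ ∫ x, g x ∂m' := by
    have hgi : Integrable g m' := Integrable.of_bound
      (continuous_iff_continuousAt.2 fun x ↦ (h1 x).continuousAt).aestronglyMeasurable B
      (ae_of_all _ hB')
    simpa using integral_mono (integrable_const b) hgi hg
  have e4 : M * (T + T') ≤ M * (T + T') / b * ∫ x, g x ∂m' := by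
    rw [div_mul_eq_mul_div, le_div_iff₀ hb]
    gcongr
  linarith [e1.1, e1.2, e2.1, e2.2]

lemma isStandardized_gaussianReal :
    IsStandardized (gaussianReal 0 1) (∫ x, |x| ^ 3 ∂gaussianReal 0 1) := by
  have hp : ∀ k : ℕ, Integrable (fun x : ℝ ↦ ‖x‖ ^ k) (gaussianReal 0 1) := fun k ↦ by
    have := (memLp_id_gaussianReal (μ := 0) (v := 1) (k : NNReal))
    exact this.integrable_norm_pow'
  refine ⟨hp 3, by simpa using hp 2, ?_, by simp, ?_, le_rfl⟩
  · exact (memLp_id_gaussianReal (μ := 0) (v := 1) 1).integrable le_rfl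
  · have h1 := variance_fun_id_gaussianReal (μ := 0) (v := 1)
    rw [variance_eq_sub (X := fun x ↦ x) (memLp_id_gaussianReal 2)] at h1
    simpa using h1

/-! ### Smoothed indicators -/

/-- A smoothed indicator of the half line `x ≤ a`, bounded away from `0` by `η`. -/
noncomputable def smoothStep (η a τ x : ℝ) : ℝ := η + stdNormalCDF ((a - x) / τ)

section smoothStep

variable {η a τ : ℝ}

lemma le_smoothStep (x : ℝ) : η ≤ smoothStep η a τ x :=
  le_add_of_nonneg_right (stdNormalCDF_pos _).le

lemma smoothStep_le (x : ℝ) : smoothStep η a τ x ≤ 1 + η := by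
  unfold smoothStep
  linarith [stdNormalCDF_le_one ((a - x) / τ)]

lemma continuous_smoothStep : Continuous (smoothStep η a τ) :=
  continuous_const.add (continuous_stdNormalCDF.comp (by fun_prop))

lemma stdNormalPDF_moment_bounds (x : ℝ) : stdNormalPDF x ≤ 1 ∧ |x * stdNormalPDF x| ≤ 1 ∧
    |(x ^ 2 - 1) * stdNormalPDF x| ≤ 1 := by
  have h0 := stdNormalPDF_pos x
  have h1 : stdNormalPDF x * (1 + x ^ 2 / 2) ≤ 1 / 2 := by
    have h2 : 1 + x ^ 2 / 2 ≤ Real.exp (x ^ 2 / 2) := by linarith [Real.add_one_le_exp (x ^ 2 / 2)]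
    calc stdNormalPDF x * (1 + x ^ 2 / 2) ≤ stdNormalPDF x * Real.exp (x ^ 2 / 2) := by gcongr
      _ = (√(2 * Real.pi))⁻¹ := by
        rw [stdNormalPDF, mul_assoc, ← Real.exp_add]
        ring_nf
        simp
      _ ≤ 1 / 2 := inv_sqrt_two_pi_le
  refine ⟨by nlinarith [sq_nonneg x], abs_le.2 ⟨?_, ?_⟩, abs_le.2 ⟨?_, ?_⟩⟩
  · nlinarith [mul_nonneg h0.le (sq_nonneg (x + 1))]
  · nlinarith [mul_nonneg h0.le (sq_nonneg (x - 1))]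
  · nlinarith [mul_nonneg h0.le (sq_nonneg x)]
  · nlinarith [mul_nonneg h0.le (sq_nonneg x)]

/-- The first three derivatives of `r ↦ smoothStep (A + w r)`, with bounds. -/
lemma exists_derivs_smoothStep (A w : ℝ) : ∃ f₁ f₂ f₃ : ℝ → ℝ,
    (∀ r, HasDerivAt (fun r ↦ smoothStep η a τ (A + w * r)) (f₁ r) r) ∧
    (∀ r, HasDerivAt f₁ (f₂ r) r) ∧ (∀ r, HasDerivAt f₂ (f₃ r) r) ∧
    (∀ r, |f₁ r| ≤ |w / τ|) ∧ (∀ r, |f₂ r| ≤ |w / τ| ^ 2) ∧ (∀ r, |f₃ r| ≤ |w / τ| ^ 3) := by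
  set u : ℝ → ℝ := fun r ↦ (a - (A + w * r)) / τ with hu
  set d : ℝ := -(w / τ) with hd
  have hdu : ∀ r, HasDerivAt u d r := fun r ↦
    ((((hasDerivAt_id r).const_mul w).const_add A).const_sub a |>.div_const τ).congr_deriv
      (by rw [hd]; ring)
  have hp : ∀ r, HasDerivAt (fun r ↦ stdNormalPDF (u r)) (-u r * stdNormalPDF (u r) * d) r :=
    fun r ↦ (hasDerivAt_stdNormalPDF (u r)).comp r (hdu r)
  refine ⟨fun r ↦ stdNormalPDF (u r) * d, fun r ↦ -u r * stdNormalPDF (u r) * d * d,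
    fun r ↦ ((u r) ^ 2 - 1) * stdNormalPDF (u r) * d ^ 3, fun r ↦ ?_, fun r ↦ ?_, fun r ↦ ?_,
    fun r ↦ ?_, fun r ↦ ?_, fun r ↦ ?_⟩
  · exact ((hasDerivAt_stdNormalCDF (u r)).comp r (hdu r)).const_add η
  · exact (hp r).mul_const d
  · exact (((hdu r).neg.mul (hp r)).mul_const d |>.mul_const d).congr_deriv (by simp; ring)
  · obtain ⟨b1, -, -⟩ := stdNormalPDF_moment_bounds (u r)
    rw [abs_mul, abs_of_pos (stdNormalPDF_pos _), hd, abs_neg]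
    exact mul_le_of_le_one_left (abs_nonneg _) b1
  · obtain ⟨-, b1, -⟩ := stdNormalPDF_moment_bounds (u r)
    change |-u r * stdNormalPDF (u r) * d * d| ≤ _
    rw [mul_assoc, abs_mul, neg_mul, abs_neg, ← sq, abs_pow, hd, abs_neg]
    exact mul_le_of_le_one_left (by positivity) b1
  · obtain ⟨-, -, b1⟩ := stdNormalPDF_moment_bounds (u r)
    rw [abs_mul, abs_pow, hd, abs_neg]
    exact mul_le_of_le_one_left (by positivity) b1

/-- Exchanging one coordinate on which two of the factors depend: the cost of replacing one
standardized law by another is of third order in the coefficient `w` of the coordinate. -/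
lemma IsStandardized.integral_smoothStep_mul_le {m m' : Measure ℝ} [IsProbabilityMeasure m]
    [IsProbabilityMeasure m'] {T T' : ℝ} (hm : IsStandardized m T) (hm' : IsStandardized m' T')
    (hη : 0 < η) (hη1 : η ≤ 1) {A A' w w' D : ℝ} (hw : |w / τ| ≤ D) (hw' : |w' / τ| ≤ D) :
    ∫ x, smoothStep η a τ (A + w * x) * smoothStep η a τ (A' + w' * x) ∂m ≤
      (1 + 10 * D ^ 3 * (T + T') / η ^ 2) *
        ∫ x, smoothStep η a τ (A + w * x) * smoothStep η a τ (A' + w' * x) ∂m' := by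
  obtain ⟨f₁, f₂, f₃, d1, d2, d3, b1, b2, b3⟩ := exists_derivs_smoothStep (η := η) (a := a)
    (τ := τ) A w
  obtain ⟨g₁, g₂, g₃, e1, e2, e3, c1, c2, c3⟩ := exists_derivs_smoothStep (η := η) (a := a)
    (τ := τ) A' w'
  set f := fun x ↦ smoothStep η a τ (A + w * x) with hf
  set g := fun x ↦ smoothStep η a τ (A' + w' * x) with hg
  have hD : 0 ≤ D := (abs_nonneg _).trans hw
  have hf0 : ∀ x, η ≤ f x := fun x ↦ le_smoothStep _
  have hg0 : ∀ x, η ≤ g x := fun x ↦ le_smoothStep _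
  have hf2 : ∀ x, f x ≤ 2 := fun x ↦ (smoothStep_le _).trans (by linarith)
  have hg2 : ∀ x, g x ≤ 2 := fun x ↦ (smoothStep_le _).trans (by linarith)
  refine hm.integral_le hm' (g := fun x ↦ f x * g x)
    (g₁ := fun x ↦ f₁ x * g x + f x * g₁ x)
    (g₂ := fun x ↦ f₂ x * g x + f₁ x * g₁ x + (f₁ x * g₁ x + f x * g₂ x))
    (g₃ := fun x ↦ f₃ x * g x + f₂ x * g₁ x + (f₂ x * g₁ x + f₁ x * g₂ x) +
      (f₂ x * g₁ x + f₁ x * g₂ x + (f₁ x * g₂ x + f x * g₃ x)))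
    (B := 2 * 2) (fun x ↦ (d1 x).mul (e1 x))
    (fun x ↦ ((d2 x).mul (e1 x)).add ((d1 x).mul (e2 x)))
    (fun x ↦ (((d3 x).mul (e1 x)).add ((d2 x).mul (e2 x))).add
      (((d2 x).mul (e2 x)).add ((d1 x).mul (e3 x))))
    (fun x ↦ ?_) (by positivity) (fun x ↦ ?_) fun x ↦ ?_
  · have key : ∀ {y z Y Z : ℝ}, |y| ≤ Y → |z| ≤ Z → |y * z| ≤ Y * Z := fun hy hz ↦ by
      rw [abs_mul]
      exact mul_le_mul hy hz (abs_nonneg _) ((abs_nonneg _).trans hy)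
    have f0 : |f x| ≤ 2 := abs_le.2 ⟨by linarith [hf0 x], hf2 x⟩
    have g0 : |g x| ≤ 2 := abs_le.2 ⟨by linarith [hg0 x], hg2 x⟩
    have f1 := (b1 x).trans hw
    have f2 := (b2 x).trans (pow_le_pow_left₀ (abs_nonneg _) hw 2)
    have f3 := (b3 x).trans (pow_le_pow_left₀ (abs_nonneg _) hw 3)
    have g1 := (c1 x).trans hw'
    have g2 := (c2 x).trans (pow_le_pow_left₀ (abs_nonneg _) hw' 2)
    have g3 := (c3 x).trans (pow_le_pow_left₀ (abs_nonneg _) hw' 3)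
    have k1 := abs_le.1 (key f3 g0)
    have k2 := abs_le.1 (key f2 g1)
    have k3 := abs_le.1 (key f1 g2)
    have k4 := abs_le.1 (key f0 g3)
    have hD3 : D ^ 2 * D = D ^ 3 ∧ D * D ^ 2 = D ^ 3 := ⟨by ring, by ring⟩
    rw [hD3.1] at k2
    rw [hD3.2] at k3
    exact abs_le.2 ⟨by linarith [k1.1, k2.1, k3.1, k4.1], by linarith [k1.2, k2.2, k3.2, k4.2]⟩
  · nlinarith [hf0 x, hg0 x]
  · exact mul_le_mul (hf2 x) (hg2 x) (hη.le.trans (hg0 x)) (by norm_num)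

end smoothStep

/-! ### Lindeberg's exchange argument for the random field of a graph -/

section Lindeberg

variable {V : Type*} [Fintype V] [DecidableEq V]

/-- The field felt by the vertex `v` when the edge `s(u, v)` carries the weight `x s(u, v)` and the
vertex `u` the spin `s u`. Only the off-diagonal coordinates of `x` matter. -/
noncomputable def localField (s : V → ℝ) (w : ℝ) (x : Sym2 V → ℝ) (v : V) : ℝ :=
  w * ∑ u ∈ Finset.univ.erase v, s u * x s(u, v)

/-- The smoothed indicator of the event that the field `β + localField s w x v` has sign `-e v` at
every vertex `v`. -/
noncomputable def fieldWeight (η a τ β w : ℝ) (s e : V → ℝ) (x : Sym2 V → ℝ) : ENNReal :=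
  ∏ v, ENNReal.ofReal (smoothStep η a τ (e v * (β + localField s w x v)))

lemma measurable_fieldWeight (η a τ β w : ℝ) (s e : V → ℝ) :
    Measurable (fieldWeight η a τ β w s e) := by
  refine Finset.measurable_fun_prod _ fun v _ ↦ ENNReal.measurable_ofReal.comp
    (continuous_smoothStep.measurable.comp ?_)
  unfold localField
  fun_prop

lemma localField_update_of_ne (s : V → ℝ) (w : ℝ) (x : Sym2 V → ℝ) {i : Sym2 V} (t : ℝ) {v : V}
    (h : ∀ u, u ≠ v → s(u, v) ≠ i) :
    localField s w (Function.update x i t) v = localField s w x v := by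
  unfold localField
  congr 1
  refine Finset.sum_congr rfl fun u hu ↦ ?_
  rw [Function.update_of_ne (h u (Finset.ne_of_mem_erase hu))]

lemma localField_update (s : V → ℝ) (w : ℝ) (x : Sym2 V → ℝ) {u v : V} (huv : u ≠ v) (t : ℝ) :
    localField s w (Function.update x s(u, v) t) v =
      localField s w (Function.update x s(u, v) 0) v + w * s u * t := by
  unfold localField
  rw [mul_assoc, ← mul_add]
  congr 1
  have hu : u ∈ Finset.univ.erase v := Finset.mem_erase.2 ⟨huv, Finset.mem_univ _⟩
  rw [← Finset.add_sum_erase _ _ hu, ← Finset.add_sum_erase _ _ hu]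
  have : ∀ r, ∑ u' ∈ (Finset.univ.erase v).erase u,
      s u' * Function.update x s(u, v) r s(u', v) =
      ∑ u' ∈ (Finset.univ.erase v).erase u, s u' * x s(u', v) := fun r ↦ by
    refine Finset.sum_congr rfl fun u' hu' ↦ ?_
    rw [Function.update_of_ne]
    intro h
    exact Finset.ne_of_mem_erase hu' (Sym2.congr_left.1 h)
  rw [this, this]
  simp
  ring

/-- The weight of the edge `s(u, v)` occurs in exactly two factors of the product, those of `u` and
`v`. A diagonal coordinate occurs in none, so nothing is assumed about its law. -/
lemma lintegral_fieldWeight_update_le {m m' : Measure ℝ} [IsProbabilityMeasure m]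
    [IsProbabilityMeasure m'] {T T' : ℝ} {i : Sym2 V} (hm : ¬ i.IsDiag → IsStandardized m T)
    (hm' : IsStandardized m' T') {η a τ β w : ℝ} {s e : V → ℝ} (hη : 0 < η) (hη1 : η ≤ 1)
    (hT : 0 ≤ T) (hs : ∀ v, |s v| = 1) (he : ∀ v, |e v| = 1) (x : Sym2 V → ℝ) :
    ∫⁻ t, fieldWeight η a τ β w s e (Function.update x i t) ∂m ≤
      ENNReal.ofReal (1 + 10 * |w / τ| ^ 3 * (T + T') / η ^ 2) *
        ∫⁻ t, fieldWeight η a τ β w s e (Function.update x i t) ∂m' := by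
  have hT' : 0 ≤ T' := le_trans (integral_nonneg fun x ↦ by positivity) hm'.cube
  have hκ : 0 ≤ 10 * |w / τ| ^ 3 * (T + T') / η ^ 2 := by positivity
  by_cases hi : i.IsDiag
  · have h1 : ∀ t, fieldWeight η a τ β w s e (Function.update x i t) =
        fieldWeight η a τ β w s e x := fun t ↦ by
      unfold fieldWeight
      refine Finset.prod_congr rfl fun v _ ↦ ?_
      rw [localField_update_of_ne]
      rintro u huv rfl
      exact huv hi
    simp_rw [h1, lintegral_const, measure_univ, mul_one]
    exact le_mul_of_one_le_left' (ENNReal.one_le_ofReal.2 (by linarith))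
  replace hm := hm hi
  induction i using Sym2.ind with | _ u v =>
  have huv : u ≠ v := hi
  have hvu : s(v, u) = s(u, v) := Sym2.eq_swap
  set A := e v * (β + localField s w (Function.update x s(u, v) 0) v) with hA
  set B := e u * (β + localField s w (Function.update x s(u, v) 0) u) with hB
  set P : ENNReal := ∏ z ∈ (Finset.univ.erase v).erase u,
    ENNReal.ofReal (smoothStep η a τ (e z * (β + localField s w x z))) with hP
  have hPtop : P ≠ ⊤ := ENNReal.prod_ne_top fun _ _ ↦ ENNReal.ofReal_ne_top
  have hfac : ∀ t, fieldWeight η a τ β w s e (Function.update x s(u, v) t) =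
      ENNReal.ofReal (smoothStep η a τ (A + e v * (w * s u) * t) *
        smoothStep η a τ (B + e u * (w * s v) * t)) * P := fun t ↦ by
    unfold fieldWeight
    rw [← Finset.mul_prod_erase _ _ (Finset.mem_univ v), ← Finset.mul_prod_erase _ _
      (Finset.mem_erase.2 ⟨huv, Finset.mem_univ u⟩), ← mul_assoc, ENNReal.ofReal_mul
      (hη.le.trans (le_smoothStep _))]
    congr 1
    · congr 3
      · rw [localField_update _ _ _ huv, hA]; ring
      · rw [← hvu, localField_update _ _ _ huv.symm, hB, hvu]; ring
    · refine Finset.prod_congr rfl fun z hz ↦ ?_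
      have hzu := Finset.ne_of_mem_erase hz
      have hzv := Finset.ne_of_mem_erase (Finset.mem_of_mem_erase hz)
      rw [localField_update_of_ne]
      intro y _ h
      have : z ∈ s(u, v) := h ▸ Sym2.mem_mk_right _ _
      rcases Sym2.mem_iff.1 this with h | h
      · exact hzu h
      · exact hzv h
  have hw : ∀ y z, |e y * (w * s z) / τ| ≤ |w / τ| := fun y z ↦ by
    rw [abs_div, abs_mul, abs_mul, he, hs, mul_one, one_mul, abs_div]
  have hmain := hm.integral_smoothStep_mul_le hm' (η := η) (a := a) (τ := τ) hη hη1 (A := A)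
    (A' := B) (hw v u) (hw u v)
  have hpos : ∀ t, 0 ≤ smoothStep η a τ (A + e v * (w * s u) * t) *
      smoothStep η a τ (B + e u * (w * s v) * t) := fun t ↦
    mul_nonneg (hη.le.trans (le_smoothStep _)) (hη.le.trans (le_smoothStep _))
  have hint : ∀ k : Measure ℝ, IsProbabilityMeasure k → Integrable
      (fun t ↦ smoothStep η a τ (A + e v * (w * s u) * t) *
      smoothStep η a τ (B + e u * (w * s v) * t)) k := fun k _ ↦ by
    refine Integrable.of_bound (C := 2 * 2) (Continuous.aestronglyMeasurable ?_)
      (ae_of_all _ fun t ↦ ?_)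
    · exact (continuous_smoothStep.comp (by fun_prop)).mul
        (continuous_smoothStep.comp (by fun_prop))
    · rw [Real.norm_of_nonneg (hpos t)]
      exact mul_le_mul ((smoothStep_le _).trans (by linarith))
        ((smoothStep_le _).trans (by linarith)) (hη.le.trans (le_smoothStep _)) (by norm_num)
  simp_rw [hfac]
  rw [lintegral_mul_const' _ _ hPtop, lintegral_mul_const' _ _ hPtop,
    ← ofReal_integral_eq_lintegral_ofReal (hint m inferInstance) (ae_of_all _ hpos),
    ← ofReal_integral_eq_lintegral_ofReal (hint m' inferInstance) (ae_of_all _ hpos),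
    ← mul_assoc (ENNReal.ofReal _) (ENNReal.ofReal _) P, ← ENNReal.ofReal_mul (by linarith)]
  gcongr

/-- Lindeberg's exchange argument: the edge weights may be replaced by Gaussian ones. -/
lemma lintegral_fieldWeight_le {μ : Sym2 V → Measure ℝ} [∀ i, IsProbabilityMeasure (μ i)] {T : ℝ}
    (hμ : ∀ i : Sym2 V, ¬ i.IsDiag → IsStandardized (μ i) T) (hT : 0 ≤ T) {η a τ β w : ℝ}
    {s e : V → ℝ} (hη : 0 < η) (hη1 : η ≤ 1) (hs : ∀ v, |s v| = 1) (he : ∀ v, |e v| = 1) :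
    ∫⁻ x, fieldWeight η a τ β w s e x ∂Measure.pi μ ≤
      ENNReal.ofReal (1 + 10 * |w / τ| ^ 3 * (T + ∫ x, |x| ^ 3 ∂gaussianReal 0 1) / η ^ 2) ^
        Fintype.card (Sym2 V) *
        ∫⁻ x, fieldWeight η a τ β w s e x ∂Measure.pi (fun _ : Sym2 V ↦ gaussianReal 0 1) :=
  lintegral_pi_le_pow_mul (measurable_fieldWeight _ _ _ _ _ _ _) ENNReal.ofReal_ne_top fun i x ↦
    lintegral_fieldWeight_update_le (hμ i) isStandardized_gaussianReal hη hη1 hT hs he x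

end Lindeberg

/-! ### The law of the field with Gaussian edge weights -/

lemma charFunDual_gaussianReal (L : StrongDual ℝ ℝ) :
    charFunDual (gaussianReal 0 1) L = Complex.exp (-((L 1 ^ 2 : ℝ) : ℂ) / 2) := by
  obtain ⟨b, hb⟩ : ∃ b, ∀ x : ℝ, L x = b * x := ⟨L 1, fun x ↦ by
    conv_lhs => rw [← mul_one x, ← smul_eq_mul, map_smul, smul_eq_mul, mul_comm]⟩
  have h2 := charFun_gaussianReal (μ := 0) (v := 1) b
  rw [charFun_apply_real] at h2
  rw [charFunDual_apply]
  simp_rw [hb, Complex.ofReal_mul]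
  rw [mul_one, h2]
  congr 1
  push_cast
  ring

lemma charFunDual_pi_gaussianReal {ι : Type*} [Fintype ι] [DecidableEq ι]
    (L : StrongDual ℝ (ι → ℝ)) :
    charFunDual (Measure.pi fun _ : ι ↦ gaussianReal 0 1) L =
      Complex.exp (-((∑ i, L (Pi.single i 1) ^ 2 : ℝ) : ℂ) / 2) := by
  rw [charFunDual_pi]
  simp_rw [charFunDual_gaussianReal, ← Complex.exp_sum]
  congr 1
  simp only [ContinuousLinearMap.comp_apply, ContinuousLinearMap.single_apply]
  push_cast
  rw [← Finset.sum_div, Finset.sum_neg_distrib]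

section GaussianField

variable {n : ℕ}

/-- Twice a sum over the edges is the sum over the ordered pairs of distinct vertices. -/
lemma two_mul_sum_sym2 (F : Sym2 (Fin n) → ℝ) (hF : ∀ i : Sym2 (Fin n), i.IsDiag → F i = 0) :
    2 * ∑ i, F i = ∑ u, ∑ v ∈ Finset.univ.erase u, F s(u, v) := by
  have h1 : ∑ i, F i = ∑ i ∈ (Finset.univ : Finset (Fin n)).sym2 with ¬ i.IsDiag, F i := by
    rw [Finset.sum_filter, Finset.sym2_univ]
    refine Finset.sum_congr rfl fun i _ ↦ ?_
    split_ifs with h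
    · exact hF i h
    · rfl
  have h2 : ∑ u, ∑ v ∈ Finset.univ.erase u, F s(u, v) =
      ∑ q ∈ (Finset.univ : Finset (Fin n)).offDiag, F s(q.1, q.2) := by
    rw [Finset.sum_sigma']
    refine Finset.sum_bij' (fun q _ ↦ (q.1, q.2)) (fun q _ ↦ ⟨q.1, q.2⟩) ?_ ?_ ?_ ?_ ?_ <;>
      simp [eq_comm]
  rw [h1, h2, Finset.sum_sym2_filter_not_isDiag, ← Finset.sum_filter_add_sum_filter_not
    (Finset.univ : Finset (Fin n)).offDiag (fun q : Fin n × Fin n ↦ q.1 < q.2), two_mul]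
  congr 1
  refine Finset.sum_bij' (fun q _ ↦ (q.2, q.1)) (fun q _ ↦ (q.2, q.1)) ?_ ?_ ?_ ?_ ?_
  · simp only [Finset.mem_filter, Finset.mem_offDiag]
    rintro q ⟨⟨-, -, h⟩, h'⟩
    exact ⟨⟨Finset.mem_univ _, Finset.mem_univ _, h.symm⟩, h'.not_gt⟩
  · simp only [Finset.mem_filter, Finset.mem_offDiag]
    rintro q ⟨⟨-, -, h⟩, h'⟩
    exact ⟨⟨Finset.mem_univ _, Finset.mem_univ _, h.symm⟩, lt_of_le_of_ne (not_lt.1 h') h.symm⟩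
  · simp
  · simp
  · intro q _
    rw [Sym2.eq_swap]

/-- The quadratic form of the covariance matrix of the field, up to normalization. -/
lemma sum_sq_eq_of_cross (s t : Fin n → ℝ) (hs : ∀ v, s v ^ 2 = 1) :
    ∑ u, ∑ v ∈ Finset.univ.erase u, (t u * s v + t v * s u) ^ 2 =
      2 * ((n - 2) * ∑ v, t v ^ 2 + (∑ v, t v * s v) ^ 2) := by
  have h1 : ∀ u, ∑ v ∈ Finset.univ.erase u, (t u * s v + t v * s u) ^ 2 =
      n * t u ^ 2 + ∑ v, t v ^ 2 + 2 * (t u * s u) * ∑ v, t v * s v - 4 * t u ^ 2 := fun u ↦ by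
    have h2 := Finset.sum_erase_add Finset.univ (fun v ↦ (t u * s v + t v * s u) ^ 2)
      (Finset.mem_univ u)
    have h3 : ∀ v, (t u * s v + t v * s u) ^ 2 =
        t u ^ 2 + t v ^ 2 + 2 * (t u * s u) * (t v * s v) := fun v ↦ by
      linear_combination t u ^ 2 * hs v + t v ^ 2 * hs u
    have h4 : ∑ v, (t u * s v + t v * s u) ^ 2 =
        n * t u ^ 2 + ∑ v, t v ^ 2 + 2 * (t u * s u) * ∑ v, t v * s v := by
      simp_rw [h3, Finset.sum_add_distrib, ← Finset.mul_sum]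
      simp
    linear_combination h2 + h4 - 4 * t u ^ 2 * hs u
  simp_rw [h1, Finset.sum_sub_distrib, Finset.sum_add_distrib, ← Finset.sum_mul, ← Finset.mul_sum]
  simp
  ring

/-- The field of independent standard Gaussian edge weights is an exchangeable Gaussian vector up
to the spins: it decouples into independent coordinates given one common Gaussian variable. -/
lemma map_localField_gaussian (s : Fin n → ℝ) (hs : ∀ v, s v ^ 2 = 1) {w c : ℝ}
    (hc : c ^ 2 = (n - 2) * w ^ 2) :
    (Measure.pi fun _ : Sym2 (Fin n) ↦ gaussianReal 0 1).map (localField s w) =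
      ((gaussianReal 0 1).prod (Measure.pi fun _ : Fin n ↦ gaussianReal 0 1)).map
        (fun z v ↦ c * z.2 v + w * s v * z.1) := by
  let L₁ : (Sym2 (Fin n) → ℝ) →L[ℝ] (Fin n → ℝ) := LinearMap.toContinuousLinearMap
    { toFun := localField s w
      map_add' := fun x y ↦ by
        ext v
        simp [localField, mul_add, Finset.sum_add_distrib]
      map_smul' := fun r x ↦ by
        ext v
        simp only [localField, Pi.smul_apply, smul_eq_mul, RingHom.id_apply, Finset.mul_sum]
        exact Finset.sum_congr rfl fun u _ ↦ by ring }
  let L₂ : (ℝ × (Fin n → ℝ)) →L[ℝ] (Fin n → ℝ) := LinearMap.toContinuousLinearMap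
    { toFun := fun z v ↦ c * z.2 v + w * s v * z.1
      map_add' := fun x y ↦ by
        ext v
        simp
        ring
      map_smul' := fun r x ↦ by
        ext v
        simp
        ring }
  change Measure.map L₁ _ = Measure.map L₂ _
  refine Measure.ext_of_charFunDual (funext fun ℓ ↦ ?_)
  rw [charFunDual_map, charFunDual_map, charFunDual_prod, charFunDual_pi_gaussianReal,
    charFunDual_pi_gaussianReal]
  set t : Fin n → ℝ := fun v ↦ ℓ (Pi.single v 1) with ht
  have hL₁ : ∀ x, L₁ x = localField s w x := fun _ ↦ rfl
  have hL₂ : ∀ z, L₂ z = fun v ↦ c * z.2 v + w * s v * z.1 := fun _ ↦ rfl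
  have hℓ : ∀ y, ℓ y = ∑ v, t v * y v := fun y ↦ by
    conv_lhs => rw [← Finset.univ_sum_single y, map_sum]
    refine Finset.sum_congr rfl fun v _ ↦ ?_
    rw [show (Pi.single v (y v) : Fin n → ℝ) = y v • Pi.single v 1 by
        rw [← Pi.single_smul, smul_eq_mul, mul_one], map_smul, smul_eq_mul, mul_comm]
  have h0 : localField s w 0 = 0 := L₁.map_zero
  have hdiag : ∀ i : Sym2 (Fin n), i.IsDiag → (ℓ.comp L₁) (Pi.single i 1) ^ 2 = 0 := fun i hi ↦ by
    have h1 : localField s w (Pi.single i 1) = 0 := by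
      ext v
      rw [Pi.single, localField_update_of_ne, h0]
      rintro u huv rfl
      exact huv hi
    rw [ContinuousLinearMap.comp_apply, hL₁, h1]
    simp
  have hoff : ∀ u v, u ≠ v →
      (ℓ.comp L₁) (Pi.single s(u, v) 1) ^ 2 = w ^ 2 * (t u * s v + t v * s u) ^ 2 := by
    intro u v huv
    have key : ∀ u v : Fin n, u ≠ v → localField s w (Pi.single s(u, v) 1) v = w * s u := by
      intro u v huv
      have hz : Function.update (0 : Sym2 (Fin n) → ℝ) s(u, v) 0 = 0 := by simp
      rw [Pi.single, localField_update _ _ _ huv, hz, h0]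
      simp
    have h1 : localField s w (Pi.single s(u, v) 1) =
        (w * s u) • Pi.single v 1 + (w * s v) • Pi.single u 1 := by
      ext z
      rcases eq_or_ne z v with rfl | hzv
      · simp [key u z huv, huv.symm]
      rcases eq_or_ne z u with rfl | hzu
      · rw [Sym2.eq_swap, key v z huv.symm]
        simp [hzv]
      · rw [Pi.single, localField_update_of_ne, h0]
        · simp [hzv, hzu]
        · intro y _ h
          have : z ∈ s(u, v) := h ▸ Sym2.mem_mk_right _ _
          rcases Sym2.mem_iff.1 this with h | h
          · exact hzu h
          · exact hzv h
    rw [ContinuousLinearMap.comp_apply, hL₁, h1, map_add, map_smul, map_smul]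
    simp only [ht, smul_eq_mul]
    ring
  have hsum : ∑ i, (ℓ.comp L₁) (Pi.single i 1) ^ 2 =
      w ^ 2 * ((n - 2) * ∑ v, t v ^ 2 + (∑ v, t v * s v) ^ 2) := by
    have h1 := two_mul_sum_sym2 _ hdiag
    have h2 : ∑ u, ∑ v ∈ Finset.univ.erase u, (ℓ.comp L₁) (Pi.single s(u, v) 1) ^ 2 =
        w ^ 2 * ∑ u, ∑ v ∈ Finset.univ.erase u, (t u * s v + t v * s u) ^ 2 := by
      simp_rw [Finset.mul_sum]
      exact Finset.sum_congr rfl fun u _ ↦ Finset.sum_congr rfl fun v hv ↦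
        hoff u v (Finset.ne_of_mem_erase hv).symm
    rw [sum_sq_eq_of_cross s t hs] at h2
    linarith
  have hZ : ((ℓ.comp L₂).comp (.inl ℝ ℝ (Fin n → ℝ))) 1 = w * ∑ v, t v * s v := by
    rw [ContinuousLinearMap.comp_apply, ContinuousLinearMap.comp_apply, hL₂, hℓ, Finset.mul_sum]
    refine Finset.sum_congr rfl fun v _ ↦ ?_
    simp
    ring
  have hξ : ∀ u, ((ℓ.comp L₂).comp (.inr ℝ ℝ (Fin n → ℝ))) (Pi.single u 1) = c * t u := by
    intro u
    have h1 : L₂ ((ContinuousLinearMap.inr ℝ ℝ (Fin n → ℝ)) (Pi.single u 1)) =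
        c • Pi.single u 1 := by
      rw [hL₂]
      ext v
      simp
    rw [ContinuousLinearMap.comp_apply, ContinuousLinearMap.comp_apply, h1, map_smul, smul_eq_mul]
  rw [charFunDual_gaussianReal, hZ, hsum, ← Complex.exp_add]
  simp_rw [hξ, mul_pow, ← Finset.mul_sum, hc]
  congr 1
  push_cast
  ring

end GaussianField

/-! ### The mean of the field weight for Gaussian edge weights -/

lemma lintegral_pi_prod_eq_prod {ι : Type*} [Fintype ι] (ν : Measure ℝ) [IsProbabilityMeasure ν]
    {g : ι → ℝ → ENNReal} (hg : ∀ i, Measurable (g i)) :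
    ∫⁻ y, ∏ i, g i (y i) ∂Measure.pi (fun _ : ι ↦ ν) = ∏ i, ∫⁻ t, g i t ∂ν := by
  have h1 : iIndepFun (fun i (y : ι → ℝ) ↦ g i (y i)) (Measure.pi (fun _ : ι ↦ ν)) :=
    iIndepFun_pi fun i ↦ (hg i).aemeasurable
  rw [lintegral_prod_eq_prod_lintegral_of_indepFun Finset.univ _ h1
    fun i ↦ (hg i).comp (measurable_pi_apply i)]
  refine Finset.prod_congr rfl fun i _ ↦ ?_
  exact (measurePreserving_eval (fun _ : ι ↦ ν) i).lintegral_comp (hg i)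

/-- Averaging a smoothed indicator against an independent Gaussian smooths it further. -/
lemma lintegral_smoothStep {η a τ : ℝ} (hη : 0 ≤ η) (hτ : 0 < τ) (A d : ℝ) :
    ∫⁻ y, ENNReal.ofReal (smoothStep η a τ (A + d * y)) ∂gaussianReal 0 1 =
      ENNReal.ofReal (smoothStep η a (√(τ ^ 2 + d ^ 2)) A) := by
  unfold smoothStep
  simp_rw [ENNReal.ofReal_add hη (stdNormalCDF_pos _).le]
  rw [lintegral_add_left measurable_const, lintegral_const, measure_univ, mul_one]
  congr 1
  rw [← lintegral_stdNormalCDF hτ]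
  refine lintegral_congr fun y ↦ ?_
  ring_nf

variable {n : ℕ}

/-- With Gaussian edge weights, the field weight averages to a mixture of products over the common
Gaussian variable `z`. Its factors are again smoothed indicators, with a larger width. -/
lemma lintegral_fieldWeight_gaussian {η a τ β w c : ℝ} {s e : Fin n → ℝ} (hη : 0 ≤ η)
    (hτ : 0 < τ) (hs : ∀ v, s v ^ 2 = 1) (he : ∀ v, e v ^ 2 = 1) (hc : c ^ 2 = (n - 2) * w ^ 2) :
    ∫⁻ x, fieldWeight η a τ β w s e x ∂Measure.pi (fun _ : Sym2 (Fin n) ↦ gaussianReal 0 1) =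
      ∫⁻ z, ∏ v, ENNReal.ofReal
        (smoothStep η a (√(τ ^ 2 + c ^ 2)) (e v * (β + w * s v * z))) ∂gaussianReal 0 1 := by
  set F : (Fin n → ℝ) → ENNReal := fun y ↦
    ∏ v, ENNReal.ofReal (smoothStep η a τ (e v * (β + y v))) with hF
  have hstep : ∀ v, Measurable fun t : ℝ ↦ ENNReal.ofReal (smoothStep η a τ (e v * (β + t))) :=
    fun v ↦ ENNReal.measurable_ofReal.comp (continuous_smoothStep.measurable.comp (by fun_prop))
  have hFm : Measurable F := Finset.measurable_fun_prod _ fun v _ ↦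
    (hstep v).comp (measurable_pi_apply v)
  have hfield : Measurable (localField s w) := measurable_pi_lambda _ fun v ↦ by
    unfold localField
    fun_prop
  have hmix : Measurable fun (z : ℝ × (Fin n → ℝ)) v ↦ c * z.2 v + w * s v * z.1 :=
    measurable_pi_lambda _ fun v ↦ by fun_prop
  change ∫⁻ x, F (localField s w x) ∂_ = _
  rw [← lintegral_map hFm hfield, map_localField_gaussian s hs hc, lintegral_map hFm hmix,
    lintegral_prod (fun z : ℝ × (Fin n → ℝ) ↦ F fun v ↦ c * z.2 v + w * s v * z.1)
      (hFm.comp hmix).aemeasurable]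
  refine lintegral_congr fun z ↦ ?_
  rw [lintegral_pi_prod_eq_prod (gaussianReal 0 1)
    (g := fun v t ↦ ENNReal.ofReal (smoothStep η a τ (e v * (β + (c * t + w * s v * z)))))
    fun v ↦ (hstep v).comp (by fun_prop)]
  refine Finset.prod_congr rfl fun v _ ↦ ?_
  have h1 := lintegral_smoothStep (a := a) hη hτ (e v * (β + w * s v * z)) (e v * c)
  rw [mul_pow, he, one_mul] at h1
  rw [← h1]
  refine lintegral_congr fun t ↦ ?_
  ring_nf

/-! ### From the random graph to the standardized field -/

section Graph

variable {V : Type*}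

/-- The `±1`-valued indicator of a set of vertices. -/
def spin [DecidableEq V] (A : Finset V) (v : V) : ℝ := if v ∈ A then 1 else -1

lemma spin_sq [DecidableEq V] (A : Finset V) (v : V) : spin A v ^ 2 = 1 := by
  unfold spin
  split_ifs <;> norm_num

lemma abs_spin [DecidableEq V] (A : Finset V) (v : V) : |spin A v| = 1 := by
  unfold spin
  split_ifs <;> norm_num

lemma sum_spin [DecidableEq V] [Fintype V] (A : Finset V) :
    ∑ v, spin A v = 2 * A.card - Fintype.card V := by
  have h : ∀ v, spin A v = 2 * (if v ∈ A then 1 else 0) - 1 := fun v ↦ by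
    unfold spin
    split_ifs <;> norm_num
  simp_rw [h, Finset.sum_sub_distrib, ← Finset.mul_sum]
  simp

/-- The law of the indicator of a potential edge of the binomial random graph. The elements of the
diagonal of `Sym2 V` are not potential edges, and their indicator is `False` almost surely. -/
noncomputable def edgeLaw (p : unitInterval) (e : Sym2 V) : Measure Prop :=
  unitInterval.toNNReal p • Measure.dirac (¬ e.IsDiag) +
    unitInterval.toNNReal (unitInterval.symm p) • Measure.dirac False

instance (p : unitInterval) (e : Sym2 V) : IsProbabilityMeasure (edgeLaw p e) := by
  unfold edgeLaw
  infer_instance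

/-- The centred and normalized indicator of a proposition of probability `p`. -/
noncomputable def standardize (p : ℝ) (P : Prop) : ℝ :=
  open Classical in ((if P then 1 else 0) - p) / √(p * (1 - p))

lemma isStandardized_map_edgeLaw {p : unitInterval} (hp0 : 0 < (p : ℝ)) (hp1 : (p : ℝ) < 1)
    {e : Sym2 V} (he : ¬ e.IsDiag) :
    IsStandardized ((edgeLaw p e).map (standardize p)) (1 / √(p * (1 - p))) := by
  have hg : ∀ g : ℝ → ℝ, Continuous g → Integrable g ((edgeLaw p e).map (standardize p)) ∧
      ∫ x, g x ∂(edgeLaw p e).map (standardize p) =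
        p * g ((1 - p) / √(p * (1 - p))) + (1 - p) * g (-p / √(p * (1 - p))) := fun g hgc ↦ by
    have hst : Measurable (standardize p) := measurable_of_finite _
    have i1 : ∀ (r : NNReal) (P : Prop), Integrable (fun P ↦ g (standardize p P))
        (r • Measure.dirac P) := fun r P ↦ by
      exact Integrable.of_finite
    constructor
    · rw [integrable_map_measure hgc.aestronglyMeasurable hst.aemeasurable]
      exact (i1 _ _).add_measure (i1 _ _)
    · rw [integral_map hst.aemeasurable hgc.aestronglyMeasurable]
      unfold edgeLaw
      rw [integral_add_measure (i1 _ _) (i1 _ _), integral_smul_nnreal_measure,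
        integral_smul_nnreal_measure, integral_dirac, integral_dirac]
      simp [standardize, he, NNReal.smul_def]
  have hv : 0 < (p : ℝ) * (1 - p) := mul_pos hp0 (by linarith)
  have hs : 0 < √((p : ℝ) * (1 - p)) := Real.sqrt_pos.2 hv
  have hss := Real.sq_sqrt hv.le
  set r := √((p : ℝ) * (1 - p)) with hr
  refine ⟨(hg (fun x ↦ |x| ^ 3) (by fun_prop)).1, (hg (fun x ↦ x ^ 2) (by fun_prop)).1,
    (hg (fun x ↦ x) (by fun_prop)).1, ?_, ?_, ?_⟩
  · rw [(hg (fun x ↦ x) (by fun_prop)).2]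
    ring
  · rw [(hg (fun x ↦ x ^ 2) (by fun_prop)).2, div_pow, div_pow, hss]
    have : 1 - (p : ℝ) ≠ 0 := by linarith
    field_simp
    ring
  · rw [(hg (fun x ↦ |x| ^ 3) (by fun_prop)).2, abs_div, abs_div, abs_of_pos hs,
      abs_of_nonneg (show 0 ≤ 1 - (p : ℝ) by linarith), abs_neg, abs_of_pos hp0, div_pow, div_pow]
    rw [show r ^ 3 = r ^ 2 * r by ring, hss]
    rw [mul_div_assoc', mul_div_assoc', ← add_div, div_le_div_iff₀ (by positivity) hs]
    nlinarith [mul_pos hv hs, mul_pos hp0 hs]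

/-- The signed number of neighbours of `v`, counted positively in `R` and negatively outside. -/
lemma sum_spin_eq_ncard_sub [DecidableEq V] [Fintype V] (P : Sym2 V → Prop) (R : Finset V) (v : V) :
    ∑ u ∈ Finset.univ.erase v, spin R u * (open Classical in if P s(u, v) then 1 else 0) =
      (((SimpleGraph.fromEdgeSet {i | P i}).neighborSet v ∩ R).ncard : ℝ) -
        (((SimpleGraph.fromEdgeSet {i | P i}).neighborSet v ∩ (R : Set V)ᶜ).ncard : ℝ) := by
  classical
  have h : ∀ A : Set V, (((SimpleGraph.fromEdgeSet {i | P i}).neighborSet v ∩ A).ncard : ℝ) =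
      ∑ u ∈ Finset.univ.erase v, if P s(u, v) ∧ u ∈ A then 1 else 0 := fun A ↦ by
    rw [Finset.sum_boole, ← Set.ncard_coe_finset]
    congr 2
    ext u
    simp [Sym2.eq_swap (a := v), and_comm, eq_comm (a := v)]
    tauto
  rw [h, h, ← Finset.sum_sub_distrib]
  refine Finset.sum_congr rfl fun u _ ↦ ?_
  unfold spin
  by_cases h1 : P s(u, v) <;> by_cases h2 : u ∈ R <;> simp [h1, h2]

/-- If `S` is the set of unconvinced vertices, the field is nonpositive on `S` and positive off `S`,
up to an error of the size of one edge: `β` also counts the pair `(v, v)`, which carries no edge. -/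
lemma spin_mul_field_le [DecidableEq V] [Fintype V] {p : ℝ} (hp0 : 0 ≤ p) (hp1 : p ≤ 1)
    {R S : Finset V} {β w : ℝ} (hβ : β = w * p * (2 * R.card - Fintype.card V) / √(p * (1 - p)))
    (hw : 0 ≤ w)
    (P : Sym2 V → Prop)
    (hS : unconvinced (SimpleGraph.fromEdgeSet {i | P i}) (R : Set V) = (S : Set V)) (v : V) :
    spin S v * (β + localField (spin R) w (fun i ↦ standardize p (P i)) v) ≤
      w / √(p * (1 - p)) := by
  classical
  set r := √(p * (1 - p)) with hr
  have hr0 : 0 ≤ r := Real.sqrt_nonneg _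
  have h1 : ∑ u ∈ Finset.univ.erase v, spin R u * standardize p (P s(u, v)) =
      ((∑ u ∈ Finset.univ.erase v, spin R u * (if P s(u, v) then 1 else 0)) -
        p * (2 * R.card - Fintype.card V - spin R v)) / r := by
    rw [← sum_spin, ← Finset.sum_erase_eq_sub (Finset.mem_univ v), Finset.mul_sum,
      ← Finset.sum_sub_distrib, Finset.sum_div]
    refine Finset.sum_congr rfl fun u _ ↦ ?_
    unfold standardize
    rw [← hr]
    ring
  have h2 := sum_spin_eq_ncard_sub P R v
  have h3 : β + localField (spin R) w (fun i ↦ standardize p (P i)) v =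
      w / r * ((∑ u ∈ Finset.univ.erase v, spin R u * (if P s(u, v) then 1 else 0)) +
        p * spin R v) := by
    unfold localField
    rw [h1, hβ]
    ring
  rw [h3]
  set N₁ := ((SimpleGraph.fromEdgeSet {i | P i}).neighborSet v ∩ R).ncard with hN₁
  set N₂ := ((SimpleGraph.fromEdgeSet {i | P i}).neighborSet v ∩ (R : Set V)ᶜ).ncard with hN₂
  have hv : v ∈ S ↔ N₁ ≤ N₂ := by
    rw [← Finset.mem_coe, ← hS]
    rfl
  have hwr : 0 ≤ w / r := by positivity
  have h4 : spin S v * (((N₁ : ℝ) - N₂) + p * spin R v) ≤ 1 := by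
    have h5 : |p * spin R v| ≤ 1 := by rw [abs_mul, abs_spin, mul_one, abs_of_nonneg hp0]; exact hp1
    have h6 := abs_le.1 h5
    by_cases h : v ∈ S
    · have h7 : (N₁ : ℝ) ≤ N₂ := by exact_mod_cast hv.1 h
      rw [spin, if_pos h]
      linarith
    · have h7 : (N₂ : ℝ) ≤ N₁ := by exact_mod_cast (not_le.1 (mt hv.2 h)).le
      rw [spin, if_neg h]
      linarith
  have h8 : (∑ u ∈ Finset.univ.erase v, spin R u * (if P s(u, v) then 1 else 0)) =
      (N₁ : ℝ) - N₂ := by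
    rw [← h2]
  rw [h8]
  calc _ = w / r * (spin S v * (((N₁ : ℝ) - N₂) + p * spin R v)) := by ring
    _ ≤ w / r * 1 := by gcongr
    _ = _ := mul_one _

lemma measurableSet_simpleGraph [Finite V] (A : Set (SimpleGraph V)) : MeasurableSet A :=
  SimpleGraph.measurableEmbedding_edgeSet.measurableSet_image.1 (Set.toFinite _).measurableSet

/-- The probability that `S` is exactly the set of unconvinced vertices is dominated by the mean
of a smooth function of the standardized edge indicators. -/
lemma binomialRandom_unconvinced_le [DecidableEq V] [Fintype V] (p : unitInterval) (R S : Finset V)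
    {η a τ β w : ℝ} (hβ : β = w * p * (2 * R.card - Fintype.card V) / √(p * (1 - p))) (hw : 0 ≤ w)
    (h : ∀ y ≤ w / √(p * (1 - p)), 1 ≤ smoothStep η a τ y) :
    SimpleGraph.binomialRandom V p {G | unconvinced G (R : Set V) = (S : Set V)} ≤
      ∫⁻ x, fieldWeight η a τ β w (spin R) (spin S) x
        ∂Measure.pi (fun e : Sym2 V ↦ (edgeLaw p e).map (standardize p)) := by
  have hst : Measurable (standardize p) := measurable_of_finite _
  have hmap : Measure.pi (fun e : Sym2 V ↦ (edgeLaw p e).map (standardize p)) =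
      (Measure.pi fun e : Sym2 V ↦ edgeLaw p e).map fun P e ↦ standardize p (P e) :=
    (Measure.pi_map_pi fun _ ↦ hst.aemeasurable).symm
  have hlaw : SimpleGraph.binomialRandom V p =
      (Measure.pi fun e : Sym2 V ↦ edgeLaw p e).map
        fun P ↦ SimpleGraph.fromEdgeSet {i | P i} := by
    rw [SimpleGraph.binomialRandom_eq_map, setBernoulli_eq_map, Measure.infinitePi_eq_pi,
      Measure.map_map SimpleGraph.measurable_fromEdgeSet (by fun_prop)]
    rfl
  have hmeas : Measurable fun (P : Sym2 V → Prop) e ↦ standardize p (P e) :=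
    measurable_pi_lambda _ fun e ↦ hst.comp (measurable_pi_apply e)
  rw [hmap, lintegral_map (measurable_fieldWeight _ _ _ _ _ _ _) hmeas, hlaw,
    Measure.map_apply (measurable_of_finite _) (measurableSet_simpleGraph _),
    ← lintegral_indicator_one (Set.toFinite _).measurableSet]
  refine lintegral_mono (Set.indicator_le fun P hP ↦ ?_)
  refine Finset.one_le_prod'' fun v ↦ ?_
  rw [ENNReal.one_le_ofReal]
  exact h _ (spin_mul_field_le p.2.1 p.2.2 hβ hw P hP v)

end Graph

/-! ### Choice of the smoothing parameters -/

/-- Smoothing parameters for which the smoothed indicators are, after a Gaussian average of unit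
variance, within a factor `1 + θ` of the normal distribution function on `[-Y, Y]`. -/
lemma exists_smoothing_parameters {θ Y : ℝ} (hθ : 0 < θ) (hθ1 : θ ≤ 1) (hY : 0 ≤ Y) :
    ∃ η a τ₀ : ℝ, 0 < η ∧ η ≤ 1 ∧ 0 < a ∧ 0 < τ₀ ∧
      (∀ τ, τ₀ ≤ τ → τ ≤ 2 * τ₀ → ∀ y ≤ a / 2, 1 ≤ smoothStep η a τ y) ∧
      (∀ y, smoothStep η a (√(τ₀ ^ 2 + 1)) y ≤ 1 + θ) ∧
      (∀ y, smoothStep η a (√(τ₀ ^ 2 + 1)) y + smoothStep η a (√(τ₀ ^ 2 + 1)) (-y) ≤ 1 + θ) ∧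
      ∀ y, |y| ≤ Y → smoothStep η a (√(τ₀ ^ 2 + 1)) y ≤ (1 + θ) * stdNormalCDF (-y) := by
  set ζ := θ * stdNormalCDF (-Y) / 4 with hζ
  have hφ := stdNormalCDF_pos (-Y)
  have hφ1 := stdNormalCDF_le_one (-Y)
  have hζ0 : 0 < ζ := by positivity
  have hζθ : 4 * ζ ≤ θ := by rw [hζ]; nlinarith
  obtain ⟨x, hx⟩ := eventually_atTop.1 (tendsto_stdNormalCDF_atTop.eventually
    (eventually_ge_nhds (show 1 - ζ < 1 by linarith)))
  set τ₀ := min (ζ / (4 * max x 1)) (ζ / (Y + 1)) with hτ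
  have hx1 : 0 < max x 1 := lt_max_of_lt_right one_pos
  have hτ0 : 0 < τ₀ := lt_min (by positivity) (by positivity)
  set c := √(τ₀ ^ 2 + 1) with hc
  have hc1 : 1 ≤ c := Real.one_le_sqrt.2 (by nlinarith)
  have hcτ : c ≤ 1 + τ₀ := Real.sqrt_le_iff.2 ⟨by positivity, by nlinarith⟩
  have hτY : Y * τ₀ ≤ ζ := by
    have h1 : τ₀ * (Y + 1) ≤ ζ := (le_div_iff₀ (by linarith)).1 (min_le_right _ _)
    nlinarith
  refine ⟨ζ, ζ, τ₀, hζ0, by linarith, hζ0, hτ0, fun τ h1 h2 y hy ↦ ?_, fun y ↦ ?_, fun y ↦ ?_,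
    fun y hy ↦ ?_⟩
  · have h3 : x ≤ (ζ - y) / τ := by
      rw [le_div_iff₀ (by linarith)]
      have h4 : τ₀ * (4 * max x 1) ≤ ζ := (le_div_iff₀ (by positivity)).1 (min_le_left _ _)
      have h5 : x * τ ≤ max x 1 * (2 * τ₀) :=
        mul_le_mul (le_max_left _ _) h2 (by linarith) hx1.le
      linarith
    have := hx _ h3
    unfold smoothStep
    linarith
  · exact (smoothStep_le y).trans (by linarith)
  · have h1 := abs_stdNormalCDF_sub_le ((ζ - -y) / c) (-((ζ - y) / c))
    have h2 : (ζ - -y) / c - -((ζ - y) / c) = 2 * (ζ / c) := by ring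
    have h3 : ζ / c ≤ ζ := div_le_self hζ0.le hc1
    have h5 : 0 ≤ 2 * (ζ / c) := by have := zero_le_one.trans hc1; positivity
    rw [h2, abs_of_nonneg h5, stdNormalCDF_neg] at h1
    have h4 := (abs_le.1 h1).2
    unfold smoothStep
    linarith
  · have h1 := abs_stdNormalCDF_sub_le ((ζ - y) / c) (-y)
    have h2 : |(ζ - y) / c - -y| ≤ 2 * ζ := by
      have h3 : (ζ - y) / c - -y = ζ / c + y * (1 - 1 / c) := by ring
      have h4 : ζ / c ≤ ζ := div_le_self hζ0.le hc1
      have h5 : 0 ≤ 1 - 1 / c := by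
        have := (div_le_one₀ (show 0 < c by linarith)).2 hc1
        linarith
      have h6 : 1 - 1 / c ≤ τ₀ := by
        have : 1 - 1 / c = (c - 1) / c := by field_simp
        rw [this]
        exact (div_le_self (by linarith) hc1).trans (by linarith)
      rw [h3]
      refine (abs_add_le _ _).trans ?_
      rw [abs_mul, abs_of_nonneg h5, abs_of_nonneg (show 0 ≤ ζ / c by positivity)]
      have : |y| * (1 - 1 / c) ≤ Y * τ₀ := mul_le_mul hy h6 h5 hY
      linarith
    have h3 := (abs_le.1 (h1.trans h2)).2
    have h4 : stdNormalCDF (-Y) ≤ stdNormalCDF (-y) :=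
      strictMono_stdNormalCDF.monotone (neg_le_neg ((le_abs_self y).trans hy))
    have h5 : 4 * ζ ≤ θ * stdNormalCDF (-y) := by
      rw [hζ]
      nlinarith
    unfold smoothStep
    linarith

/-! ### Chernoff bounds and truncated Gaussian averages -/

/-- The Chernoff bound for the number of successes in independent trials, in unnormalized form. -/
lemma pow_mul_sum_powersetCard_le {ι : Type*} [Fintype ι] [DecidableEq ι] {P Q : ι → ℝ}
    (hP : ∀ i, 0 ≤ P i) (hQ : ∀ i, 0 ≤ Q i) {t : ℝ} (ht : 0 ≤ t) (k : ℕ) :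
    t ^ k * ∑ S ∈ Finset.powersetCard k (Finset.univ : Finset ι),
      ∏ i, (if i ∈ S then P i else Q i) ≤ ∏ i, (t * P i + Q i) := by
  rw [Finset.prod_add, Finset.mul_sum]
  have h : ∀ S ∈ Finset.powersetCard k (Finset.univ : Finset ι),
      t ^ k * ∏ i, (if i ∈ S then P i else Q i) =
        (∏ i ∈ S, t * P i) * ∏ i ∈ Finset.univ \ S, Q i := fun S hS ↦ by
    rw [Finset.prod_mul_distrib, Finset.prod_const, (Finset.mem_powersetCard.1 hS).2,
      Finset.prod_ite, mul_assoc]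
    congr 3
    · ext i; simp
    · ext i; simp
  rw [Finset.sum_congr rfl h]
  refine Finset.sum_le_sum_of_subset_of_nonneg (fun S hS ↦ ?_) fun S _ _ ↦ ?_
  · exact Finset.mem_powerset.2 (Finset.subset_univ _)
  · exact mul_nonneg (Finset.prod_nonneg fun i _ ↦ mul_nonneg ht (hP i))
      (Finset.prod_nonneg fun i _ ↦ hQ i)

lemma gaussianReal_abs_gt_le {b : ℝ} (hb : 1 ≤ b) :
    gaussianReal 0 1 {z | b < |z|} ≤ ENNReal.ofReal (Real.exp (-b ^ 2 / 2)) := by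
  have h1 : {z : ℝ | b < |z|} ⊆ (Iic b)ᶜ ∪ Iic (-b) := fun z hz ↦ by
    rcases lt_abs.1 (show b < |z| from hz) with h | h
    · exact Or.inl (not_le.2 h)
    · exact Or.inr (by simp only [mem_Iic]; linarith)
  have h2 : ∀ x, gaussianReal 0 1 (Iic x) = ENNReal.ofReal (stdNormalCDF x) := fun x ↦
    (ofReal_cdf _ x).symm
  refine (measure_mono h1).trans ((measure_union_le _ _).trans ?_)
  rw [prob_compl_eq_one_sub measurableSet_Iic, h2, h2, ← ENNReal.ofReal_one,
    ← ENNReal.ofReal_sub _ (stdNormalCDF_pos _).le, ← stdNormalCDF_neg,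
    ← ENNReal.ofReal_add (stdNormalCDF_pos _).le (stdNormalCDF_pos _).le]
  refine ENNReal.ofReal_le_ofReal ?_
  have h3 := mul_stdNormalTail_le (x := b) (by linarith)
  have h4 : stdNormalPDF b ≤ 1 / 2 * Real.exp (-b ^ 2 / 2) := by
    unfold stdNormalPDF
    gcongr
    exact inv_sqrt_two_pi_le
  have h5 := stdNormalTail_pos b
  unfold stdNormalTail at h3 h5
  nlinarith

lemma setLIntegral_exp_sq_le {b : ℝ} :
    ∫⁻ z in {z | |z| ≤ b}, ENNReal.ofReal (Real.exp (z ^ 2 / 2)) ∂gaussianReal 0 1 ≤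
      ENNReal.ofReal b := by
  have hset : {z : ℝ | |z| ≤ b} = Icc (-b) b := by
    ext z
    simp [abs_le]
  rw [hset, gaussianReal_of_var_ne_zero 0 one_ne_zero,
    setLIntegral_withDensity_eq_setLIntegral_mul _ (measurable_gaussianPDF 0 1)
      (by fun_prop) measurableSet_Icc]
  have h : ∀ z : ℝ, (gaussianPDF 0 1 * fun z ↦ ENNReal.ofReal (Real.exp (z ^ 2 / 2))) z ≤
      ENNReal.ofReal (1 / 2) := fun z ↦ by
    rw [Pi.mul_apply, gaussianPDF, gaussianPDFReal_zero_one,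
      ← ENNReal.ofReal_mul (stdNormalPDF_pos z).le]
    refine ENNReal.ofReal_le_ofReal ?_
    rw [stdNormalPDF, mul_assoc, ← Real.exp_add, neg_div, neg_add_cancel, Real.exp_zero, mul_one]
    exact inv_sqrt_two_pi_le
  calc _ ≤ ∫⁻ z in Icc (-b) b, ENNReal.ofReal (1 / 2) := lintegral_mono h
    _ = ENNReal.ofReal b := by
      rw [setLIntegral_const, Real.volume_Icc, ← ENNReal.ofReal_mul (by norm_num)]
      ring_nf

/-- The two halves of the vertex set have almost the same size, so the product over the vertices is
governed by the geometric mean of the two kinds of factors. -/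
lemma pow_mul_pow_le_of_balanced {A B φ K : ℝ} {m d : ℕ} (hA : 0 ≤ A) (hB : 0 ≤ B) (hφ : 0 < φ)
    (hBA : φ * B ≤ A) (h : (A * B) ^ (2 * m + d) ≤ K ^ 2) :
    φ ^ d * (B ^ (m + d) * A ^ m) ^ 2 ≤ K ^ 2 := by
  refine le_trans ?_ h
  calc φ ^ d * (B ^ (m + d) * A ^ m) ^ 2 = (A * B) ^ (2 * m) * (B ^ d * (φ * B) ^ d) := by ring
    _ ≤ (A * B) ^ (2 * m) * (B ^ d * A ^ d) := by gcongr
    _ = _ := by ring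

/-! ### Summation over the sets of unconvinced vertices -/

section Integration

variable {n k m d : ℕ} {H : ℝ → ℝ} {θ ρ β Y : ℝ} {R : Finset (Fin n)}

/-- The sum over the sets `S` of `k` vertices of the weight of `S` as the set of unconvinced
vertices, when the field at `v` is `β + spin R v * γ` and a field `y` contributes the factor `H y`
on `S` and `H (-y)` off `S`. -/
noncomputable def configSum (k : ℕ) (H : ℝ → ℝ) (β : ℝ) (R : Finset (Fin n)) (γ : ℝ) : ℝ :=
  ∑ S ∈ Finset.powersetCard k (Finset.univ : Finset (Fin n)),
    ∏ v, H (spin S v * (β + spin R v * γ))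

lemma pow_mul_configSum_le (hH : ∀ y, 0 ≤ H y) {t : ℝ} (ht : 0 ≤ t) (γ : ℝ) :
    t ^ k * configSum k H β R γ ≤
      ∏ v, (t * H (β + spin R v * γ) + H (-(β + spin R v * γ))) := by
  have h := pow_mul_sum_powersetCard_le (P := fun v ↦ H (β + spin R v * γ))
    (Q := fun v ↦ H (-(β + spin R v * γ))) (fun _ ↦ hH _) (fun _ ↦ hH _) ht k
  refine le_trans (le_of_eq ?_) h
  unfold configSum
  congr 1
  refine Finset.sum_congr rfl fun S _ ↦ Finset.prod_congr rfl fun v _ ↦ ?_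
  unfold spin
  split_ifs <;> simp

lemma configSum_le_pow (hH : ∀ y, 0 ≤ H y) (hsum : ∀ y, H y + H (-y) ≤ 1 + θ) (γ : ℝ) :
    configSum k H β R γ ≤ (1 + θ) ^ n := by
  have h := pow_mul_configSum_le (k := k) (β := β) (R := R) hH zero_le_one γ
  rw [one_pow, one_mul] at h
  refine h.trans ((Finset.prod_le_prod (fun v _ ↦ ?_) fun v _ ↦ ?_).trans_eq
    (Finset.prod_const (1 + θ) |>.trans (by simp)))
  · exact add_nonneg (mul_nonneg zero_le_one (hH _)) (hH _)
  · rw [one_mul]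
    exact hsum _

/-- The tilted bound for moderate values `γ` of the common Gaussian variable. The sizes `m + d` and
`m` of `R` and its complement differ by little (`hd`), so the product over the vertices may be
compared with the power `n / 2` of the product of the two kinds of factors. -/
lemma configSum_le_of_tilt (hH : ∀ y, 0 ≤ H y) (hH1 : ∀ y, H y ≤ 1 + θ) (hθ : 0 ≤ θ)
    (hHΦ : ∀ y, |y| ≤ Y → H y ≤ (1 + θ) * stdNormalCDF (-y)) (hn : n = 2 * m + d)
    (hR : R.card = m + d) (hn0 : 0 < n) (hd : 1 ≤ stdNormalCDF (-Y) ^ d * (1 + θ) ^ n)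
    {γ t : ℝ} (hγ : |β| + |γ| ≤ Y) (hρ : 0 ≤ ρ) (ht : 1 ≤ t)
    (htilt : 4 * ((1 + t * stdNormalCDF (γ - β)) * (1 + t * stdNormalCDF (-γ - β))) ≤
      ρ * (t ^ (2 * ((k : ℝ) / n)) * Real.exp (γ ^ 2))) :
    configSum k H β R γ ≤ (1 + θ) ^ (2 * n) * (√ρ / 2) ^ n * Real.exp (n * γ ^ 2 / 2) := by
  have ht0 : 0 < t := by linarith
  set A := 1 + t * stdNormalCDF (γ - β) with hA
  set B := 1 + t * stdNormalCDF (-γ - β) with hB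
  have hΦA := stdNormalCDF_pos (γ - β)
  have hΦB := stdNormalCDF_pos (-γ - β)
  have hA0 : 0 < A := by positivity
  have hB0 : 0 < B := by positivity
  have hn' : (0 : ℝ) < n := by exact_mod_cast hn0
  have hyY : ∀ v, |β + spin R v * γ| ≤ Y := fun v ↦
    (abs_add_le _ _).trans (by rwa [abs_mul, abs_spin, one_mul])
  have h1 : t ^ k * configSum k H β R γ ≤ (1 + θ) ^ n * (B ^ (m + d) * A ^ m) := by
    refine (pow_mul_configSum_le hH ht0.le γ).trans ?_
    calc _ ≤ ∏ v, ((1 + θ) * (1 + t * stdNormalCDF (-(β + spin R v * γ)))) := by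
          refine Finset.prod_le_prod (fun v _ ↦ add_nonneg (mul_nonneg ht0.le (hH _)) (hH _))
            fun v _ ↦ ?_
          have h2 := mul_le_mul_of_nonneg_left (hHΦ _ (hyY v)) ht0.le
          linarith [hH1 (-(β + spin R v * γ))]
      _ = (1 + θ) ^ n * ∏ v, (if v ∈ R then B else A) := by
          rw [Finset.prod_mul_distrib, Finset.prod_const, Finset.card_univ, Fintype.card_fin]
          congr 1
          refine Finset.prod_congr rfl fun v _ ↦ ?_
          unfold spin
          split_ifs
          · rw [hB]; ring_nf
          · rw [hA]; ring_nf
      _ = _ := by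
          rw [Finset.prod_ite, Finset.prod_const, Finset.prod_const]
          have h3 : (Finset.univ.filter fun v ↦ v ∈ R) = R := by ext; simp
          have h4 : (Finset.univ.filter fun v ↦ v ∉ R) = Rᶜ := by ext; simp
          rw [h3, h4, Finset.card_compl, hR, Fintype.card_fin, hn]
          congr 3
          omega
  set K := (√ρ / 2) ^ n * t ^ k * Real.exp (n * γ ^ 2 / 2) with hK
  have hK0 : 0 ≤ K := by positivity
  have hABK : (A * B) ^ (2 * m + d) ≤ K ^ 2 := by
    have h2 : A * B ≤ ρ / 4 * (t ^ (2 * ((k : ℝ) / n)) * Real.exp (γ ^ 2)) := by linarith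
    have h3 : (t ^ (2 * ((k : ℝ) / n))) ^ n = (t ^ k) ^ 2 := by
      rw [← Real.rpow_natCast, ← Real.rpow_mul ht0.le,
        show 2 * ((k : ℝ) / n) * n = ((k * 2 : ℕ) : ℝ) by push_cast; field_simp,
        Real.rpow_natCast, pow_mul]
    have h4 : Real.exp (γ ^ 2) ^ n = Real.exp (n * γ ^ 2 / 2) ^ 2 := by
      rw [← Real.exp_nat_mul, ← Real.exp_nat_mul]
      congr 1
      push_cast
      ring
    have h5 : (ρ / 4) ^ n = ((√ρ / 2) ^ n) ^ 2 := by
      rw [← pow_mul, mul_comm n 2, pow_mul, div_pow (√ρ), Real.sq_sqrt hρ]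
      norm_num
    rw [← hn]
    refine (pow_le_pow_left₀ (by positivity) h2 n).trans_eq ?_
    rw [mul_pow, mul_pow, h3, h4, h5, hK]
    ring
  have hφBA : stdNormalCDF (-Y) * B ≤ A := by
    have h2 : stdNormalCDF (-Y) ≤ stdNormalCDF (γ - β) := by
      refine strictMono_stdNormalCDF.monotone ?_
      linarith [le_abs_self β, neg_abs_le γ]
    have h3 := stdNormalCDF_le_one (-γ - β)
    have h4 := stdNormalCDF_le_one (-Y)
    have h5 := stdNormalCDF_pos (-Y)
    have h6 : stdNormalCDF (-Y) * stdNormalCDF (-γ - β) ≤ stdNormalCDF (γ - β) * 1 :=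
      mul_le_mul h2 h3 hΦB.le hΦA.le
    rw [hA, hB]
    nlinarith
  have h6 := pow_mul_pow_le_of_balanced hA0.le hB0.le (stdNormalCDF_pos _) hφBA hABK
  have hθn : 1 ≤ (1 + θ) ^ n := one_le_pow₀ (by linarith)
  have h7 : B ^ (m + d) * A ^ m ≤ (1 + θ) ^ n * K := by
    refine le_of_pow_le_pow_left₀ two_ne_zero (by positivity) ?_
    calc (B ^ (m + d) * A ^ m) ^ 2 = 1 * (B ^ (m + d) * A ^ m) ^ 2 := (one_mul _).symm
      _ ≤ stdNormalCDF (-Y) ^ d * (1 + θ) ^ n * (B ^ (m + d) * A ^ m) ^ 2 := by gcongr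
      _ = (1 + θ) ^ n * (stdNormalCDF (-Y) ^ d * (B ^ (m + d) * A ^ m) ^ 2) := by ring
      _ ≤ (1 + θ) ^ n * ((1 + θ) ^ n * K ^ 2) := by
          exact mul_le_mul_of_nonneg_left
            (h6.trans (le_mul_of_one_le_left (sq_nonneg _) hθn)) (by positivity)
      _ = _ := by ring
  have h8 : t ^ k * configSum k H β R γ ≤
      t ^ k * ((1 + θ) ^ (2 * n) * (√ρ / 2) ^ n * Real.exp (n * γ ^ 2 / 2)) := by
    refine h1.trans ((mul_le_mul_of_nonneg_left h7 (by positivity)).trans_eq ?_)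
    rw [hK, two_mul, pow_add]
    ring
  exact le_of_mul_le_mul_left h8 (by positivity)

/-- The cut-off `1.18` satisfies `1.18 ^ 2 / 2 > log 2`: the tail of the common Gaussian variable is
exponentially smaller than the inverse `2 ^ (-n)` of the number of vertex sets. -/
lemma exp_mul_sq_le (n : ℕ) : Real.exp (-(1.18 * √n) ^ 2 / 2) ≤ 0.499 ^ n := by
  have h1 : Real.exp (-0.6962) ≤ 0.499 := by
    rw [Real.exp_neg, inv_le_comm₀ (Real.exp_pos _) (by norm_num)]
    exact le_trans (by norm_num) (taylor_le_exp (by norm_num))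
  calc _ = Real.exp (-0.6962) ^ n := by
        rw [← Real.exp_nat_mul, mul_pow, Real.sq_sqrt (Nat.cast_nonneg n)]
        norm_num
        ring
    _ ≤ _ := pow_le_pow_left₀ (Real.exp_pos _).le h1 n

/-- Averaging the sum over configurations against the common Gaussian variable. -/
lemma lintegral_configSum_le (hH : ∀ y, 0 ≤ H y) (hH1 : ∀ y, H y ≤ 1 + θ) (hθ : 0 ≤ θ)
    (hsum : ∀ y, H y + H (-y) ≤ 1 + θ)
    (hHΦ : ∀ y, |y| ≤ Y → H y ≤ (1 + θ) * stdNormalCDF (-y)) (hn : n = 2 * m + d)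
    (hR : R.card = m + d) (hn0 : 0 < n) (hd : 1 ≤ stdNormalCDF (-Y) ^ d * (1 + θ) ^ n)
    (hβ : |β| + 1.18 ≤ Y) (hρ : 0 ≤ ρ)
    (htilt : ∀ γ, |γ| ≤ 1.18 → ∃ t, 1 ≤ t ∧
      4 * ((1 + t * stdNormalCDF (γ - β)) * (1 + t * stdNormalCDF (-γ - β))) ≤
        ρ * (t ^ (2 * ((k : ℝ) / n)) * Real.exp (γ ^ 2))) :
    ∫⁻ z, ENNReal.ofReal (configSum k H β R (z / √n)) ∂gaussianReal 0 1 ≤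
      ENNReal.ofReal ((1 + θ) ^ (2 * n) * (√ρ / 2) ^ n * (1.18 * √n) +
        (1 + θ) ^ n * 0.499 ^ n) := by
  have hsn : 1 ≤ √n := Real.one_le_sqrt.2 (by exact_mod_cast hn0)
  set b := 1.18 * √n with hb
  have hb1 : 1 ≤ b := by
    rw [hb]
    norm_num
    linarith
  have hset : MeasurableSet {z : ℝ | |z| ≤ b} := measurableSet_le (by fun_prop) (by fun_prop)
  have hcompl : {z : ℝ | |z| ≤ b}ᶜ = {z | b < |z|} := by
    ext z
    simp
  rw [← lintegral_add_compl _ hset, hcompl, ENNReal.ofReal_add (by positivity) (by positivity)]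
  refine add_le_add ?_ ?_
  · calc _ ≤ ∫⁻ z in {z : ℝ | |z| ≤ b}, ENNReal.ofReal ((1 + θ) ^ (2 * n) * (√ρ / 2) ^ n) *
          ENNReal.ofReal (Real.exp (z ^ 2 / 2)) ∂gaussianReal 0 1 := by
          refine setLIntegral_mono' hset fun z hz ↦ ?_
          have hz' : |z / √n| ≤ 1.18 := by
            rw [abs_div, abs_of_nonneg (Real.sqrt_nonneg _), div_le_iff₀ (by linarith)]
            exact hz
          obtain ⟨t, ht, htt⟩ := htilt _ hz'
          rw [← ENNReal.ofReal_mul (by positivity)]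
          refine ENNReal.ofReal_le_ofReal ?_
          refine (configSum_le_of_tilt hH hH1 hθ hHΦ hn hR hn0 hd (by linarith) hρ ht
            htt).trans_eq ?_
          rw [div_pow z, Real.sq_sqrt (Nat.cast_nonneg n)]
          congr 2
          have : (n : ℝ) ≠ 0 := by positivity
          field_simp
      _ ≤ _ := by
          rw [lintegral_const_mul' _ _ ENNReal.ofReal_ne_top,
            ENNReal.ofReal_mul (q := b) (by positivity)]
          gcongr
          exact setLIntegral_exp_sq_le
  · calc _ ≤ ∫⁻ z in {z : ℝ | b < |z|}, ENNReal.ofReal ((1 + θ) ^ n) ∂gaussianReal 0 1 :=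
          lintegral_mono fun z ↦ ENNReal.ofReal_le_ofReal (configSum_le_pow hH hsum _)
      _ ≤ _ := by
          rw [setLIntegral_const, ENNReal.ofReal_mul (by positivity)]
          gcongr
          exact (gaussianReal_abs_gt_le hb1).trans (ENNReal.ofReal_le_ofReal (exp_mul_sq_le n))

end Integration

/-! ### The probability bound for a fixed set -/

/-- The constant of the Lindeberg exchange: replacing all edge weights costs a factor
`exp (lindebergConst η τ₀ * n / √(n p (1 - p)))`. -/
noncomputable def lindebergConst (η τ₀ : ℝ) : ℝ :=
  10 * (1 + ∫ x, |x| ^ 3 ∂gaussianReal 0 1) / (τ₀ ^ 3 * η ^ 2)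

lemma lindebergConst_nonneg {η τ₀ : ℝ} (hτ : 0 < τ₀) : 0 ≤ lindebergConst η τ₀ := by
  have : 0 ≤ ∫ x, |x| ^ 3 ∂gaussianReal 0 1 := integral_nonneg fun x ↦ by positivity
  unfold lindebergConst
  positivity

/-- Each of the at most `n ^ 2` exchanges costs a factor
`1 + O(n ^ (-3 / 2) (p (1 - p)) ^ (-1 / 2))`, where the last factor bounds the third absolute moment
of a standardized edge indicator. -/
lemma exchange_factor_le {η τ₀ τ C v : ℝ} {n : ℕ} (hη : 0 < η) (hτ₀ : 0 < τ₀) (hτ : τ₀ ≤ τ)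
    (hn : 0 < n) (hv : 0 < v) (hv1 : v ≤ 1) (hC : 0 < C) (hCv : C ≤ n * v) :
    (1 + 10 * |(√n)⁻¹ / τ| ^ 3 * (1 / √v + ∫ x, |x| ^ 3 ∂gaussianReal 0 1) / η ^ 2) ^
        Fintype.card (Sym2 (Fin n)) ≤ Real.exp (lindebergConst η τ₀ * (n / √C)) := by
  set T := ∫ x, |x| ^ 3 ∂gaussianReal 0 1 with hT
  have hT0 : 0 ≤ T := integral_nonneg fun x ↦ by positivity
  have hn' : (0 : ℝ) < n := by exact_mod_cast hn
  set s := √(n : ℝ) with hs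
  have hs0 : 0 < s := Real.sqrt_pos.2 hn'
  have hsn : s ^ 2 = n := Real.sq_sqrt hn'.le
  have hr0 : 0 < √v := Real.sqrt_pos.2 hv
  have hr1 : √v ≤ 1 := Real.sqrt_le_one.2 hv1
  have hc0 : 0 < √C := Real.sqrt_pos.2 hC
  have hcs : √C ≤ s * √v := by
    rw [hs, ← Real.sqrt_mul hn'.le]
    exact Real.sqrt_le_sqrt hCv
  set κ := 10 * |s⁻¹ / τ| ^ 3 * (1 / √v + T) / η ^ 2 with hκ
  have hκ0 : 0 ≤ κ := by positivity
  have hcard : Fintype.card (Sym2 (Fin n)) ≤ n ^ 2 := by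
    rw [Sym2.card, Fintype.card_fin, Nat.choose_two_right, Nat.add_sub_cancel]
    refine Nat.div_le_of_le_mul ?_
    nlinarith
  have h1 : κ * (n : ℝ) ^ 2 ≤ lindebergConst η τ₀ * (n / √C) := by
    have h2 : |s⁻¹ / τ| ≤ s⁻¹ / τ₀ := by
      rw [abs_of_nonneg (by have := hτ₀.trans_le hτ; positivity)]
      gcongr
    have h3 : 1 / √v + T ≤ (1 + T) * (s / √C) := by
      have h4 : 1 / √v ≤ s / √C := by
        rw [div_le_div_iff₀ hr0 hc0, one_mul]
        exact hcs
      have h5 : 1 ≤ s / √C := by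
        rw [le_div_iff₀ hc0, one_mul]
        exact hcs.trans (mul_le_of_le_one_right hs0.le hr1)
      nlinarith
    calc κ * (n : ℝ) ^ 2 ≤ 10 * (s⁻¹ / τ₀) ^ 3 * ((1 + T) * (s / √C)) / η ^ 2 * (n : ℝ) ^ 2 := by
          rw [hκ]
          gcongr
      _ = lindebergConst η τ₀ * (n / √C) := by
          unfold lindebergConst
          rw [← hsn, ← hT]
          field_simp
  calc (1 + κ) ^ Fintype.card (Sym2 (Fin n)) ≤ (1 + κ) ^ (n ^ 2) :=
        pow_le_pow_right₀ (by linarith) hcard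
    _ ≤ Real.exp κ ^ (n ^ 2) := by
        gcongr
        rw [add_comm]
        exact Real.add_one_le_exp κ
    _ = Real.exp (κ * (n : ℝ) ^ 2) := by
        rw [← Real.exp_nat_mul]
        push_cast
        ring_nf
    _ ≤ _ := Real.exp_le_exp.2 h1

section FixedSet

variable {n : ℕ} {p : unitInterval} {C η a τ₀ β : ℝ} {R : Finset (Fin n)}

/-- The probability that exactly the vertices of `S` are unconvinced by `R` is bounded by the
corresponding mixture for Gaussian edges, up to the cost of the exchange. -/
lemma binomialRandom_unconvinced_le_gaussian (hp0 : 0 < (p : ℝ)) (hp1 : (p : ℝ) < 1) (hn : 2 ≤ n)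
    (hC : 0 < C) (hCn : C ≤ n * (p * (1 - p))) (hη : 0 < η) (hη1 : η ≤ 1) (hτ₀ : 0 < τ₀)
    (hτn : 2 / (n : ℝ) ≤ 3 * τ₀ ^ 2) (hβ : β = (√n)⁻¹ * p * (2 * R.card - n) / √(p * (1 - p)))
    (hstep : ∀ τ, τ₀ ≤ τ → τ ≤ 2 * τ₀ → ∀ y ≤ 1 / √C, 1 ≤ smoothStep η a τ y)
    (S : Finset (Fin n)) :
    SimpleGraph.binomialRandom (Fin n) p {G | unconvinced G (R : Set (Fin n)) = (S : Set (Fin n))} ≤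
      ENNReal.ofReal (Real.exp (lindebergConst η τ₀ * (n / √C))) *
        ∫⁻ z, ∏ v, ENNReal.ofReal (smoothStep η a (√(τ₀ ^ 2 + 1))
          (spin S v * (β + spin R v * (z / √n)))) ∂gaussianReal 0 1 := by
  have hn0 : 0 < n := by omega
  have hn' : (2 : ℝ) ≤ n := by exact_mod_cast hn
  set v : ℝ := p * (1 - p) with hv
  have hv0 : 0 < v := mul_pos hp0 (by linarith)
  have hv1 : v ≤ 1 := by rw [hv]; nlinarith
  -- The conditional variance of the Gaussian field is `1 - 2 / n`; with this width of the smoothing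
  -- it is completed to `τ₀ ^ 2 + 1`.
  set τ := √(τ₀ ^ 2 + 2 / n) with hτ
  have hτ2 : τ ^ 2 = τ₀ ^ 2 + 2 / n := Real.sq_sqrt (by positivity)
  have hττ₀ : τ₀ ≤ τ := Real.le_sqrt_of_sq_le (by
    have : (0 : ℝ) ≤ 2 / n := by positivity
    linarith)
  have hτ2τ₀ : τ ≤ 2 * τ₀ := Real.sqrt_le_iff.2 ⟨by positivity, by linarith⟩
  have hτ0 : 0 < τ := hτ₀.trans_le hττ₀
  set w := (√(n : ℝ))⁻¹ with hw
  have hw0 : 0 ≤ w := by positivity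
  have hw2 : w ^ 2 = (n : ℝ)⁻¹ := by rw [hw, inv_pow, Real.sq_sqrt (by linarith)]
  have hc : √(((n : ℝ) - 2) * w ^ 2) ^ 2 = (n - 2) * w ^ 2 :=
    Real.sq_sqrt (mul_nonneg (by linarith) (sq_nonneg _))
  have hwv : w / √v ≤ 1 / √C := by
    rw [hw, inv_eq_one_div, div_div, ← Real.sqrt_mul (by linarith)]
    exact one_div_le_one_div_of_le (Real.sqrt_pos.2 hC) (Real.sqrt_le_sqrt hCn)
  refine (binomialRandom_unconvinced_le p R S (η := η) (a := a) (τ := τ) (β := β) (w := w)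
    (by simpa using hβ) hw0 fun y hy ↦ hstep τ hττ₀ hτ2τ₀ y (hy.trans hwv)).trans ?_
  have inst : ∀ e : Sym2 (Fin n), IsProbabilityMeasure ((edgeLaw p e).map (standardize p)) :=
    fun e ↦ Measure.isProbabilityMeasure_map (measurable_of_finite _).aemeasurable
  refine (lintegral_fieldWeight_le (fun e he ↦ isStandardized_map_edgeLaw hp0 hp1 he)
    (by positivity) hη hη1 (abs_spin R) (abs_spin S)).trans ?_
  rw [lintegral_fieldWeight_gaussian hη.le hτ0 (spin_sq R) (spin_sq S) hc,
    ← ENNReal.ofReal_pow (by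
      have : 0 ≤ ∫ x, |x| ^ 3 ∂gaussianReal 0 1 := integral_nonneg fun x ↦ by positivity
      positivity)]
  refine mul_le_mul' (ENNReal.ofReal_le_ofReal ?_) ?_
  · exact exchange_factor_le hη hτ₀ hττ₀ hn0 hv0 hv1 hC hCn
  · refine le_of_eq (lintegral_congr fun z ↦ Finset.prod_congr rfl fun u _ ↦ ?_)
    have h1 : τ₀ ^ 2 + 2 / (n : ℝ) + (n - 2) * (n : ℝ)⁻¹ = τ₀ ^ 2 + 1 := by
      field_simp
      ring
    have h2 : w * spin R u * z = spin R u * (z / √n) := by rw [hw]; ring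
    rw [hc, hτ2, hw2, h1, h2]

variable {θ ρ Y : ℝ} {k m d : ℕ}

/-- The probability that exactly `k` vertices are unconvinced by a fixed set `R`. -/
lemma binomialRandom_ncard_unconvinced_le (hp0 : 0 < (p : ℝ)) (hp1 : (p : ℝ) < 1) (hn : 2 ≤ n)
    (hC : 0 < C) (hCn : C ≤ n * (p * (1 - p))) (hη : 0 < η) (hη1 : η ≤ 1) (hτ₀ : 0 < τ₀)
    (hτn : 2 / (n : ℝ) ≤ 3 * τ₀ ^ 2) (hβ : β = (√n)⁻¹ * p * (2 * R.card - n) / √(p * (1 - p)))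
    (hstep : ∀ τ, τ₀ ≤ τ → τ ≤ 2 * τ₀ → ∀ y ≤ 1 / √C, 1 ≤ smoothStep η a τ y)
    (hH1 : ∀ y, smoothStep η a (√(τ₀ ^ 2 + 1)) y ≤ 1 + θ) (hθ : 0 ≤ θ)
    (hsum : ∀ y, smoothStep η a (√(τ₀ ^ 2 + 1)) y + smoothStep η a (√(τ₀ ^ 2 + 1)) (-y) ≤ 1 + θ)
    (hHΦ : ∀ y, |y| ≤ Y → smoothStep η a (√(τ₀ ^ 2 + 1)) y ≤ (1 + θ) * stdNormalCDF (-y))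
    (hΛ : Real.exp (lindebergConst η τ₀ * (n / √C)) ≤ (1 + θ) ^ n)
    (hnm : n = 2 * m + d) (hR : R.card = m + d)
    (hd : 1 ≤ stdNormalCDF (-Y) ^ d * (1 + θ) ^ n) (hβY : |β| + 1.18 ≤ Y) (hρ : 0 ≤ ρ)
    (htilt : ∀ γ, |γ| ≤ 1.18 → ∃ t, 1 ≤ t ∧
      4 * ((1 + t * stdNormalCDF (γ - β)) * (1 + t * stdNormalCDF (-γ - β))) ≤
        ρ * (t ^ (2 * ((k : ℝ) / n)) * Real.exp (γ ^ 2))) :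
    SimpleGraph.binomialRandom (Fin n) p {G | (unconvinced G (R : Set (Fin n))).ncard = k} ≤
      ENNReal.ofReal (((1 + θ) ^ 3 * max (√ρ) 0.998 / 2) ^ n * (2 * n + 1)) := by
  classical
  have hsub : {G : SimpleGraph (Fin n) | (unconvinced G (R : Set (Fin n))).ncard = k} ⊆
      ⋃ S ∈ Finset.powersetCard k (Finset.univ : Finset (Fin n)),
        {G | unconvinced G (R : Set (Fin n)) = (S : Set (Fin n))} := fun G hG ↦ by
    simp only [mem_iUnion, Finset.mem_powersetCard]
    refine ⟨(unconvinced G (R : Set (Fin n))).toFinset, ⟨Finset.subset_univ _, ?_⟩, by simp⟩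
    rw [← Set.ncard_eq_toFinset_card']
    exact hG
  have hH0 : ∀ y, 0 ≤ smoothStep η a (√(τ₀ ^ 2 + 1)) y := fun y ↦ hη.le.trans (le_smoothStep y)
  refine (measure_mono hsub).trans ((measure_biUnion_finset_le _ _).trans ?_)
  refine (Finset.sum_le_sum fun S _ ↦ binomialRandom_unconvinced_le_gaussian hp0 hp1 hn hC hCn hη
    hη1 hτ₀ hτn hβ hstep S).trans ?_
  rw [← Finset.mul_sum, ← lintegral_finsetSum]
  · have hconfig : ∀ z : ℝ, ∑ S ∈ Finset.powersetCard k (Finset.univ : Finset (Fin n)),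
        ∏ v, ENNReal.ofReal (smoothStep η a (√(τ₀ ^ 2 + 1))
          (spin S v * (β + spin R v * (z / √n)))) =
        ENNReal.ofReal (configSum k (smoothStep η a (√(τ₀ ^ 2 + 1))) β R (z / √n)) := fun z ↦ by
      unfold configSum
      rw [ENNReal.ofReal_sum_of_nonneg fun S _ ↦ Finset.prod_nonneg fun v _ ↦ hH0 _]
      exact Finset.sum_congr rfl fun S _ ↦ (ENNReal.ofReal_prod_of_nonneg fun v _ ↦ hH0 _).symm
    simp_rw [hconfig]
    have h1 := lintegral_configSum_le (k := k) hH0 hH1 hθ hsum hHΦ hnm hR (by omega) hd hβY hρ htilt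
    refine (mul_le_mul' (ENNReal.ofReal_le_ofReal hΛ) h1).trans ?_
    rw [← ENNReal.ofReal_mul (by positivity)]
    refine ENNReal.ofReal_le_ofReal ?_
    set M := max (√ρ) 0.998 with hM
    have hM0 : 0 < M := lt_max_of_lt_right (by norm_num)
    have h2 : (√ρ / 2) ^ n ≤ (M / 2) ^ n := by
      gcongr
      exact le_max_left _ _
    have h3 : (0.499 : ℝ) ^ n ≤ (M / 2) ^ n := by
      refine pow_le_pow_left₀ (by norm_num) ?_ n
      have : (0.998 : ℝ) ≤ M := le_max_right _ _
      norm_num at this ⊢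
      linarith
    have h4 : 1.18 * √(n : ℝ) ≤ 2 * n := by
      have h5 : (1 : ℝ) ≤ n := by exact_mod_cast (show 1 ≤ n by omega)
      have h6 : √(n : ℝ) ≤ n := Real.sqrt_le_iff.2 ⟨by linarith, by nlinarith⟩
      norm_num
      linarith
    have hθn : 1 ≤ (1 + θ) ^ n := one_le_pow₀ (by linarith)
    calc _ ≤ (1 + θ) ^ n * ((1 + θ) ^ (2 * n) * (M / 2) ^ n * (2 * n) +
          (1 + θ) ^ (2 * n) * (M / 2) ^ n) := by
          gcongr
          · linarith
          · omega
      _ = _ := by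
          rw [two_mul, pow_add, mul_div_assoc, mul_pow ((1 + θ) ^ 3), ← pow_mul,
            show 3 * n = n + n + n by ring, pow_add, pow_add]
          ring
  · intro S _
    refine Finset.measurable_fun_prod _ fun v _ ↦ ENNReal.measurable_ofReal.comp
      (continuous_smoothStep.measurable.comp (by fun_prop))

end FixedSet

/-! ### Uniformity over all sets -/

lemma unconvinced_subset_of_subset {V : Type*} [Finite V] (G : SimpleGraph V) {R R' : Set V}
    (h : R' ⊆ R) : unconvinced G R ⊆ unconvinced G R' := fun v hv ↦ by
  have h1 : (G.neighborSet v ∩ R').ncard ≤ (G.neighborSet v ∩ R).ncard :=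
    Set.ncard_le_ncard (inter_subset_inter_right _ h) (Set.toFinite _)
  have h2 : (G.neighborSet v ∩ Rᶜ).ncard ≤ (G.neighborSet v ∩ R'ᶜ).ncard :=
    Set.ncard_le_ncard (inter_subset_inter_right _ (compl_subset_compl.2 h)) (Set.toFinite _)
  exact h1.trans (le_trans hv h2)

lemma exists_stdNormalCDF_rpow_le {ε : ℝ} (hε : 0 < ε) :
    ∃ K, 0 ≤ K ∧ stdNormalCDF (-(2 * K)) ^ ε ≤ 1 / 8 := by
  have h1 : Tendsto (fun K : ℝ ↦ stdNormalCDF (-(2 * K))) atTop (𝓝 0) :=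
    tendsto_stdNormalCDF_atBot.comp
      (tendsto_neg_atTop_atBot.comp (tendsto_id.const_mul_atTop two_pos))
  have h2 : (0 : ℝ) < (1 / 8) ^ (1 / ε) := by positivity
  obtain ⟨K, hK, hK0⟩ :=
    ((h1.eventually (eventually_le_nhds h2)).and (eventually_ge_atTop 0)).exists
  refine ⟨K, hK0, (Real.rpow_le_rpow (stdNormalCDF_pos _).le hK hε.le).trans_eq ?_⟩
  rw [← Real.rpow_mul (by norm_num), one_div_mul_cancel hε.ne', Real.rpow_one]

section Reduction

variable {n : ℕ} {p : ℝ}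

/-- The mean field of a set `R` of vertices, in units of the standard deviation of a degree. -/
noncomputable def meanField (n : ℕ) (p : ℝ) (r : ℕ) : ℝ :=
  (√n)⁻¹ * p * (2 * r - n) / √(p * (1 - p))

/-- The mean field of `R` is `2 α` when `R` has exactly `n / 2 + α √(n (1 - p) / p)` elements. -/
lemma meanField_mul_sqrt (hp0 : 0 < p) (hp1 : p < 1) (hn : 0 < n) (r : ℕ) :
    meanField n p r * √((n : ℝ) * (1 - p) / p) = 2 * r - n := by
  have hn' : (0 : ℝ) < n := by exact_mod_cast hn
  have hq : 0 < 1 - p := by linarith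
  have h1 : √((n : ℝ) * (1 - p) / p) = √n * √(p * (1 - p)) / p := by
    rw [← Real.sqrt_mul hn'.le, eq_div_iff hp0.ne']
    calc _ = √((n : ℝ) * (1 - p) / p) * √(p ^ 2) := by rw [Real.sqrt_sq hp0.le]
      _ = _ := by
        rw [← Real.sqrt_mul (by positivity)]
        congr 1
        field_simp
  have h2 : 0 < √(p * (1 - p)) := Real.sqrt_pos.2 (by positivity)
  have h3 : 0 < √(n : ℝ) := Real.sqrt_pos.2 hn'
  rw [h1, meanField]
  field_simp

/-- If some large `R` leaves too many vertices unconvinced, then so does a set with a bounded mean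
field, and the fraction of unconvinced vertices may serve as `δ`. -/
lemma exists_bounded_of_bad {ε K δ α : ℝ} (hε : 0 < ε) (hε1 : ε ≤ 1 / 10)
    (hK : stdNormalCDF (-(2 * K)) ^ ε ≤ 1 / 8) (hp0 : 0 < p) (hp1 : p < 1)
    (hnp : 1 ≤ n * (p * (1 - p))) (hδ : ε < δ) (hδ1 : δ < 1) (G : SimpleGraph (Fin n))
    {R : Set (Fin n)} (hR : (n : ℝ) / 2 + α * √((n : ℝ) * (1 - p) / p) ≤ (R.ncard : ℝ))
    (hα : stdNormalCDF (-(2 * α)) ^ δ ≤ 1 / 4 - ε) (hbad : δ * n < (unconvinced G R).ncard) :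
    ∃ R' : Finset (Fin n), n ≤ 2 * R'.card ∧ meanField n p R'.card ≤ 2 * (K + 1) ∧
      stdNormalCDF (-meanField n p R'.card) ^
        (((unconvinced G (R' : Set (Fin n))).ncard : ℝ) / n) ≤ 1 / 4 - ε := by
  have hn : 0 < n := by
    rcases Nat.eq_zero_or_pos n with rfl | h
    · norm_num at hnp
    · exact h
  have hn' : (0 : ℝ) < n := by exact_mod_cast hn
  classical
  set s := √((n : ℝ) * (1 - p) / p) with hs
  have hs1 : 1 ≤ s := by
    refine Real.one_le_sqrt.2 (hnp.trans ?_)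
    rw [le_div_iff₀ hp0]
    have : 0 ≤ (n : ℝ) * (1 - p) := mul_nonneg hn'.le (by linarith)
    nlinarith [mul_nonneg this (show 0 ≤ 1 - p ^ 2 by nlinarith)]
  -- Shrink `R` to the least admissible size for a threshold `α` that is at most `K`.
  set α' := min α K with hα'
  have hα'Φ : stdNormalCDF (-(2 * α')) ^ δ ≤ 1 / 4 - ε := by
    rcases min_choice α K with h | h
    · rwa [hα', h]
    · rw [hα', h]
      refine (Real.rpow_le_rpow_of_exponent_ge (stdNormalCDF_pos _) (stdNormalCDF_le_one _)
        hδ.le).trans (hK.trans (by linarith))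
  have hα'0 : 0 < 2 * α' := pos_of_stdNormalCDF_rpow_le (hε.trans hδ) hδ1.le (by linarith)
  set r := ⌈(n : ℝ) / 2 + α' * s⌉₊ with hr
  have hr1 : (n : ℝ) / 2 + α' * s ≤ r := Nat.le_ceil _
  have hr2 : (r : ℝ) < (n : ℝ) / 2 + α' * s + 1 := Nat.ceil_lt_add_one (by
    have : 0 ≤ α' * s := mul_nonneg (by linarith) (by linarith)
    positivity)
  have hrR : r ≤ R.toFinset.card := by
    rw [← Set.ncard_eq_toFinset_card']
    refine Nat.ceil_le.2 (le_trans ?_ hR)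
    gcongr
    exact min_le_left _ _
  obtain ⟨R', hR'R, hR'r⟩ := Finset.exists_subset_card_eq hrR
  have hmul := meanField_mul_sqrt hp0 hp1 hn r
  rw [← hs] at hmul
  have hβ1 : 2 * α' ≤ meanField n p r := by
    refine le_of_mul_le_mul_right (a := s) ?_ (by linarith)
    rw [hmul]
    linarith
  have hβ2 : meanField n p r ≤ 2 * (K + 1) := by
    refine le_of_mul_le_mul_right (a := s) ?_ (by linarith)
    rw [hmul]
    have : α' * s ≤ K * s := mul_le_mul_of_nonneg_right (min_le_right _ _) (by linarith)
    nlinarith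
  have hsub : (R' : Set (Fin n)) ⊆ R := by
    intro v hv
    simpa using hR'R hv
  have hcard : (unconvinced G R).ncard ≤ (unconvinced G (R' : Set (Fin n))).ncard :=
    Set.ncard_le_ncard (unconvinced_subset_of_subset G hsub) (Set.toFinite _)
  refine ⟨R', ?_, ?_, ?_⟩
  · rw [hR'r]
    have : 0 < α' * s := mul_pos (by linarith) (by linarith)
    have h2 : (n : ℝ) ≤ ((2 * r : ℕ) : ℝ) := by
      push_cast
      linarith
    exact_mod_cast h2
  · rwa [hR'r]
  · rw [hR'r]
    have h1 : δ ≤ ((unconvinced G (R' : Set (Fin n))).ncard : ℝ) / n := by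
      rw [le_div_iff₀ hn']
      have : ((unconvinced G R).ncard : ℝ) ≤ (unconvinced G (R' : Set (Fin n))).ncard := by
        exact_mod_cast hcard
      linarith
    calc _ ≤ stdNormalCDF (-meanField n p r) ^ δ :=
          Real.rpow_le_rpow_of_exponent_ge (stdNormalCDF_pos _) (stdNormalCDF_le_one _) h1
      _ ≤ stdNormalCDF (-(2 * α')) ^ δ :=
          Real.rpow_le_rpow (stdNormalCDF_pos _).le
            (strictMono_stdNormalCDF.monotone (by linarith)) (hε.trans hδ).le
      _ ≤ _ := hα'Φ

end Reduction

lemma eventually_polynomial_mul_pow_le {M q : ℝ} (hM : 0 ≤ M) (hMq : M < q) :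
    ∀ᶠ n : ℕ in atTop, (n + 1 : ℝ) * (2 * n + 1) * M ^ n ≤ q ^ n := by
  have hq : 0 < q := hM.trans_lt hMq
  have hr : |M / q| < 1 := by
    rw [abs_of_nonneg (by positivity), div_lt_one hq]
    exact hMq
  have h : Tendsto (fun n : ℕ ↦ 2 * ((n : ℝ) ^ 2 * (M / q) ^ n) + 3 * ((n : ℝ) ^ 1 * (M / q) ^ n) +
      (n : ℝ) ^ 0 * (M / q) ^ n) atTop (𝓝 (2 * 0 + 3 * 0 + 0)) :=
    (((tendsto_pow_const_mul_const_pow_of_abs_lt_one 2 hr).const_mul 2).add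
      ((tendsto_pow_const_mul_const_pow_of_abs_lt_one 1 hr).const_mul 3)).add
      (tendsto_pow_const_mul_const_pow_of_abs_lt_one 0 hr)
  filter_upwards [h.eventually (eventually_le_nhds (show 2 * 0 + 3 * 0 + 0 < (1 : ℝ) by norm_num))]
    with n hn
  have hqn : 0 < q ^ n := by positivity
  rw [← div_le_one₀ hqn, mul_div_assoc, ← div_pow]
  refine le_trans (le_of_eq ?_) hn
  ring

/-- A set with a bounded mean field is almost balanced. -/
lemma one_le_pow_mul_pow_of_meanField_le {n : ℕ} {p C L φ x : ℝ} {r : ℕ} (hp0 : 0 < p)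
    (hp1 : p < 1) (hn : 0 < n) (hC : 0 < C) (hCn : C ≤ n * (p * (1 - p))) (hr : n ≤ 2 * r)
    (hL : 0 ≤ L) (hrL : meanField n p r ≤ L) (hφ0 : 0 < φ) (hφ1 : φ ≤ 1)
    (hx : Real.exp (L * (-Real.log φ) * (n / √C)) ≤ x ^ n) :
    1 ≤ φ ^ (2 * r - n) * x ^ n := by
  have hn' : (0 : ℝ) < n := by exact_mod_cast hn
  have hq : 0 < 1 - p := by linarith
  have hφl : 0 ≤ -Real.log φ := by
    have := Real.log_nonpos hφ0.le hφ1
    linarith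
  have hd1 : ((2 * r - n : ℕ) : ℝ) ≤ L * (n / √C) := by
    rw [Nat.cast_sub hr]
    push_cast
    rw [← meanField_mul_sqrt hp0 hp1 hn r]
    have h1 : √((n : ℝ) * (1 - p) / p) ≤ n / √C := by
      rw [le_div_iff₀ (Real.sqrt_pos.2 hC)]
      calc _ ≤ √((n : ℝ) * (1 - p) / p) * √(n * (p * (1 - p))) := by gcongr
        _ = √(((n : ℝ) * (1 - p)) ^ 2) := by
          rw [← Real.sqrt_mul (by positivity)]
          congr 1
          field_simp
        _ = n * (1 - p) := Real.sqrt_sq (by positivity)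
        _ ≤ n := mul_le_of_le_one_right hn'.le (by linarith)
    gcongr
  have h3 : 1 ≤ φ ^ (2 * r - n) * Real.exp (L * (-Real.log φ) * (n / √C)) := by
    have h4 : φ ^ (2 * r - n) = Real.exp ((2 * r - n : ℕ) * Real.log φ) := by
      rw [Real.exp_nat_mul, Real.exp_log hφ0]
    rw [h4, ← Real.exp_add]
    refine Real.one_le_exp ?_
    nlinarith
  exact h3.trans (mul_le_mul_of_nonneg_left hx (by positivity))

/-- The constants: `1 + θ` is a factor per vertex that absorbs the smoothing, the exchange and the
imbalance between `R` and its complement, and `M₁ / 2` is the resulting bound per vertex for the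
probability of failure of a fixed set. A large `C` makes the exchange and the imbalance cheap and
the error of one edge in the field smaller than the smoothing scale `a`. The field is bounded by
`2 (K + 1) + 1.18`: a mean field of at most `2 (K + 1)` is shifted by `γ` with `|γ| ≤ 1.18`. -/
lemma exists_params {K ρ : ℝ} (hK0 : 0 ≤ K) (hρ1 : ρ < 1) :
    ∃ θ M₁ η a τ₀ C : ℝ, 0 < θ ∧ 0 < M₁ ∧ M₁ < 1 ∧ M₁ = (1 + θ) ^ 3 * max (√ρ) 0.998 ∧
      0 < η ∧ η ≤ 1 ∧ 0 < τ₀ ∧ 2 ≤ C ∧ 2 / C ≤ 3 * τ₀ ^ 2 ∧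
      (∀ τ, τ₀ ≤ τ → τ ≤ 2 * τ₀ → ∀ y ≤ 1 / √C, 1 ≤ smoothStep η a τ y) ∧
      (∀ y, smoothStep η a (√(τ₀ ^ 2 + 1)) y ≤ 1 + θ) ∧
      (∀ y, smoothStep η a (√(τ₀ ^ 2 + 1)) y + smoothStep η a (√(τ₀ ^ 2 + 1)) (-y) ≤ 1 + θ) ∧
      (∀ y, |y| ≤ 2 * (K + 1) + 1.18 →
        smoothStep η a (√(τ₀ ^ 2 + 1)) y ≤ (1 + θ) * stdNormalCDF (-y)) ∧
      (∀ n : ℕ, Real.exp (lindebergConst η τ₀ * (n / √C)) ≤ (1 + θ) ^ n) ∧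
      ∀ n : ℕ, Real.exp (2 * (K + 1) * (-Real.log (stdNormalCDF (-(2 * (K + 1) + 1.18)))) *
        (n / √C)) ≤ (1 + θ) ^ n := by
  set M := max (√ρ) 0.998 with hM
  have hM0 : 0 < M := lt_max_of_lt_right (by norm_num)
  have hM1 : M < 1 := max_lt ((Real.sqrt_lt' one_pos).2 (by simpa using hρ1)) (by norm_num)
  -- Three factors `1 + θ` must not spoil `M < 1`.
  set θ := (1 - M) / 8 with hθ
  have hθ0 : 0 < θ := by rw [hθ]; linarith
  have hθ1 : θ ≤ 1 := by rw [hθ]; linarith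
  have hM₁1 : (1 + θ) ^ 3 * M < 1 := by
    have h1 : (1 + θ) ^ 3 ≤ 1 + 7 * θ := by nlinarith [mul_pos hθ0 hθ0]
    have h2 : (1 + 7 * θ) * M < 1 := by rw [hθ]; nlinarith
    exact (mul_le_mul_of_nonneg_right h1 hM0.le).trans_lt h2
  have hY0 : 0 ≤ 2 * (K + 1) + 1.18 := by positivity
  obtain ⟨η, a, τ₀, hη, hη1, ha, hτ₀, hstep, hH1, hsum, hHΦ⟩ :=
    exists_smoothing_parameters hθ0 hθ1 hY0
  set l := Real.log (1 + θ) with hl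
  have hl0 : 0 < l := Real.log_pos (by linarith)
  set x := 2 * (K + 1) * (-Real.log (stdNormalCDF (-(2 * (K + 1) + 1.18)))) with hx
  have hx0 : 0 ≤ x := by
    have := Real.log_nonpos (stdNormalCDF_pos (-(2 * (K + 1) + 1.18))).le (stdNormalCDF_le_one _)
    exact mul_nonneg (by linarith) (by linarith)
  have hΛ0 := lindebergConst_nonneg (η := η) hτ₀
  have hsqrt : ∀ c : ℝ, 0 < c → ∀ᶠ C : ℝ in atTop, 1 / √C ≤ c := fun c hc ↦ by
    have : Tendsto (fun C : ℝ ↦ 1 / √C) atTop (𝓝 0) :=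
      Real.tendsto_sqrt_atTop.const_div_atTop 1
    exact this.eventually (eventually_le_nhds hc)
  obtain ⟨C, hC1, hC2, hC3, hC4, hC6⟩ := ((hsqrt (a / 2) (by positivity)).and
    ((hsqrt (l / (lindebergConst η τ₀ + 1)) (by positivity)).and
    ((hsqrt (l / (x + 1)) (by positivity)).and
    ((eventually_ge_atTop 2).and (eventually_ge_atTop (2 / (3 * τ₀ ^ 2))))))).exists
  have hC0 : 0 < C := by linarith
  have hexp : ∀ y : ℝ, 0 ≤ y → 1 / √C ≤ l / (y + 1) → ∀ n : ℕ,
      Real.exp (y * (n / √C)) ≤ (1 + θ) ^ n := fun y hy h n ↦ by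
    have h1 : y * (1 / √C) ≤ l := by
      rw [le_div_iff₀ (by linarith)] at h
      have : 0 ≤ 1 / √C := by positivity
      nlinarith
    rw [← Real.exp_log (show 0 < 1 + θ by linarith), ← Real.exp_nat_mul]
    refine Real.exp_le_exp.2 ?_
    calc y * (n / √C) = n * (y * (1 / √C)) := by ring
      _ ≤ n * l := by gcongr
  refine ⟨θ, _, η, a, τ₀, C, hθ0, by positivity, hM₁1, rfl, hη, hη1, hτ₀, hC4, ?_,
    fun τ h1 h2 y hy ↦ hstep τ h1 h2 y (hy.trans hC1), hH1, hsum, hHΦ, hexp _ hΛ0 hC2,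
    hexp _ hx0 hC3⟩
  rw [div_le_iff₀ (by positivity)] at hC6
  rw [div_le_iff₀ hC0]
  linarith

/-- The bound for a fixed set `R` and a fixed number `k` of unconvinced vertices beats the number
of choices of `R`. -/
lemma exists_const_fixed_set {ε K : ℝ} (hε : 0 < ε) (hε1 : ε ≤ 1 / 10) (hK0 : 0 ≤ K) :
    ∃ M₁ C : ℝ, 0 < M₁ ∧ M₁ < 1 ∧ 2 ≤ C ∧ ∀ (n : ℕ) (p : unitInterval), 0 < (p : ℝ) →
      (p : ℝ) < 1 → C ≤ n * (p * (1 - p)) → ∀ (R : Finset (Fin n)) (k : ℕ), k ≤ n →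
      n ≤ 2 * R.card → meanField n p R.card ≤ 2 * (K + 1) →
      stdNormalCDF (-meanField n p R.card) ^ ((k : ℝ) / n) ≤ 1 / 4 - ε →
      SimpleGraph.binomialRandom (Fin n) p {G | (unconvinced G (R : Set (Fin n))).ncard = k} ≤
        ENNReal.ofReal ((M₁ / 2) ^ n * (2 * n + 1)) := by
  obtain ⟨ρ, hρ0, hρ1, htilt⟩ := exists_tilt hε hε1
  obtain ⟨θ, M₁, η, a, τ₀, C, hθ0, hM₁0, hM₁1, hM₁, hη, hη1, hτ₀, hC2, hCτ, hstep, hH1, hsum, hHΦ,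
    hΛ, hx⟩ := exists_params hK0 hρ1
  refine ⟨M₁, C, hM₁0, hM₁1, hC2, fun n p hp0 hp1 hnp R k hkn hR1 hR2 hR3 ↦ ?_⟩
  have hC0 : 0 < C := by linarith
  have hnC : C ≤ n := by
    have h1 : (p : ℝ) * (1 - p) ≤ 1 := by nlinarith
    have h2 : (n : ℝ) * (p * (1 - p)) ≤ n := mul_le_of_le_one_right (Nat.cast_nonneg n) h1
    linarith
  have hn' : (0 : ℝ) < n := by linarith
  have hn2 : 2 ≤ n := by exact_mod_cast hC2.trans hnC
  have hRn : R.card ≤ n := by simpa using R.card_le_univ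
  have hk : 0 < (k : ℝ) / n := by
    rcases Nat.eq_zero_or_pos k with rfl | h
    · norm_num at hR3
      linarith
    · have : (0 : ℝ) < k := by exact_mod_cast h
      positivity
  have hk1 : (k : ℝ) / n ≤ 1 := by
    rw [div_le_one₀ hn']
    exact_mod_cast hkn
  have hβ0 : 0 < meanField n p R.card :=
    pos_of_stdNormalCDF_rpow_le hk hk1 (by linarith)
  have hd := one_le_pow_mul_pow_of_meanField_le hp0 hp1 (by omega) hC0 hnp hR1 (by positivity) hR2
    (stdNormalCDF_pos _) (stdNormalCDF_le_one _) (hx n)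
  have hτn : 2 / (n : ℝ) ≤ 3 * τ₀ ^ 2 := le_trans (by gcongr) hCτ
  rw [hM₁]
  refine binomialRandom_ncard_unconvinced_le (β := meanField n p R.card) (m := n - R.card)
    (d := 2 * R.card - n) hp0 hp1 hn2 hC0 hnp hη hη1 hτ₀ hτn rfl hstep hH1 hθ0.le hsum hHΦ (hΛ n)
    (by omega) (by omega) hd ?_ hρ0.le fun γ hγ ↦ ?_
  · rw [abs_of_pos hβ0]
    linarith
  · have h1 := htilt ((k : ℝ) / n) (meanField n p R.card / 2) hk
      (by rwa [mul_div_cancel₀ _ (two_ne_zero)]) hk1 γ hγ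
    rwa [mul_div_cancel₀ _ (two_ne_zero)] at h1

/-- Uniformly over all admissible `δ`, `α` and `R`, few vertices are unconvinced. -/
lemma exists_const_binomialRandom_unconvinced {ε : ℝ} (hε : 0 < ε) :
    ∃ C q : ℝ, 0 < C ∧ 0 < q ∧ q < 1 ∧
      ∀ (n : ℕ) (p : unitInterval), C < (n : ℝ) * p * (1 - p) →
        1 - q ^ n ≤ (SimpleGraph.binomialRandom (Fin n) p).real
          {G | ∀ (δ α : ℝ) (R : Set (Fin n)), ε < δ → δ < 1 - ε →
            (n : ℝ) / 2 + α * √((n : ℝ) * (1 - p) / p) ≤ (R.ncard : ℝ) →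
            leadSup α δ ≤ 1 / 4 - ε →
            ((unconvinced G R).ncard : ℝ) ≤ δ * n} := by
  set ε₁ := min ε (1 / 10) with hε₁
  have hε₁0 : 0 < ε₁ := lt_min hε (by norm_num)
  have hε₁1 : ε₁ ≤ 1 / 10 := min_le_right _ _
  obtain ⟨K, hK0, hK⟩ := exists_stdNormalCDF_rpow_le hε₁0
  obtain ⟨M₁, C, hM₁0, hM₁1, hC2, hfix⟩ := exists_const_fixed_set hε₁0 hε₁1 hK0
  set q := (1 + M₁) / 2 with hq
  obtain ⟨n₀, hn₀⟩ := eventually_atTop.1 (eventually_polynomial_mul_pow_le hM₁0.le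
    (show M₁ < q by rw [hq]; linarith))
  refine ⟨max C n₀, q, lt_max_of_lt_left (by linarith), by rw [hq]; linarith,
    by rw [hq]; linarith, fun n p hnp ↦ ?_⟩
  rw [mul_assoc] at hnp
  have hCnp : C < n * (p * (1 - p)) := (le_max_left _ _).trans_lt hnp
  have hv0 : 0 < (n : ℝ) * (p * (1 - p)) := by linarith
  have hp0 : 0 < (p : ℝ) := by
    rcases p.2.1.eq_or_lt with h | h
    · rw [← h] at hv0
      norm_num at hv0
    · exact h
  have hp1 : (p : ℝ) < 1 := by
    rcases p.2.2.eq_or_lt with h | h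
    · rw [h] at hv0
      norm_num at hv0
    · exact h
  have hnn₀ : n₀ ≤ n := by
    have h1 : (p : ℝ) * (1 - p) ≤ 1 := by nlinarith
    have h2 : (n : ℝ) * (p * (1 - p)) ≤ n := mul_le_of_le_one_right (Nat.cast_nonneg n) h1
    have h3 : (n₀ : ℝ) ≤ n := by linarith [le_max_right C (n₀ : ℝ)]
    exact_mod_cast h3
  set P := SimpleGraph.binomialRandom (Fin n) p with hP
  set B : ℝ := (M₁ / 2) ^ n * (2 * n + 1) with hB
  -- The exceptional event for a fixed set and a fixed number of unconvinced vertices; the last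
  -- three conditions do not depend on the graph.
  set E : Finset (Fin n) → ℕ → Set (SimpleGraph (Fin n)) := fun R k ↦
    {G | (unconvinced G (R : Set (Fin n))).ncard = k ∧ n ≤ 2 * R.card ∧
        meanField n p R.card ≤ 2 * (K + 1) ∧
        stdNormalCDF (-meanField n p R.card) ^ ((k : ℝ) / n) ≤ 1 / 4 - ε₁} with hE
  have hEle : ∀ R k, k ≤ n → P (E R k) ≤ ENNReal.ofReal B := by
    intro R k hkn
    by_cases hcond : n ≤ 2 * R.card ∧ meanField n p R.card ≤ 2 * (K + 1) ∧
        stdNormalCDF (-meanField n p R.card) ^ ((k : ℝ) / n) ≤ 1 / 4 - ε₁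
    · exact (measure_mono fun G hG ↦ hG.1).trans
        (hfix n p hp0 hp1 hCnp.le R k hkn hcond.1 hcond.2.1 hcond.2.2)
    · have hempty : E R k = ∅ := eq_empty_iff_forall_notMem.2 fun G hG ↦ hcond hG.2
      rw [hempty, measure_empty]
      exact zero_le
  set good := {G : SimpleGraph (Fin n) | ∀ (δ α : ℝ) (R : Set (Fin n)), ε < δ → δ < 1 - ε →
            (n : ℝ) / 2 + α * √((n : ℝ) * (1 - p) / p) ≤ (R.ncard : ℝ) →
            leadSup α δ ≤ 1 / 4 - ε →
            ((unconvinced G R).ncard : ℝ) ≤ δ * n} with hgood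
  have hcover : goodᶜ ⊆ ⋃ R : Finset (Fin n), ⋃ k ∈ Finset.range (n + 1), E R k := by
    intro G hG
    rw [hgood, mem_compl_iff, mem_ofPred_eq] at hG
    push Not at hG
    obtain ⟨δ, α, R, hδ, hδ1, hR, hlead, hbad⟩ := hG
    have hεδ : ε₁ < δ := (min_le_left _ _).trans_lt hδ
    have hδ1' : δ < 1 := by linarith
    have hα := stdNormalCDF_rpow_le_of_leadSup (hε₁0.trans hεδ) hδ1' hε₁1
      (hlead.trans (by linarith [min_le_left ε (1 / 10)]))
    obtain ⟨R', h1, h2, h3⟩ := exists_bounded_of_bad hε₁0 hε₁1 hK hp0 hp1 (by linarith) hεδ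
      hδ1' G hR hα hbad
    simp only [mem_iUnion, Finset.mem_range]
    refine ⟨R', (unconvinced G (R' : Set (Fin n))).ncard, ?_, rfl, h1, h2, h3⟩
    have := Set.ncard_le_card (unconvinced G (R' : Set (Fin n)))
    simp only [Nat.card_eq_fintype_card, Fintype.card_fin] at this
    omega
  have htotal : P goodᶜ ≤ ENNReal.ofReal (q ^ n) := by
    refine (measure_mono hcover).trans ?_
    calc _ ≤ ∑ R : Finset (Fin n), ∑ k ∈ Finset.range (n + 1), ENNReal.ofReal B := by
          refine (measure_iUnion_fintype_le _ _).trans (Finset.sum_le_sum fun R _ ↦ ?_)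
          refine (measure_biUnion_finset_le _ _).trans (Finset.sum_le_sum fun k hk ↦ ?_)
          exact hEle R k (by simpa [Nat.lt_succ_iff] using hk)
      _ = ENNReal.ofReal ((n + 1) * (2 * n + 1) * M₁ ^ n) := by
          rw [Finset.sum_const, Finset.sum_const, Finset.card_univ, Fintype.card_finset,
            Fintype.card_fin, Finset.card_range, ← ENNReal.ofReal_nsmul, ← ENNReal.ofReal_nsmul,
            nsmul_eq_mul, nsmul_eq_mul, hB, div_pow]
          congr 1
          push_cast
          field_simp
      _ ≤ _ := ENNReal.ofReal_le_ofReal (hn₀ n hnn₀)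
  have hreal : P.real goodᶜ ≤ q ^ n := by
    rw [measureReal_def]
    exact ENNReal.toReal_le_of_le_ofReal (by positivity) htotal
  rw [probReal_compl_eq_one_sub (measurableSet_simpleGraph _)] at hreal
  linarith

/-! ### The numerical example -/

lemma cubic_sub_le_exp_neg {y : ℝ} (h0 : 0 ≤ y) (h1 : y ≤ 1) :
    1 - y + y ^ 2 / 2 - y ^ 3 / 6 - 5 / 96 * y ^ 4 ≤ Real.exp (-y) := by
  have h := Real.exp_bound (x := -y) (by rwa [abs_neg, abs_of_nonneg h0]) (n := 4) (by norm_num)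
  rw [abs_neg, abs_of_nonneg h0] at h
  simp only [Finset.sum_range_succ, Finset.sum_range_zero, Nat.factorial] at h
  have := (abs_le.1 h).1
  norm_num at this ⊢
  linarith

lemma inv_sqrt_two_pi_ge : 0.3989 ≤ (√(2 * Real.pi))⁻¹ := by
  rw [le_inv_comm₀ (by norm_num) (by positivity)]
  refine Real.sqrt_le_iff.2 ⟨by norm_num, ?_⟩
  have := Real.pi_lt_d4
  norm_num at this ⊢
  linarith

/-- A lower bound for the normal distribution function by integrating the Taylor expansion of its
density. -/
lemma le_stdNormalCDF_of_le_one {x : ℝ} (h0 : 0 ≤ x) (h1 : x ≤ 1) :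
    1 / 2 + (√(2 * Real.pi))⁻¹ * (x - x ^ 3 / 6 + x ^ 5 / 40 - x ^ 7 / 336 - 5 / 13824 * x ^ 9) ≤
      stdNormalCDF x := by
  set c := (√(2 * Real.pi))⁻¹ with hc
  set g : ℝ → ℝ := fun x ↦ stdNormalCDF x -
    c * (x - x ^ 3 / 6 + x ^ 5 / 40 - x ^ 7 / 336 - 5 / 13824 * x ^ 9) with hg
  have hd : ∀ x, HasDerivAt g (stdNormalPDF x -
      c * (1 - x ^ 2 / 2 + x ^ 4 / 8 - x ^ 6 / 48 - 5 / 1536 * x ^ 8)) x := fun x ↦ by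
    refine ((hasDerivAt_stdNormalCDF x).sub (((((hasDerivAt_id x).sub
      ((hasDerivAt_pow 3 x).div_const 6)).add ((hasDerivAt_pow 5 x).div_const 40)).sub
      ((hasDerivAt_pow 7 x).div_const 336)).sub
      ((hasDerivAt_pow 9 x).const_mul (5 / 13824)) |>.const_mul c)).congr_deriv ?_
    push_cast
    ring
  have hmono : MonotoneOn g (Icc 0 1) := by
    refine monotoneOn_of_deriv_nonneg (convex_Icc 0 1)
      (fun x _ ↦ (hd x).continuousAt.continuousWithinAt)
      (fun x _ ↦ (hd x).differentiableAt.differentiableWithinAt) fun x hx ↦ ?_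
    rw [interior_Icc] at hx
    rw [(hd x).deriv, sub_nonneg]
    unfold stdNormalPDF
    refine mul_le_mul_of_nonneg_left ?_ (by positivity)
    have h2 := cubic_sub_le_exp_neg (y := x ^ 2 / 2) (by positivity) (by nlinarith [hx.1, hx.2])
    rw [neg_div]
    refine le_trans (le_of_eq ?_) h2
    ring
  have h2 := hmono ⟨le_rfl, zero_le_one⟩ ⟨h0, h1⟩ h0
  simp only [hg, stdNormalCDF_zero] at h2
  norm_num at h2 ⊢
  linarith

lemma stdNormalCDF_neg_nine_tenths_le : stdNormalCDF (-0.9) ≤ 0.1845 := by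
  have h1 := le_stdNormalCDF_of_le_one (x := 0.9) (by norm_num) (by norm_num)
  have h2 := inv_sqrt_two_pi_ge
  rw [stdNormalCDF_neg]
  norm_num at h1 h2 ⊢
  linarith

/-- The hazard rate at the tangent point, with explicit bounds. -/
lemma stdNormalHazard_neg_nine_tenths :
    1.43 ≤ stdNormalHazard (-0.9) ∧ stdNormalHazard (-0.9) ≤ 1.55 := by
  have hΦ := stdNormalCDF_neg_nine_tenths_le
  have hΦ0 := stdNormalCDF_pos (-0.9)
  constructor
  · have h1 := inv_sqrt_two_pi_ge
    have h2 := cubic_sub_le_exp_neg (y := 0.405) (by norm_num) (by norm_num)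
    have h3 : 0.3989 * 0.664 ≤ stdNormalPDF (-0.9) := by
      unfold stdNormalPDF
      rw [show -(-0.9 : ℝ) ^ 2 / 2 = -0.405 by norm_num]
      refine mul_le_mul h1 (le_trans (by norm_num) h2) (by norm_num) (by positivity)
    unfold stdNormalHazard
    rw [le_div_iff₀ hΦ0]
    norm_num at h3 hΦ ⊢
    linarith
  · have h1 := le_sq_stdNormalTail (x := 0.9) (by norm_num)
    rw [stdNormalTail] at h1
    rw [stdNormalHazard, div_le_iff₀ hΦ0, stdNormalPDF_neg]
    by_contra! hcon
    have h2 : 1.55 * stdNormalCDF (-0.9) * (0.65 * stdNormalCDF (-0.9)) ≤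
        stdNormalPDF 0.9 * (stdNormalPDF 0.9 - 0.9 * stdNormalCDF (-0.9)) := by
      refine mul_le_mul hcon.le ?_ (by positivity) (stdNormalPDF_pos _).le
      norm_num at hcon ⊢
      linarith
    have h3 := mul_pos hΦ0 hΦ0
    norm_num at h1 h2
    norm_num only at h3
    nlinarith

lemma log_stdNormalCDF_neg_nine_tenths_le : Real.log (stdNormalCDF (-0.9)) ≤ -1.687 := by
  refine (Real.log_le_log (stdNormalCDF_pos _) stdNormalCDF_neg_nine_tenths_le).trans ?_
  have h1 : Real.log 0.1845 ≤ -Real.log (2 * 2.71) := by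
    rw [← Real.log_inv]
    exact Real.log_le_log (by norm_num) (by norm_num)
  rw [Real.log_mul (by norm_num) (by norm_num)] at h1
  have h2 := log_two_add_le_log (x := 2.71) (by norm_num)
  have h3 := Real.log_two_gt_d9
  norm_num at h1 h2 h3 ⊢
  linarith

/-- With `log Φ` replaced by its tangent at `-0.9`, close to the argument of `Φ` at the maximum, the
exponent becomes a quadratic polynomial in `γ`, at most `-1.4 < log (1 / 4 - 10 ^ (-10))`. -/
lemma leadSup_numeric : leadSup 0.85 0.499 ≤ 1 / 4 - (10 : ℝ) ^ (-10 : ℤ) := by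
  obtain ⟨hm1, hm2⟩ := stdNormalHazard_neg_nine_tenths
  have hL := log_stdNormalCDF_neg_nine_tenths_le
  set m := stdNormalHazard (-0.9) with hm
  set s := √(1 - (0.499 : ℝ)) with hs
  have hs2 : s ^ 2 = 0.501 := by
    rw [hs, Real.sq_sqrt (by norm_num)]
    norm_num
  have hs0 : 0 < s := Real.sqrt_pos.2 (by norm_num)
  have hs1 : s ≤ 0.7079 := Real.sqrt_le_iff.2 ⟨by norm_num, by norm_num⟩
  have hinv : 1.4126 ≤ s⁻¹ := by
    rw [le_inv_comm₀ (by norm_num) hs0]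
    exact hs1.trans (by norm_num)
  have hinv2 : (s⁻¹) ^ 2 = 1 / 0.501 := by rw [inv_pow, hs2, one_div]
  have : Nonempty (Icc (0 : ℝ) 2) := ⟨⟨0, by simp⟩⟩
  refine ciSup_le fun ⟨γ, hγ⟩ ↦ ?_
  have htan := stdNormalCDF_le_mul_exp (-0.9) ((γ - 2 * 0.85) / s)
  have hexp : stdNormalCDF ((γ - 2 * 0.85) / s) ^ (0.499 : ℝ) ≤
      Real.exp (0.499 * (Real.log (stdNormalCDF (-0.9)) + m * ((γ - 2 * 0.85) / s - -0.9))) := by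
    refine (Real.rpow_le_rpow (stdNormalCDF_pos _).le htan (by norm_num)).trans_eq ?_
    rw [mul_comm (0.499 : ℝ), Real.exp_mul (Real.log _ + _) 0.499, Real.exp_add,
      Real.exp_log (stdNormalCDF_pos _)]
  have hE : -γ ^ 2 / 2 + 0.499 * (Real.log (stdNormalCDF (-0.9)) +
      m * ((γ - 2 * 0.85) / s - -0.9)) ≤ -1.4 := by
    have h1 : -γ ^ 2 / 2 + 0.499 * m * s⁻¹ * γ ≤ (0.499 * m) ^ 2 / (2 * 0.501) := by
      have h2 := sq_nonneg (γ - 0.499 * m * s⁻¹)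
      have h3 : (0.499 * m * s⁻¹) ^ 2 = (0.499 * m) ^ 2 / 0.501 := by rw [mul_pow, hinv2]; ring
      have h4 : (0.499 * m) ^ 2 / (2 * 0.501) = (0.499 * m * s⁻¹) ^ 2 / 2 := by rw [h3]; ring
      rw [h4]
      linarith
    have h4 : 0.499 * m * (0.9 - 1.7 * s⁻¹) ≤ 0.499 * m * (0.9 - 1.7 * 1.4126) := by
      have : 0 < m := by norm_num at hm1; linarith
      gcongr
    have h5 : (m - 1.43) * (m - 1.55) ≤ 0 :=
      mul_nonpos_of_nonneg_of_nonpos (by linarith) (by linarith)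
    have h6 : -γ ^ 2 / 2 + 0.499 * (Real.log (stdNormalCDF (-0.9)) +
        m * ((γ - 2 * 0.85) / s - -0.9)) = (-γ ^ 2 / 2 + 0.499 * m * s⁻¹ * γ) +
        0.499 * m * (0.9 - 1.7 * s⁻¹) + 0.499 * Real.log (stdNormalCDF (-0.9)) := by
      rw [div_eq_mul_inv (γ - 2 * 0.85)]
      ring
    rw [h6]
    norm_num at *
    nlinarith
  calc _ ≤ Real.exp (-γ ^ 2 / 2) * Real.exp (0.499 * (Real.log (stdNormalCDF (-0.9)) +
        m * ((γ - 2 * 0.85) / s - -0.9))) := by gcongr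
    _ ≤ Real.exp (-1.4) := by
      rw [← Real.exp_add]
      exact Real.exp_le_exp.2 hE
    _ ≤ 0.249 := by
      rw [Real.exp_neg, inv_le_comm₀ (Real.exp_pos _) (by norm_num)]
      exact le_trans (by norm_num) (taylor_le_exp (by norm_num))
    _ ≤ _ := by norm_num

theorem mainTheorem2 :
    (∀ ε : ℝ, 0 < ε → ∃ C q : ℝ, 0 < C ∧ 0 < q ∧ q < 1 ∧
      ∀ (n : ℕ) (p : unitInterval), C < (n : ℝ) * p * (1 - p) →
        1 - q ^ n ≤ (SimpleGraph.binomialRandom (Fin n) p).real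
          {G | ∀ (δ α : ℝ) (R : Set (Fin n)), ε < δ → δ < 1 - ε →
            (n : ℝ) / 2 + α * √((n : ℝ) * (1 - p) / p) ≤ (R.ncard : ℝ) →
            leadSup α δ ≤ 1 / 4 - ε →
            ((unconvinced G R).ncard : ℝ) ≤ δ * n}) ∧
    leadSup 0.85 0.499 ≤ 1 / 4 - (10 : ℝ) ^ (-10 : ℤ) ∧
    (∃ C q : ℝ, 0 < C ∧ 0 < q ∧ q < 1 ∧
      ∀ (n : ℕ) (p : unitInterval), C < (n : ℝ) * p * (1 - p) →
        1 - q ^ n ≤ (SimpleGraph.binomialRandom (Fin n) p).real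
          {G | ∀ R : Set (Fin n),
            (n : ℝ) / 2 + 0.85 * √((n : ℝ) * (1 - p) / p) ≤ (R.ncard : ℝ) →
            ((unconvinced G R).ncard : ℝ) ≤ 0.499 * n}) := by
  refine ⟨fun ε hε ↦ exists_const_binomialRandom_unconvinced hε, leadSup_numeric, ?_⟩
  obtain ⟨C, q, hC, hq0, hq1, h⟩ :=
    exists_const_binomialRandom_unconvinced (ε := (10 : ℝ) ^ (-10 : ℤ)) (by positivity)
  refine ⟨C, q, hC, hq0, hq1, fun n p hnp ↦ (h n p hnp).trans ?_⟩
  exact measureReal_mono fun G hG R hR ↦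
    hG 0.499 0.85 R (by norm_num) (by norm_num) hR leadSup_numeric
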